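/- **Setting.** A composition is a finite word of positive integers. For a composition $\alpha=(\alpha_1,\dots,\alpha_r)$ of $n$ let $D(\alpha)=\{\alpha_1,\alpha_1+\alpha_2,\dots,\alpha_1+\cdots+\alpha_{r-1}\}$, let $M_\alpha=\sum_{i_1<\cdots<i_r}x_{i_1}^{\alpha_1}\cdots x_{i_r}^{\alpha_r}$, and let $F_\alpha=\sum_{\beta}M_\beta$, the sum over all compositions $\beta$ of $n$ with $D(\alpha)\subseteq D(\beta)$. Let $\mathrm{QSym}$ be the ring with $\mathbb Z$-basis the $M_\alpha$ ($\alpha$ running over all compositions, including the empty one, $M_\emptyset=1$); the $F_\alpha$ are another $\mathbb Z$-basis. For $n\ge1$, a set $P\subseteq\{2,\dots,n-1\}$ such that $i\in P$ implies $i-1\notin P$ is called a peak subset, and for such a $P$ $$K_P=2^{|P|+1}\sum_{\alpha\vDash n,\ P\subseteq D(\alpha)\triangle(D(\alpha)+1)}F_\alpha .$$ The ring $\mathrm{PQSym}\subset\mathrm{QSym}$ of peak quasisymmetric functions is the ring generated by all the $K_P$, for all $n\ge 1$ (additively it is spanned by them and $1$). Stembridge's map $\vartheta:\mathrm{QSym}\to\mathrm{PQSym}$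 is the surjective ring homomorphism with $\vartheta(1)=1$ and $\vartheta(F_\alpha)=K_{P(\alpha)}$ for $\alpha\vDash n\geq 1$, where $P(\alpha)=\{i\in D(\alpha)\cap[2,n-1]:i-1\notin D(\alpha)\}$; put $L_\alpha=\vartheta(M_\alpha)$. Let $\Psi^k(M_\alpha)=M_{(k\alpha_1,\dots,k\alpha_r)}$ for $k\ge1$, and let $\Phi^k$ be the map on $\mathrm{PQSym}$ determined by $\Phi^k\circ\vartheta=\vartheta\circ\Psi^k$. The operations $\tilde\lambda^n$ are defined by $$\sum_{n\ge0}\tilde\lambda^n(f)t^n=\exp\Big(\sum_{k\ge1}(-1)^{k-1}\Phi^k(f)\frac{t^k}{k}\Big),\qquad f\in\mathrm{PQSym}.$$ A word is Lyndon if it is lexicographically smaller than each of its proper nonempty tails (a proper prefix of a word being smaller than the word). Let $\mathcal{EL}_{\mathrm{od}}$ be the set of nonempty compositions with all parts odd which are Lyndon words and are elementary, i.e. the greatest common divisor of the parts is $1$. For $\alpha\in\mathcal{EL}_{\mathrm{od}}$ and $n\ge0$ put $q_n(\alpha)=\tilde\lambda^n(L_\alpha)$, so that $q_0(\alpha)=1$.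 Let $q_n=\sum_{i=0}^n h_ie_{n-i}$, with $e_i$ and $h_i$ the elementary and the complete symmetric functions in $x_1,x_2,\dots$, and let $\Gamma$ be the ring generated by the $q_n$, $n\ge1$. For a ring $A$ put $A_{\mathbb Q}=A\otimes_{\mathbb Z}\mathbb Q$. **Theorem.** All $q_n(\alpha)$, $\alpha\in\mathcal{EL}_{\mathrm{od}}$, $n\ge1$, lie in $\mathrm{PQSym}$, and the following hold. (i) The ring $\mathrm{PQSym}$ is generated by $\{q_n(\alpha):\alpha\in\mathcal{EL}_{\mathrm{od}},\,n\ge1\}$, and the relations $$\sum_{i=0}^n(-1)^iq_i(\alpha)q_{n-i}(\alpha)=0\qquad(\alpha\in\mathcal{EL}_{\mathrm{od}},\ n\ge1)$$ are complete: the kernel of the ring homomorphism $\mathbb Z[Y_n(\alpha):\alpha\in\mathcal{EL}_{\mathrm{od}},n\ge1]\to\mathrm{PQSym}$, $Y_n(\alpha)\mapsto q_n(\alpha)$, is the ideal generated by the elements $\sum_{i=0}^n(-1)^iY_i(\alpha)Y_{n-i}(\alpha)$, $\alpha\in\mathcal{EL}_{\mathrm{od}}$, $n\ge1$, where $Y_0(\alpha)=1$.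 In particular, the products $\prod_{\alpha\in\mathcal{EL}_{\mathrm{od}}}q_{\lambda_\alpha}(\alpha)$, indexed by the families $(\lambda_\alpha)_{\alpha\in\mathcal{EL}_{\mathrm{od}}}$ of strict partitions of which only finitely many are nonempty, form a $\mathbb Z$-basis of $\mathrm{PQSym}$; here $q_\lambda(\alpha)=q_{\lambda_1}(\alpha)q_{\lambda_2}(\alpha)\cdots$. (ii) The elements $q_n(\alpha)$, $\alpha\in\mathcal{EL}_{\mathrm{od}}$, $n\ge1$ odd, form a free commutative polynomial basis of $\mathrm{PQSym}_{\mathbb Q}$, i.e. they are algebraically independent over $\mathbb Q$ and generate $\mathrm{PQSym}_{\mathbb Q}$ as a $\mathbb Q$-algebra. Moreover $q_n((1))=q_n$ for all $n\ge1$, so this basis contains the symmetric functions $q_n$, $n$ odd, and these form a free commutative polynomial basis of $\Gamma_{\mathbb Q}$. -/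

import Mathlib

open scoped TensorProduct

noncomputable section

namespace Peak

/-- The ambient ring: formal power series in the commuting variables `x_0, x_1, x_2, …`. The
rings of the theory (`QSym`, `PQSym`, `Γ`) consist of series with integer coefficients; they are
regarded here as subrings of the power series ring over `ℚ`. -/
abbrev Amb : Type := MvPowerSeries ℕ ℚ

/-- All compositions; the unique composition of `0` is the empty one. -/
abbrev Comp : Type := Σ n : ℕ, Composition n

/-- The descent set `{α₁, α₁ + α₂, …, α₁ + ⋯ + α_{r-1}}`. -/
def descents {n : ℕ} (c : Composition n) : Finset ℕ :=
  (Finset.Ioo 0 c.length).image c.sizeUpTo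

/-- The monomial quasisymmetric function `M_α`, the sum of all monomials
`x_{i₁}^{α₁} ⋯ x_{i_r}^{α_r}` with `i₁ < ⋯ < i_r`: the coefficient of a monomial is `1` if the
list of its nonzero exponents, in increasing order of the variables, is `α`, and `0` otherwise. -/
def monomialQ (c : Comp) : Amb :=
  fun m => if (m.support.sort (· ≤ ·)).map m = c.2.blocks then 1 else 0

/-- The fundamental quasisymmetric function `F_α`, the sum of `M_β` over all refinements `β`
of `α`. -/
def fundamentalQ (c : Comp) : Amb :=
  ∑ d : Composition c.1 with descents c.2 ⊆ descents d, monomialQ ⟨c.1, d⟩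

/-- The module of quasisymmetric functions over the integers. -/
def QSym : Submodule ℤ Amb := Submodule.span ℤ (Set.range monomialQ)

/-! ### The two bases of `QSym` -/

theorem mem_boundaries_iff {n : ℕ} (c : Composition n) (j : Fin (n + 1)) :
    j ∈ c.boundaries ↔ (j : ℕ) = 0 ∨ (j : ℕ) = n ∨ (j : ℕ) ∈ descents c := by
  constructor
  · intro h
    simp only [Composition.boundaries, Finset.mem_map, Finset.mem_univ, true_and] at h
    obtain ⟨i, rfl⟩ := h
    by_cases h0 : (i : ℕ) = 0
    · left
      have : i = 0 := Fin.ext h0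
      subst this
      simp
    by_cases h1 : (i : ℕ) = c.length
    · right; left
      have : i = Fin.last c.length := Fin.ext h1
      subst this
      simp
    · right; right
      refine Finset.mem_image.2 ⟨i, Finset.mem_Ioo.2 ⟨by omega, ?_⟩, rfl⟩
      have := i.2
      omega
  · rintro (h | h | h)
    · have : j = 0 := Fin.ext h
      subst this
      exact c.toCompositionAsSet.zero_mem
    · have : j = Fin.last n := Fin.ext h
      subst this
      exact c.toCompositionAsSet.getLast_mem
    · obtain ⟨i, hi, hij⟩ := Finset.mem_image.1 h
      rw [Finset.mem_Ioo] at hi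
      simp only [Composition.boundaries, Finset.mem_map, Finset.mem_univ, true_and]
      exact ⟨⟨i, by omega⟩, Fin.ext hij⟩

theorem descents_injective (n : ℕ) :
    Function.Injective (descents : Composition n → Finset ℕ) := by
  intro c d h
  apply (compositionEquiv n).injective
  apply CompositionAsSet.ext
  change c.boundaries = d.boundaries
  ext j
  rw [mem_boundaries_iff, mem_boundaries_iff, h]

/-- The monomial `x_0^{α₁} x_1^{α₂} ⋯`. -/
def stdExp (c : Comp) : ℕ →₀ ℕ := c.2.blocks.toFinsupp

theorem coeff_stdExp (c d : Comp) :
    MvPowerSeries.coeff (stdExp c) (monomialQ d) = if c = d then 1 else 0 := by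
  have hs : ((stdExp c).support.sort (· ≤ ·)).map (stdExp c) = c.2.blocks := by
    have h1 : (stdExp c).support = Finset.range c.2.blocks.length := by
      ext i
      simp only [stdExp, Finsupp.mem_support_iff, List.toFinsupp_apply, Finset.mem_range]
      constructor
      · intro h
        by_contra h'
        exact h (List.getD_eq_default _ _ (by omega))
      · intro h
        rw [List.getD_eq_getElem _ _ h]
        have := c.2.blocks_pos (List.getElem_mem h)
        omega
    rw [h1]
    have h2 : (Finset.range c.2.blocks.length).sort (· ≤ ·) = List.range c.2.blocks.length := by
      simp
    rw [h2]
    apply List.ext_getElem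
    · simp
    · intro i hi hi'
      simp [stdExp, hi']
  change (if ((stdExp c).support.sort (· ≤ ·)).map (stdExp c) = d.2.blocks then (1 : ℚ) else 0)
    = _
  rw [hs]
  exact if_congr Composition.sigma_eq_iff_blocks_eq.symm rfl rfl

theorem linearIndependent_monomialQ : LinearIndependent ℤ monomialQ := by
  rw [linearIndependent_iff']
  intro s g hg c hc
  have := congrArg (MvPowerSeries.coeff (R := ℚ) (stdExp c)) hg
  simp only [map_sum, map_zsmul, coeff_stdExp, map_zero] at this
  rw [Finset.sum_eq_single c] at this
  · simpa using this
  · intro d _ hd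
    simp [hd.symm]
  · exact fun h => absurd hc h

theorem coeff_stdExp_fundamentalQ (c d : Comp) :
    MvPowerSeries.coeff (stdExp c) (fundamentalQ d) =
      if c.1 = d.1 ∧ descents d.2 ⊆ descents c.2 then 1 else 0 := by
  simp only [fundamentalQ, map_sum, coeff_stdExp]
  split_ifs with h
  · obtain ⟨n, c⟩ := c
    obtain ⟨m, d⟩ := d
    obtain ⟨h1, h2⟩ := h
    dsimp only at h1 h2
    subst h1
    rw [Finset.sum_eq_single c]
    · simp
    · intro e _ he
      rw [if_neg]
      intro h
      simp only [Sigma.mk.injEq, heq_eq_eq, true_and] at h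
      exact he h.symm
    · intro h'
      simp [h2] at h'
  · apply Finset.sum_eq_zero
    intro e he
    rw [if_neg]
    rintro rfl
    exact h ⟨rfl, by simpa using he⟩

theorem linearIndependent_fundamentalQ : LinearIndependent ℤ fundamentalQ := by
  rw [linearIndependent_iff']
  intro s g hg
  by_contra! hne
  obtain ⟨c0, hc0, hgc0⟩ := hne
  obtain ⟨c, hc, hmin⟩ := Finset.exists_min_image (s.filter fun c => g c ≠ 0)
    (fun c => (descents c.2).card) ⟨c0, by simp [hc0, hgc0]⟩
  simp only [Finset.mem_filter] at hc hmin
  have := congrArg (MvPowerSeries.coeff (R := ℚ) (stdExp c)) hg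
  simp only [map_sum, map_zsmul, coeff_stdExp_fundamentalQ, map_zero] at this
  rw [Finset.sum_eq_single c] at this
  · simp [hc.2] at this
  · intro d hd hdc
    by_cases hgd : g d = 0
    · simp [hgd]
    rw [if_neg]
    · simp
    rintro ⟨h1, h2⟩
    have hcard := hmin d ⟨hd, hgd⟩
    have heq := Finset.eq_of_subset_of_card_le h2 hcard
    obtain ⟨n, c⟩ := c
    obtain ⟨m, d⟩ := d
    dsimp only at h1 heq
    subst h1
    exact hdc (by rw [descents_injective n heq])
  · exact fun h => absurd hc.1 h

theorem monomialQ_mem (c : Comp) : monomialQ c ∈ QSym :=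
  Submodule.subset_span ⟨c, rfl⟩

theorem fundamentalQ_mem (c : Comp) : fundamentalQ c ∈ QSym :=
  Submodule.sum_mem _ fun _ _ => monomialQ_mem _

theorem descents_subset_range {n : ℕ} (c : Composition n) :
    descents c ⊆ Finset.range (n + 1) := by
  intro i hi
  obtain ⟨j, _, rfl⟩ := Finset.mem_image.1 hi
  have := c.sizeUpTo_le j
  rw [Finset.mem_range]
  omega

theorem monomialQ_mem_span (c : Comp) :
    monomialQ c ∈ Submodule.span ℤ (Set.range fundamentalQ) := by
  obtain ⟨n, c⟩ := c
  induction hk : n + 1 - (descents c).card using Nat.strong_induction_on generalizing c with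
  | _ k ih =>
    have key : monomialQ ⟨n, c⟩ = fundamentalQ ⟨n, c⟩ -
        ∑ d ∈ (Finset.univ.filter fun d : Composition n => descents c ⊆ descents d).erase c,
          monomialQ ⟨n, d⟩ := by
      rw [eq_sub_iff_add_eq]
      exact Finset.add_sum_erase _ (fun d : Composition n => monomialQ ⟨n, d⟩) (by simp)
    rw [key]
    refine Submodule.sub_mem _ (Submodule.subset_span ⟨_, rfl⟩) (Submodule.sum_mem _ ?_)
    intro d hd
    simp only [Finset.mem_erase, Finset.mem_filter, Finset.mem_univ, true_and] at hd
    have hlt : (descents c).card < (descents d).card :=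
      Finset.card_lt_card (lt_of_le_of_ne hd.2 fun h => hd.1 (descents_injective n h).symm)
    have hle := Finset.card_le_card (descents_subset_range d)
    rw [Finset.card_range] at hle
    exact ih _ (by omega) d rfl

/-- The basis `M_α` of `QSym`. -/
def monomialBasis : Module.Basis Comp ℤ QSym := Module.Basis.span linearIndependent_monomialQ

/-- The basis `F_α` of `QSym`. -/
def fundamentalBasis : Module.Basis Comp ℤ QSym :=
  Module.Basis.mk (v := fun c => (⟨fundamentalQ c, fundamentalQ_mem c⟩ : QSym))
    (LinearIndependent.of_comp QSym.subtype linearIndependent_fundamentalQ)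
    (by
      rintro ⟨x, hx⟩ -
      have hle : QSym ≤ Submodule.span ℤ (Set.range fundamentalQ) := by
        refine Submodule.span_le.2 ?_
        rintro _ ⟨c, rfl⟩
        exact monomialQ_mem_span c
      have h := hle hx
      have h' : x ∈ (Submodule.span ℤ (Set.range fun c =>
          (⟨fundamentalQ c, fundamentalQ_mem c⟩ : QSym))).map QSym.subtype := by
        rw [Submodule.map_span, ← Set.range_comp]
        exact h
      obtain ⟨y, hy, rfl⟩ := h'
      exact hy)

/-! ### Peak quasisymmetric functions -/

/-- Peak subsets of `[n-1]`. -/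
def IsPeakSet (n : ℕ) (P : Finset ℕ) : Prop :=
  P ⊆ Finset.Icc 2 (n - 1) ∧ ∀ i ∈ P, i - 1 ∉ P

/-- The peak set of a composition. -/
def peakSet {n : ℕ} (c : Composition n) : Finset ℕ :=
  (descents c ∩ Finset.Icc 2 (n - 1)).filter fun i => i - 1 ∉ descents c

/-- Stembridge's peak function: `2^{|P|+1}` times the sum of the `F_α`, `α` a composition of `n`
with `P ⊆ D(α) △ (D(α) + 1)`. -/
def peakK (n : ℕ) (P : Finset ℕ) : Amb :=
  (2 : Amb) ^ (P.card + 1) *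
    ∑ c : Composition n with P ⊆ symmDiff (descents c) ((descents c).image (· + 1)),
      fundamentalQ ⟨n, c⟩

/-- The ring of peak quasisymmetric functions over the integers, generated by all peak
functions. -/
def PQSym : Subring Amb :=
  Subring.closure {f | ∃ (n : ℕ) (P : Finset ℕ), 1 ≤ n ∧ IsPeakSet n P ∧ f = peakK n P}

/-- Stembridge's descent-to-peak map `ϑ`, the linear map on `QSym` with `1 ↦ 1` and
`F_α ↦ K_{P(α)}`. -/
def theta : QSym →ₗ[ℤ] Amb :=
  fundamentalBasis.constr ℤ fun c => if c.1 = 0 then 1 else peakK c.1 (peakSet c.2)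

/-- The monomial peak function `L_α = ϑ(M_α)`. -/
def monomialPeak (c : Comp) : Amb := theta ⟨monomialQ c, monomialQ_mem c⟩

/-! ### The lambda operations on `PQSym` -/

/-- `k · α = (k α₁, …, k α_r)`. -/
def smulComp (k : ℕ+) (c : Comp) : Comp :=
  ⟨k * c.1,
    { blocks := c.2.blocks.map ((k : ℕ) * ·)
      blocks_pos := by
        intro i hi
        obtain ⟨j, hj, rfl⟩ := List.mem_map.1 hi
        exact Nat.mul_pos k.pos (c.2.blocks_pos hj)
      blocks_sum := by rw [List.sum_map_mul_left, List.map_id', c.2.blocks_sum] }⟩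

/-- The Adams operations `Ψ^k : M_α ↦ M_{k·α}` of the lambda ring `QSym`. -/
def adamsQ (k : ℕ+) : QSym →ₗ[ℤ] QSym :=
  monomialBasis.constr ℤ fun c => monomialBasis (smulComp k c)

/-- The Adams operations `Φ^k` of the lambda ring structure on `PQSym` for which `ϑ` is a morphism
of lambda rings: `Φ^k` is the factorization of `ϑ ∘ Ψ^k` through `ϑ`, that is,
`Φ^k (ϑ f) = ϑ (Ψ^k f)` (with value `0` outside the image of `ϑ`). -/
def adamsP (k : ℕ+) : Amb → Amb :=
  Function.extend theta (fun f => theta (adamsQ k f)) 0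

/-- The lambda operations of `PQSym` as a generating series in `t`:
`λ̃_t(f) = exp (∑_{k ≥ 1} (-1)^{k-1} Φ^k(f) t^k / k)`. -/
def lambdaSeries (f : Amb) : PowerSeries Amb :=
  (PowerSeries.exp ℚ).subst
    (PowerSeries.X * PowerSeries.mk fun j : ℕ =>
      ((-1 : ℚ) ^ j / (j + 1)) • adamsP j.succPNat f : PowerSeries Amb)

/-- The lambda operation `λ̃^n`. -/
def lambdaOp (n : ℕ) (f : Amb) : Amb := PowerSeries.coeff n (lambdaSeries f)

/-! ### Elementary Lyndon odd compositions -/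

/-- Lyndon words: smaller than each proper tail in the lexicographic order (in which a proper
prefix of a word is smaller than the word). -/
def IsLyndon (w : List ℕ) : Prop :=
  ∀ t : List ℕ, t <:+ w → t ≠ [] → t ≠ w → w < t

/-- Elementary Lyndon odd compositions. -/
def IsELod (c : Comp) : Prop :=
  c.1 ≠ 0 ∧ (∀ a ∈ c.2.blocks, Odd a) ∧ c.2.blocks.foldr Nat.gcd 0 = 1 ∧ IsLyndon c.2.blocks

/-- The type of elementary Lyndon odd compositions. -/
abbrev ELod : Type := {c : Comp // IsELod c}

/-- The composition `(1)`. -/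
def oneComp : ELod :=
  ⟨⟨1, Composition.ones 1⟩, by
    refine ⟨by simp, by simp, by simp, ?_⟩
    intro t ht h1 h2
    have hb : (Composition.ones 1).blocks = [1] := by simp
    dsimp only at ht h2
    rw [hb] at ht h2
    rcases List.suffix_cons_iff.1 ht with h | h
    · exact absurd h h2
    · exact absurd (List.suffix_nil.1 h) h1⟩

/-! ### Relations, strict partitions, polynomial bases -/

/-- The polynomial generator `Y_n(α)`, with the convention `Y_0(α) = 1`. -/
def genY (α : ELod) (n : ℕ) : MvPolynomial (ELod × ℕ+) ℤ :=
  if h : 0 < n then MvPolynomial.X (α, ⟨n, h⟩) else 1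

/-- The Euler relation `∑_{i=0}^n (-1)^i Y_i(α) Y_{n-i}(α)`. -/
def eulerRel (α : ELod) (n : ℕ) : MvPolynomial (ELod × ℕ+) ℤ :=
  ∑ i ∈ Finset.range (n + 1), (-1) ^ i * genY α i * genY α (n - i)

/-- Strict partitions, as strictly decreasing lists of positive integers. -/
def IsStrictPartition (l : List ℕ) : Prop := l.Pairwise (· > ·) ∧ ∀ a ∈ l, 0 < a

/-- Families of strict partitions indexed by `ELod`, all but finitely many of them empty. -/
abbrev StrictFamily : Type :=
  {l : ELod → List ℕ // (∀ α, IsStrictPartition (l α)) ∧ {α | l α ≠ []}.Finite}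

/-- A free commutative polynomial basis: algebraically independent and generating. -/
def IsPolynomialBasis (R : Type*) {A ι : Type*} [CommRing R] [CommRing A] [Algebra R A]
    (x : ι → A) : Prop :=
  AlgebraicIndependent R x ∧ Algebra.adjoin R (Set.range x) = ⊤

/-! ### The ring `Γ` -/

/-- The elementary symmetric function `e_n`. -/
def elemSym (n : ℕ) : Amb := fun m => if m.degree = n ∧ ∀ i ∈ m.support, m i = 1 then 1 else 0

/-- The complete symmetric function `h_n`. -/
def completeSym (n : ℕ) : Amb := fun m => if m.degree = n then 1 else 0

/-- The symmetric function `q_n = ∑_{i=0}^n h_i e_{n-i}`, the coefficient of `z^n` in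
`∏ (1 + x_i z) / (1 - x_i z)`. -/
def qSym (n : ℕ) : Amb := ∑ i ∈ Finset.range (n + 1), completeSym i * elemSym (n - i)

/-- The subring `Γ` generated by the `q_n`, `n ≥ 1`. -/
def Gam : Subring Amb := Subring.closure {f | ∃ n : ℕ, 1 ≤ n ∧ f = qSym n}

theorem qSym_mem (n : ℕ+) : qSym n ∈ Gam := Subring.subset_closure ⟨n, n.pos, rfl⟩

end Peak

end

/-!
The theorem is reduced to words. Let `nu` be the character of the quasi-shuffle algebra with
`nu [a] = 1 - (-1)^a` and `nu (a :: b :: w) = (-1)^(a+1) nu (b :: w)`. Cutting a word into consecutive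
pieces of prescribed sums and multiplying the values of a character on the pieces gives the
coefficients of a power series (`charSeries`), and these series multiply by quasi-shuffles
(`charSeries_mul`). The character `zeta` gives `M_w`, and `nu` gives `L_w = ϑ(M_w)`
(`theta_charSeries`). Hence `ϑ` is multiplicative, a part that is even can be merged with the next
one up to sign, and the `L_w` with all letters odd form a `ℤ`-basis of `PQSym` (`peakBasis`). The
operations `λ̃^n` on `L_w` satisfy Newton's identities with power sums `L_{kw}`
(`isNewton_lambdaL`), and they preserve integrality because they are images under `ϑ` of elementary
symmetric functions of the monomials in `M_w` (`lambdaL_mem`).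

For generation, order words of equal sum by length and then lexicographically. If `u₁ ≥ u₂ ≥ ⋯` are
Lyndon words in odd letters, the product of the `λ̃^m(L_u)` over the distinct `u` among them, `m`
being the multiplicity of `u`, is `L_w` plus smaller terms, where `w = u₁u₂⋯`
(`IsLyndonSeq.lyndonProd_sub_mem`). As every word is such a concatenation, the `λ̃^n(L_u)` generate
`PQSym`; and `u` is an odd multiple of an elementary word `α`, for which `λ̃^n(L_{dα})` is a
polynomial in the `λ̃^k(L_α)` (`lambdaL_scale_mem`), so that the `q_n(α)` generate.

Since `L_{kα} = 0` for even `k`, the series `∑ q_n(α) t^n` times its value at `-t` is `1`; these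
are the Euler relations. They allow every monomial to be rewritten as a combination of squarefree
ones (`mem_span_squarefree`). That the squarefree monomials are linearly independent is a matter of
counting: by binary expansion, they inject degree by degree into the multisets of pairs `(α, d)`
with `d` odd, and these inject into odd words, because the factorization of a word into
nonincreasing Lyndon words is unique; and a homogeneous spanning family no larger than a basis is
independent (`linearIndependent_of_span_eq_top`). Completeness of the relations follows, since
modulo the Euler relations nothing but squarefree monomials remains. Over `ℚ` the `q_n(α)` with `n`
odd suffice to generate, and the same count proves them algebraically independent. Finally
`q_n((1)) = L_{1^n} = q_n` (`lambdaL_one`).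
-/

namespace Peak

/-! ### Deconcatenation and the quasi-shuffle product of words -/

section Words

variable {R : Type*}

/-- The sum of `G u v` over all ways of cutting the word `w` as `u ++ v`. -/
def cutSum [AddCommMonoid R] (G : List ℕ → List ℕ → R) (w : List ℕ) : R :=
  ∑ i ∈ Finset.range (w.length + 1), G (w.take i) (w.drop i)

@[simp] theorem cutSum_nil [AddCommMonoid R] (G : List ℕ → List ℕ → R) :
    cutSum G [] = G [] [] := by simp [cutSum]

theorem cutSum_cons [AddCommMonoid R] (G : List ℕ → List ℕ → R) (a : ℕ) (w : List ℕ) :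
    cutSum G (a :: w) = G [] (a :: w) + cutSum (fun u v => G (a :: u) v) w := by
  rw [cutSum, List.length_cons, Finset.sum_range_succ', add_comm]
  simp [cutSum]

theorem cutSum_add [AddCommMonoid R] (G H : List ℕ → List ℕ → R) (w : List ℕ) :
    cutSum (fun u v => G u v + H u v) w = cutSum G w + cutSum H w :=
  Finset.sum_add_distrib

theorem mul_cutSum [CommSemiring R] (c : R) (G : List ℕ → List ℕ → R) (w : List ℕ) :
    c * cutSum G w = cutSum (fun u v => c * G u v) w := Finset.mul_sum _ _ _

theorem cutSum_mul [CommSemiring R] (c : R) (G : List ℕ → List ℕ → R) (w : List ℕ) :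
    cutSum G w * c = cutSum (fun u v => G u v * c) w := Finset.sum_mul _ _ _

theorem map_cutSum {S F : Type*} [AddCommMonoid R] [AddCommMonoid S] [FunLike F R S]
    [AddMonoidHomClass F R S] (f : F) (G : List ℕ → List ℕ → R) (w : List ℕ) :
    f (cutSum G w) = cutSum (fun u v => f (G u v)) w := map_sum _ _ _

theorem cutSum_congr [AddCommMonoid R] {G H : List ℕ → List ℕ → R} {w : List ℕ}
    (h : ∀ u v, u ++ v = w → G u v = H u v) : cutSum G w = cutSum H w :=
  Finset.sum_congr rfl fun _ _ => h _ _ (List.take_append_drop _ _)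

theorem cutSum_eq_zero [AddCommMonoid R] {G : List ℕ → List ℕ → R} {w : List ℕ}
    (h : ∀ u v, u ++ v = w → G u v = 0) : cutSum G w = 0 :=
  Finset.sum_eq_zero fun _ _ => h _ _ (List.take_append_drop _ _)

/-- The quasi-shuffle product of two words, as a multiset of words: letters of the two words are
interleaved, and a letter of one may be added to a letter of the other. -/
def qsh : List ℕ → List ℕ → Multiset (List ℕ)
  | [], v => {v}
  | a :: u, [] => {a :: u}
  | a :: u, b :: v =>
    (qsh u (b :: v)).map (a :: ·) + (qsh (a :: u) v).map (b :: ·) +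
      (qsh u v).map ((a + b) :: ·)
  termination_by u v => u.length + v.length

@[simp] theorem qsh_nil_left (v : List ℕ) : qsh [] v = {v} := by simp [qsh]

@[simp] theorem qsh_nil_right (u : List ℕ) : qsh u [] = {u} := by cases u <;> simp [qsh]

theorem qsh_cons_cons (a b : ℕ) (u v : List ℕ) :
    qsh (a :: u) (b :: v) = (qsh u (b :: v)).map (a :: ·) + (qsh (a :: u) v).map (b :: ·) +
      (qsh u v).map ((a + b) :: ·) := by
  rw [qsh]

theorem word_pair_induction {P : List ℕ → List ℕ → Prop} (h1 : ∀ v, P [] v)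
    (h2 : ∀ u, P u [])
    (h3 : ∀ a u b v, P u (b :: v) → P (a :: u) v → P u v → P (a :: u) (b :: v)) :
    ∀ u v, P u v := by
  intro u
  induction u with
  | nil => exact h1
  | cons a u ihu =>
    intro v
    induction v with
    | nil => exact h2 _
    | cons b v ihv => exact h3 a u b v (ihu _) ihv (ihu _)

theorem sum_of_mem_qsh (u v : List ℕ) : ∀ w ∈ qsh u v, w.sum = u.sum + v.sum := by
  induction u, v using word_pair_induction with
  | h1 v => simp
  | h2 u => simp
  | h3 a u b v i1 i2 i3 =>
    intro w hw
    simp only [qsh_cons_cons, Multiset.mem_add, Multiset.mem_map] at hw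
    rcases hw with (⟨x, hx, rfl⟩ | ⟨x, hx, rfl⟩) | ⟨x, hx, rfl⟩
    · have := i1 x hx; simp at this ⊢; omega
    · have := i2 x hx; simp at this ⊢; omega
    · have := i3 x hx; simp at this ⊢; omega

theorem pos_of_mem_qsh (u v : List ℕ) (hu : ∀ a ∈ u, 0 < a) (hv : ∀ a ∈ v, 0 < a) :
    ∀ w ∈ qsh u v, ∀ a ∈ w, 0 < a := by
  induction u, v using word_pair_induction with
  | h1 v => simpa using hv
  | h2 u => simpa using hu
  | h3 a u b v i1 i2 i3 =>
    intro w hw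
    simp only [List.forall_mem_cons] at hu hv
    simp only [qsh_cons_cons, Multiset.mem_add, Multiset.mem_map] at hw
    rcases hw with (⟨x, hx, rfl⟩ | ⟨x, hx, rfl⟩) | ⟨x, hx, rfl⟩
    · exact List.forall_mem_cons.2 ⟨hu.1, i1 hu.2 (by simpa using hv) x hx⟩
    · exact List.forall_mem_cons.2 ⟨hv.1, i2 (by simpa using hu) hv.2 x hx⟩
    · exact List.forall_mem_cons.2 ⟨by omega, i3 hu.2 hv.2 x hx⟩

/-- Deconcatenation is a morphism for the quasi-shuffle product. -/
theorem sum_qsh_cutSum [AddCommMonoid R] (u v : List ℕ) (G : List ℕ → List ℕ → R) :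
    ((qsh u v).map fun w => cutSum G w).sum =
      cutSum (fun u₁ u₂ => cutSum (fun v₁ v₂ =>
        ((qsh u₁ v₁).map fun p => ((qsh u₂ v₂).map fun s => G p s).sum).sum) v) u := by
  induction u, v using word_pair_induction generalizing G with
  | h1 v => simp
  | h2 u => simp
  | h3 a u b v i1 i2 i3 =>
    have j1 := i1 fun p s => G (a :: p) s
    have j2 := i2 fun p s => G (b :: p) s
    have j3 := i3 fun p s => G ((a + b) :: p) s
    simp only [qsh_cons_cons, Multiset.map_add, Multiset.map_map, Function.comp_def, cutSum_cons,
      Multiset.sum_add, Multiset.sum_map_add, cutSum_add, qsh_nil_left, qsh_nil_right,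
      Multiset.map_singleton, Multiset.sum_singleton] at j1 j2 j3 ⊢
    rw [j1, j2, j3]
    abel

/-- A character of the quasi-shuffle algebra of words. -/
structure IsChar [CommSemiring R] (φ : List ℕ → R) : Prop where
  nil : φ [] = 1
  mul : ∀ u v, φ u * φ v = ((qsh u v).map φ).sum

/-- The convolution product of two characters is a character. -/
theorem IsChar.conv [CommSemiring R] {φ ψ : List ℕ → R} (hφ : IsChar φ) (hψ : IsChar ψ) :
    IsChar fun w => cutSum (fun u v => φ u * ψ v) w := by
  refine ⟨by simp [hφ.nil, hψ.nil], fun u v => ?_⟩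
  rw [sum_qsh_cutSum, cutSum_mul]
  refine cutSum_congr fun u₁ u₂ _ => ?_
  rw [mul_cutSum]
  refine cutSum_congr fun v₁ v₂ _ => ?_
  simp only [Multiset.sum_map_mul_left, ← hψ.mul, Multiset.sum_map_mul_right, ← hφ.mul]
  ring

/-- The character of the basis `M_α`: `1` on words with at most one letter. -/
def zeta : List ℕ → ℚ
  | [] => 1
  | [_] => 1
  | _ :: _ :: _ => 0

/-- The character of Stembridge's map, with values `2 (-1)^{|w| + ℓ(w)}` on nonempty words `w`
whose last letter is odd, and `0` on those whose last letter is even. -/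
def nu : List ℕ → ℚ
  | [] => 1
  | [a] => 1 - (-1) ^ a
  | a :: b :: w => (-1) ^ (a + 1) * nu (b :: w)

theorem ne_nil_of_mem_qsh {u v w : List ℕ} (h : w ∈ qsh u v) (hv : v ≠ []) : w ≠ [] := by
  obtain ⟨b, v, rfl⟩ := List.exists_cons_of_ne_nil hv
  cases u with
  | nil => simp at h; simp [h]
  | cons a u =>
    simp only [qsh_cons_cons, Multiset.mem_add, Multiset.mem_map] at h
    rcases h with (⟨x, hx, rfl⟩ | ⟨x, hx, rfl⟩) | ⟨x, hx, rfl⟩ <;> simp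

theorem nu_cons {w : List ℕ} (h : w ≠ []) (a : ℕ) : nu (a :: w) = (-1) ^ (a + 1) * nu w := by
  obtain ⟨b, w, rfl⟩ := List.exists_cons_of_ne_nil h
  rw [nu]

theorem sum_nu_cons {s : Multiset (List ℕ)} (h : ∀ w ∈ s, w ≠ []) (a : ℕ) :
    (s.map fun w => nu (a :: w)).sum = (-1) ^ (a + 1) * (s.map nu).sum := by
  rw [← Multiset.sum_map_mul_left]
  exact congrArg _ (Multiset.map_congr rfl fun w hw => nu_cons (h w hw) a)

theorem isChar_nu : IsChar nu := by
  refine ⟨rfl, fun u v => ?_⟩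
  induction u, v using word_pair_induction with
  | h1 v => simp [nu]
  | h2 u => simp [nu]
  | h3 a u b v i1 i2 i3 =>
    simp only [qsh_cons_cons, Multiset.map_add, Multiset.map_map, Function.comp_def,
      Multiset.sum_add]
    rw [sum_nu_cons (s := qsh u (b :: v)) fun w hw => ne_nil_of_mem_qsh hw (by simp), ← i1]
    have h2 : ∀ w ∈ qsh (a :: u) v, w ≠ [] := by
      intro w hw
      by_cases hv : v = []
      · subst hv; simp at hw; simp [hw]
      · exact ne_nil_of_mem_qsh hw hv
    rw [sum_nu_cons h2, ← i2]
    rcases eq_or_ne v [] with rfl | hv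
    · rcases eq_or_ne u [] with rfl | hu
      · simp only [nu, pow_succ, pow_add, qsh_nil_left, Multiset.map_singleton,
          Multiset.sum_singleton]
        ring
      · simp only [nu, pow_succ, pow_add, qsh_nil_right, Multiset.map_singleton,
          Multiset.sum_singleton, nu_cons hu]
        ring
    · rw [sum_nu_cons fun w hw => ne_nil_of_mem_qsh hw hv, ← i3]
      rcases eq_or_ne u [] with rfl | hu
      · simp only [nu, pow_succ, pow_add, nu_cons hv]
        ring
      · simp only [nu_cons hu, nu_cons hv, pow_succ, pow_add]
        ring

theorem isChar_zeta : IsChar zeta := by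
  refine ⟨rfl, fun u v => ?_⟩
  induction u, v using word_pair_induction with
  | h1 v => simp [zeta]
  | h2 u => simp [zeta]
  | h3 a u b v i1 i2 i3 =>
    have key : ∀ (s : Multiset (List ℕ)) (c : ℕ), (∀ w ∈ s, w ≠ []) →
        (s.map fun w => zeta (c :: w)).sum = 0 := by
      intro s c hs
      refine Multiset.sum_eq_zero fun x hx => ?_
      obtain ⟨w, hw, rfl⟩ := Multiset.mem_map.1 hx
      obtain ⟨d, w, rfl⟩ := List.exists_cons_of_ne_nil (hs w hw)
      rfl
    simp only [qsh_cons_cons, Multiset.map_add, Multiset.map_map, Function.comp_def,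
      Multiset.sum_add]
    rw [key _ _ fun w hw => ne_nil_of_mem_qsh hw (by simp), key (qsh (a :: u) v)]
    · rcases eq_or_ne v [] with rfl | hv
      · cases u <;> simp [zeta]
      · rw [key _ _ fun w hw => ne_nil_of_mem_qsh hw hv]
        obtain ⟨d, w, rfl⟩ := List.exists_cons_of_ne_nil hv
        simp [zeta]
    · intro w hw
      by_cases hv : v = []
      · subst hv; simp at hw; simp [hw]
      · exact ne_nil_of_mem_qsh hw hv

end Words

/-! ### Series attached to characters -/

/-- The value on `w` of the convolution power of `χ` indexed by the letters of `δ`, the factor of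
index `d` being restricted to words of weight `d`. -/
def charCoeff (χ : List ℕ → ℚ) : List ℕ → List ℕ → ℚ
  | [], w => if w = [] then 1 else 0
  | d :: δ, w => cutSum (fun u v => if u.sum = d then χ u * charCoeff χ δ v else 0) w

/-- The quasisymmetric series of a word `w` attached to the character `χ`: `M_w` for `χ = zeta`
and `L_w` for `χ = nu`. -/
def charSeries (χ : List ℕ → ℚ) (w : List ℕ) : Amb :=
  fun m => charCoeff χ ((m.support.sort (· ≤ ·)).map m) w

/-- The restriction of `charSeries χ w` to the variables with indices in the list `is`. -/
noncomputable def charPoly (χ : List ℕ → ℚ) : List ℕ → List ℕ → Amb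
  | [], w => if w = [] then 1 else 0
  | i :: is, w =>
    cutSum (fun u v => MvPowerSeries.monomial (Finsupp.single i u.sum) (χ u) *
      charPoly χ is v) w

theorem isChar_monomial {χ : List ℕ → ℚ} (hχ : IsChar χ) (i : ℕ) :
    IsChar fun u => (MvPowerSeries.monomial (Finsupp.single i u.sum) (χ u) : Amb) := by
  refine ⟨by simp [hχ.nil, MvPowerSeries.monomial_zero_one], fun u v => ?_⟩
  rw [MvPowerSeries.monomial_mul_monomial, ← Finsupp.single_add, hχ.mul, map_multiset_sum,
    Multiset.map_map]
  refine congrArg _ (Multiset.map_congr rfl fun w hw => ?_)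
  simp [sum_of_mem_qsh u v w hw]

theorem isChar_charPoly {χ : List ℕ → ℚ} (hχ : IsChar χ) (is : List ℕ) :
    IsChar (charPoly χ is) := by
  induction is with
  | nil =>
    refine ⟨by simp [charPoly], fun u v => ?_⟩
    cases v with
    | nil => simp [charPoly]
    | cons b v =>
      have : ((qsh u (b :: v)).map (charPoly χ [])).sum = 0 := by
        refine Multiset.sum_eq_zero fun x hx => ?_
        obtain ⟨w, hw, rfl⟩ := Multiset.mem_map.1 hx
        simp [charPoly, ne_nil_of_mem_qsh hw (by simp)]
      rw [this]
      simp [charPoly]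
  | cons i is ih => exact (isChar_monomial hχ i).conv ih

theorem charCoeff_zero_cons {χ : List ℕ → ℚ} (hχ : χ [] = 1) (δ : List ℕ) {w : List ℕ}
    (hw : ∀ a ∈ w, 0 < a) : charCoeff χ (0 :: δ) w = charCoeff χ δ w := by
  cases w with
  | nil => simp [charCoeff, hχ]
  | cons a w =>
    rw [charCoeff, cutSum_cons, cutSum_eq_zero]
    · simp [hχ]
    · intro u v _
      have := hw a (by simp)
      rw [if_neg]
      simp; omega

theorem charCoeff_filter {χ : List ℕ → ℚ} (hχ : χ [] = 1) (δ : List ℕ) {w : List ℕ}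
    (hw : ∀ a ∈ w, 0 < a) : charCoeff χ (δ.filter (· ≠ 0)) w = charCoeff χ δ w := by
  induction δ generalizing w with
  | nil => rfl
  | cons d δ ih =>
    by_cases hd : d = 0
    · subst hd
      rw [charCoeff_zero_cons hχ δ hw, ← ih hw]
      simp
    · rw [List.filter_cons_of_pos (by simpa using hd), charCoeff, charCoeff]
      refine cutSum_congr fun u v huv => ?_
      rw [ih fun a ha => hw a (by rw [← huv]; exact List.mem_append_right _ ha)]

theorem coeff_charPoly {χ : List ℕ → ℚ} {is : List ℕ} (his : is.Nodup) (m : ℕ →₀ ℕ)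
    (w : List ℕ) : MvPowerSeries.coeff m (charPoly χ is w) =
      if ∀ i ∈ m.support, i ∈ is then charCoeff χ (is.map m) w else 0 := by
  induction is generalizing m w with
  | nil =>
    have h0 : (∀ i ∈ m.support, i ∈ ([] : List ℕ)) ↔ m = 0 := by
      rw [← Finsupp.support_eq_empty, Finset.eq_empty_iff_forall_notMem]
      simp
    simp only [h0, charPoly, charCoeff, List.map_nil]
    by_cases hw : w = [] <;> simp [hw, MvPowerSeries.coeff_one]
  | cons i is ih =>
    have hi := (List.nodup_cons.1 his).1
    simp only [charPoly, map_cutSum, MvPowerSeries.coeff_monomial_mul,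
      ih (List.nodup_cons.1 his).2, charCoeff, List.map_cons]
    have key : ∀ k, (Finsupp.single i k ≤ m ∧
        ∀ j ∈ (m - Finsupp.single i k).support, j ∈ is) ↔
        (k = m i ∧ ∀ j ∈ m.support, j ∈ i :: is) := by
      intro k
      constructor
      · rintro ⟨h1, h2⟩
        have h3 : k ≤ m i := by simpa using h1
        refine ⟨?_, fun j hj => ?_⟩
        · by_contra hne
          exact hi (h2 i (by simp; omega))
        · by_cases hji : j = i
          · simp [hji]
          · refine List.mem_cons_of_mem _ (h2 j ?_)
            have : (fun₀ | i => k) j = 0 := Finsupp.single_eq_of_ne (by simpa using hji)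
            simpa [this] using hj
      · rintro ⟨rfl, h2⟩
        refine ⟨by simp, fun j hj => ?_⟩
        have hji : j ≠ i := by rintro rfl; simp at hj
        have h0 : (fun₀ | i => m i) j = 0 := Finsupp.single_eq_of_ne (by simpa using hji)
        have := h2 j (by simpa [h0] using hj)
        simpa [hji] using this
    have hmap : ∀ k : ℕ, is.map (m - Finsupp.single i k : ℕ →₀ ℕ) = is.map m := by
      intro k
      refine List.map_congr_left fun j hj => ?_
      have hji : j ≠ i := by rintro rfl; exact hi hj
      have h0 : (fun₀ | i => k) j = 0 := Finsupp.single_eq_of_ne (by simpa using hji)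
      simp [h0]
    by_cases hm : ∀ j ∈ m.support, j ∈ i :: is
    · rw [if_pos hm]
      refine cutSum_congr fun u v _ => ?_
      have := key u.sum
      by_cases hu : u.sum = m i
      · obtain ⟨h1, h2⟩ := this.2 ⟨hu, hm⟩
        rw [if_pos h1, if_pos h2, if_pos hu, hmap]
      · rw [if_neg hu]
        split_ifs with h1 h2
        · exact absurd (this.1 ⟨h1, h2⟩).1 hu
        · simp
        · rfl
    · rw [if_neg hm]
      refine cutSum_eq_zero fun u v _ => ?_
      split_ifs with h1 h2
      · exact absurd ((key u.sum).1 ⟨h1, h2⟩).2 hm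
      · simp
      · rfl

/-- Zero exponents may be kept in the list of exponents, as `charCoeff` ignores letters `0` of its
index (`charCoeff_filter`); so monomials dividing a given one can be handled with one list of
variables. -/
theorem sort_support_eq_filter {is : List ℕ} (his : is.Pairwise (· < ·)) {m : ℕ →₀ ℕ}
    (hm : ∀ i ∈ m.support, i ∈ is) :
    m.support.sort (· ≤ ·) = is.filter (fun i => m i ≠ 0) := by
  apply List.Perm.eq_of_pairwise (le := (· ≤ ·))
  · intro a b _ _ h1 h2; exact le_antisymm h1 h2
  · exact Finset.pairwise_sort _ _
  · exact (his.imp le_of_lt).filter _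
  · rw [List.perm_ext_iff_of_nodup (Finset.sort_nodup _ _) ((his.imp ne_of_lt).filter _)]
    intro a
    simp only [Finset.mem_sort, List.mem_filter, Finsupp.mem_support_iff, decide_eq_true_eq]
    exact ⟨fun h => ⟨hm a (by simpa using h), h⟩, fun h => h.2⟩

theorem coeff_charSeries {χ : List ℕ → ℚ} (hχ : χ [] = 1) {is : List ℕ}
    (his : is.Pairwise (· < ·)) {m : ℕ →₀ ℕ} (hm : ∀ i ∈ m.support, i ∈ is) {w : List ℕ}
    (hw : ∀ a ∈ w, 0 < a) :
    MvPowerSeries.coeff m (charSeries χ w) = charCoeff χ (is.map m) w := by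
  change charCoeff χ ((m.support.sort (· ≤ ·)).map m) w = _
  rw [sort_support_eq_filter his hm, ← charCoeff_filter hχ (is.map m) hw, List.filter_map]
  rfl

theorem coeff_charSeries_eq_coeff_charPoly {χ : List ℕ → ℚ} (hχ : χ [] = 1) {is : List ℕ}
    (his : is.Pairwise (· < ·)) {m : ℕ →₀ ℕ} (hm : ∀ i ∈ m.support, i ∈ is) {w : List ℕ}
    (hw : ∀ a ∈ w, 0 < a) :
    MvPowerSeries.coeff m (charSeries χ w) = MvPowerSeries.coeff m (charPoly χ is w) := by
  rw [coeff_charSeries hχ his hm hw, coeff_charPoly (his.imp ne_of_lt), if_pos hm]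

/-- Coefficient by coefficient, the series is a convolution product of characters, hence itself a
character of the quasi-shuffle algebra. -/
theorem charSeries_mul {χ : List ℕ → ℚ} (hχ : IsChar χ) {u v : List ℕ} (hu : ∀ a ∈ u, 0 < a)
    (hv : ∀ a ∈ v, 0 < a) :
    charSeries χ u * charSeries χ v = ((qsh u v).map (charSeries χ)).sum := by
  ext m
  set is := m.support.sort (· ≤ ·) with hdef
  have his : is.Pairwise (· < ·) := Finset.sortedLT_sort _ |>.pairwise
  have hm : ∀ m' : ℕ →₀ ℕ, m' ≤ m → ∀ i ∈ m'.support, i ∈ is := by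
    intro m' h i hi
    simp only [hdef, Finset.mem_sort, Finsupp.mem_support_iff] at hi ⊢
    have := h i
    omega
  have h1 : MvPowerSeries.coeff m (charSeries χ u * charSeries χ v) =
      MvPowerSeries.coeff m (charPoly χ is u * charPoly χ is v) := by
    rw [MvPowerSeries.coeff_mul, MvPowerSeries.coeff_mul]
    refine Finset.sum_congr rfl fun p hp => ?_
    rw [Finset.HasAntidiagonal.mem_antidiagonal] at hp
    rw [coeff_charSeries_eq_coeff_charPoly hχ.nil his (hm _ (by rw [← hp]; simp)) hu,
      coeff_charSeries_eq_coeff_charPoly hχ.nil his (hm _ (by rw [← hp]; simp)) hv]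
  rw [h1, (isChar_charPoly hχ is).mul, map_multiset_sum, map_multiset_sum, Multiset.map_map,
    Multiset.map_map]
  refine congrArg _ (Multiset.map_congr rfl fun w hw => ?_)
  exact (coeff_charSeries_eq_coeff_charPoly hχ.nil his (hm m le_rfl)
    (pos_of_mem_qsh u v hu hv w hw)).symm

theorem charCoeff_eq_zero_of_sum_ne {χ : List ℕ → ℚ} {δ w : List ℕ} (h : w.sum ≠ δ.sum) :
    charCoeff χ δ w = 0 := by
  induction δ generalizing w with
  | nil =>
    rw [charCoeff, if_neg]
    rintro rfl
    simp at h
  | cons d δ ih =>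
    refine cutSum_eq_zero fun u v huv => ?_
    split_ifs with hu
    · rw [ih, mul_zero]
      intro hv
      apply h
      rw [← huv, List.sum_append, List.sum_cons, hu, hv]
    · rfl

theorem charCoeff_zeta {δ w : List ℕ} (hδ : ∀ a ∈ δ, 0 < a) (hw : ∀ a ∈ w, 0 < a) :
    charCoeff zeta δ w = if δ = w then 1 else 0 := by
  induction δ generalizing w with
  | nil => simp [charCoeff, eq_comm]
  | cons d δ ih =>
    rw [List.forall_mem_cons] at hδ
    cases w with
    | nil => simp [charCoeff, hδ.1.ne]
    | cons a w =>
      rw [List.forall_mem_cons] at hw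
      rw [charCoeff, cutSum_cons, if_neg (by simp; omega), zero_add]
      cases w with
      | nil =>
        simp only [cutSum_nil, List.sum_singleton, zeta, ih hδ.2 (w := []) (by simp),
          List.cons.injEq]
        rcases eq_or_ne a d with h | h
        · simp [h]
        · simp [h, h.symm]
      | cons b w =>
        rw [cutSum_cons, cutSum_eq_zero (by intro u v _; simp [zeta])]
        simp only [List.sum_singleton, zeta, ih hδ.2 hw.2, List.cons.injEq]
        rcases eq_or_ne a d with h | h
        · simp [h]
        · simp [h, h.symm]

theorem monomialQ_eq_charSeries (c : Comp) : monomialQ c = charSeries zeta c.2.blocks := by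
  ext m
  change (if _ then (1 : ℚ) else 0) = charCoeff _ _ _
  rw [charCoeff_zeta _ fun a ha => c.2.blocks_pos ha]
  intro a ha
  obtain ⟨i, hi, rfl⟩ := List.mem_map.1 ha
  have : i ∈ m.support := by simpa using hi
  simp at this
  omega

/-! ### Compositions as words of bits -/

theorem charSeries_eq_sum {χ : List ℕ → ℚ} {n : ℕ} {w : List ℕ} (hw : w.sum = n) :
    charSeries χ w = ∑ d : Composition n, charCoeff χ d.blocks w • monomialQ ⟨n, d⟩ := by
  ext m
  simp only [map_sum, map_smul, smul_eq_mul]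
  set δ := (m.support.sort (· ≤ ·)).map m with hδ
  have h1 : ∀ d : Composition n, MvPowerSeries.coeff m (monomialQ ⟨n, d⟩) =
      if δ = d.blocks then 1 else 0 := fun d => rfl
  have h2 : MvPowerSeries.coeff m (charSeries χ w) = charCoeff χ δ w := rfl
  simp only [h1, h2]
  by_cases hs : δ.sum = n
  · have hpos : ∀ {i}, i ∈ δ → 0 < i := by
      intro i hi
      obtain ⟨j, hj, rfl⟩ := List.mem_map.1 hi
      have : j ∈ m.support := by simpa using hj
      simp at this
      omega
    rw [Finset.sum_eq_single (⟨δ, hpos, hs⟩ : Composition n)]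
    · simp
    · intro d _ hd
      rw [if_neg, mul_zero]
      intro h
      exact hd (Composition.ext h.symm)
    · simp
  · rw [charCoeff_eq_zero_of_sum_ne (by omega), Finset.sum_eq_zero]
    intro d _
    rw [if_neg, mul_zero]
    intro h
    exact hs (h ▸ d.blocks_sum)

/-- The composition with first part at least `s` that is encoded by a word of bits: after a first
part starting at `s`, each bit `true` starts a new part, and each `false` enlarges the current
one. -/
def ofBits : ℕ → List Bool → List ℕ
  | s, [] => [s]
  | s, true :: r => s :: ofBits 1 r
  | s, false :: r => ofBits (s + 1) r

theorem ofBits_ne_nil (s : ℕ) (r : List Bool) : ofBits s r ≠ [] := by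
  induction r generalizing s with
  | nil => simp [ofBits]
  | cons b r ih => cases b <;> simp [ofBits, ih]

theorem sum_ofBits (s : ℕ) (r : List Bool) : (ofBits s r).sum = s + r.length := by
  induction r generalizing s with
  | nil => simp [ofBits]
  | cons b r ih => cases b <;> simp [ofBits, ih] <;> omega

theorem pos_ofBits {s : ℕ} (hs : 0 < s) (r : List Bool) : ∀ a ∈ ofBits s r, 0 < a := by
  induction r generalizing s with
  | nil => simpa [ofBits]
  | cons b r ih =>
    cases b
    · exact ih (by omega)
    · simpa [ofBits, hs] using ih one_pos

theorem le_sum_ofBits_prefix {s : ℕ} {r : List Bool} {u v : List ℕ} (h : ofBits s r = u ++ v)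
    (hu : u ≠ []) : s ≤ u.sum := by
  induction r generalizing s with
  | nil =>
    obtain ⟨a, u, rfl⟩ := List.exists_cons_of_ne_nil hu
    simp [ofBits] at h
    simp [h]
  | cons b r ih =>
    cases b
    · exact (Nat.le_succ s).trans (ih h)
    · obtain ⟨a, u, rfl⟩ := List.exists_cons_of_ne_nil hu
      simp [ofBits] at h
      simp [h]

/-- The descents of the composition encoded by `r` are the positions of the bits `true`. -/
theorem exists_prefix_ofBits (s : ℕ) (r : List Bool) (j : ℕ) :
    (∃ u v, u ≠ [] ∧ v ≠ [] ∧ ofBits s r = u ++ v ∧ u.sum = j) ↔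
      ∃ i, r[i]? = some true ∧ j = s + i := by
  induction r generalizing s j with
  | nil =>
    simp only [ofBits, List.getElem?_nil, reduceCtorEq, false_and, exists_false, iff_false]
    rintro ⟨u, v, hu, hv, h, -⟩
    have := congrArg List.length h
    have h1 := List.length_pos_iff.2 hu
    have h2 := List.length_pos_iff.2 hv
    simp at this
    omega
  | cons b r ih =>
    cases b
    · rw [ofBits, ih]
      constructor
      · rintro ⟨i, hi, rfl⟩
        exact ⟨i + 1, by simpa using hi, by omega⟩
      · rintro ⟨i, hi, rfl⟩
        cases i with
        | zero => simp at hi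
        | succ i => exact ⟨i, by simpa using hi, by omega⟩
    · rw [ofBits]
      constructor
      · rintro ⟨u, v, hu, hv, h, rfl⟩
        obtain ⟨a, u, rfl⟩ := List.exists_cons_of_ne_nil hu
        simp only [List.cons_append, List.cons.injEq] at h
        obtain ⟨rfl, h⟩ := h
        rcases eq_or_ne u [] with rfl | hu'
        · exact ⟨0, by simp, by simp⟩
        · obtain ⟨i, hi, h'⟩ := (ih 1 u.sum).1 ⟨u, v, hu', hv, h, rfl⟩
          exact ⟨i + 1, by simpa using hi, by simp; omega⟩
      · rintro ⟨i, hi, rfl⟩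
        cases i with
        | zero => exact ⟨[s], ofBits 1 r, by simp, ofBits_ne_nil _ _, by simp, by simp⟩
        | succ i =>
          obtain ⟨u, v, hu, hv, h, h'⟩ := (ih 1 (1 + i)).2 ⟨i, by simpa using hi, rfl⟩
          exact ⟨s :: u, v, by simp, hv, by simp [h], by simp [h']; omega⟩

theorem mem_descents_iff {n : ℕ} (c : Composition n) (j : ℕ) :
    j ∈ descents c ↔ ∃ u v, u ≠ [] ∧ v ≠ [] ∧ c.blocks = u ++ v ∧ u.sum = j := by
  simp only [descents, Finset.mem_image, Finset.mem_Ioo, Composition.length,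
    Composition.sizeUpTo]
  constructor
  · rintro ⟨i, ⟨h1, h2⟩, rfl⟩
    refine ⟨c.blocks.take i, c.blocks.drop i, ?_, ?_, (List.take_append_drop _ _).symm, rfl⟩
    · exact List.length_pos_iff.1 (by rw [List.length_take]; omega)
    · exact List.length_pos_iff.1 (by rw [List.length_drop]; omega)
  · rintro ⟨u, v, hu, hv, h, rfl⟩
    have h1 := List.length_pos_iff.2 hu
    have h2 := List.length_pos_iff.2 hv
    refine ⟨u.length, ⟨h1, by simp [h]; omega⟩, by simp [h]⟩

theorem mem_descents_bounds {n : ℕ} {c : Composition n} {j : ℕ} (h : j ∈ descents c) :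
    0 < j ∧ j < n := by
  obtain ⟨u, v, hu, hv, huv, rfl⟩ := (mem_descents_iff c j).1 h
  have hpos : ∀ w : List ℕ, w ≠ [] → (∀ a ∈ w, 0 < a) → 0 < w.sum := by
    intro w hw hp
    obtain ⟨a, w, rfl⟩ := List.exists_cons_of_ne_nil hw
    have := hp a (by simp)
    simp; omega
  have hu' := hpos u hu fun a ha => c.blocks_pos (by rw [huv]; exact List.mem_append_left _ ha)
  have hv' := hpos v hv fun a ha => c.blocks_pos (by rw [huv]; exact List.mem_append_right _ ha)
  have := c.blocks_sum
  rw [huv, List.sum_append] at this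
  omega

/-- The indicator word of `S` on the interval `(o, o + k]`. -/
def toBits (S : Finset ℕ) : ℕ → ℕ → List Bool
  | _, 0 => []
  | o, k + 1 => decide (o + 1 ∈ S) :: toBits S (o + 1) k

@[simp] theorem length_toBits (S : Finset ℕ) (o k : ℕ) : (toBits S o k).length = k := by
  induction k generalizing o with
  | zero => rfl
  | succ k ih => simp [toBits, ih]

theorem getElem?_toBits (S : Finset ℕ) (o k i : ℕ) :
    (toBits S o k)[i]? = some true ↔ i < k ∧ o + 1 + i ∈ S := by
  induction k generalizing o i with
  | zero => simp [toBits]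
  | succ k ih =>
    cases i with
    | zero => simp [toBits]
    | succ i =>
      simp only [toBits, List.getElem?_cons_succ, ih]
      rw [show o + 1 + 1 + i = o + 1 + (i + 1) by omega]
      simp

theorem toBits_congr {S T : Finset ℕ} (o k : ℕ) (h : ∀ i, o < i → (i ∈ S ↔ i ∈ T)) :
    toBits S o k = toBits T o k := by
  induction k generalizing o with
  | zero => rfl
  | succ k ih =>
    rw [toBits, toBits, ih _ fun i hi => h i (by omega)]
    simp [h (o + 1) (by omega)]

/-- The composition of `k + 1` encoded by a word of `k` bits. -/
def compOfBits {k : ℕ} (r : List Bool) (h : r.length = k) : Composition (k + 1) :=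
  ⟨ofBits 1 r, fun {_} hi => pos_ofBits one_pos r _ hi, by rw [sum_ofBits, h, add_comm]⟩

theorem mem_descents_compOfBits {k : ℕ} (r : List Bool) (h : r.length = k) (j : ℕ) :
    j ∈ descents (compOfBits r h) ↔ ∃ i, r[i]? = some true ∧ j = 1 + i := by
  rw [mem_descents_iff]
  exact exists_prefix_ofBits 1 r j

theorem descents_compOfBits_toBits {k : ℕ} (S : Finset ℕ) (hS : S ⊆ Finset.Icc 1 k) :
    descents (compOfBits (toBits S 0 k) (length_toBits S 0 k)) = S := by
  ext j
  simp only [mem_descents_compOfBits, getElem?_toBits]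
  constructor
  · rintro ⟨i, ⟨h1, h2⟩, rfl⟩
    simpa using h2
  · intro hj
    have := Finset.mem_Icc.1 (hS hj)
    exact ⟨j - 1, ⟨by omega, by rwa [show 0 + 1 + (j - 1) = j by omega]⟩, by omega⟩

theorem compOfBits_toBits {k : ℕ} (c : Composition (k + 1)) :
    compOfBits (toBits (descents c) 0 k) (length_toBits _ 0 k) = c := by
  apply descents_injective
  apply descents_compOfBits_toBits
  intro j hj
  have := mem_descents_bounds hj
  rw [Finset.mem_Icc]
  omega

theorem ofBits_toBits {k : ℕ} (c : Composition (k + 1)) :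
    ofBits 1 (toBits (descents c) 0 k) = c.blocks :=
  congrArg Composition.blocks (compOfBits_toBits c)

theorem toBits_compOfBits {k : ℕ} (r : List Bool) (h : r.length = k) :
    toBits (descents (compOfBits r h)) 0 k = r := by
  apply List.ext_getElem?
  intro i
  have h1 : (toBits (descents (compOfBits r h)) 0 k)[i]? = some true ↔ r[i]? = some true := by
    rw [getElem?_toBits, mem_descents_compOfBits]
    constructor
    · rintro ⟨-, j, hj, hij⟩
      rwa [show i = j by omega]
    · intro hi
      obtain ⟨hlt, -⟩ := List.getElem?_eq_some_iff.1 hi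
      exact ⟨by omega, i, hi, by omega⟩
  by_cases hi : i < k
  · have e1 : i < (toBits (descents (compOfBits r h)) 0 k).length := by simpa
    have e2 : i < r.length := by omega
    rw [List.getElem?_eq_getElem e1, List.getElem?_eq_getElem e2] at h1 ⊢
    simp only [Option.some.injEq] at h1 ⊢
    exact Bool.eq_iff_iff.2 h1
  · rw [List.getElem?_eq_none (by simpa using hi), List.getElem?_eq_none (by omega)]

/-- The sum of `f` over all words of `k` bits. -/
def bitSum {R : Type*} [AddCommMonoid R] : ℕ → (List Bool → R) → R
  | 0, f => f []
  | k + 1, f => bitSum k (fun r => f (true :: r)) + bitSum k (fun r => f (false :: r))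

theorem bitSum_eq_sum {R : Type*} [AddCommMonoid R] (k : ℕ) :
    ∃ B : Finset (List Bool), (∀ r, r ∈ B ↔ r.length = k) ∧
      ∀ f : List Bool → R, bitSum k f = ∑ r ∈ B, f r := by
  induction k with
  | zero => exact ⟨{[]}, by simp, by simp [bitSum]⟩
  | succ k ih =>
    obtain ⟨B, hB, hs⟩ := ih
    have hd : Disjoint (B.map ⟨List.cons true, List.cons_injective⟩)
        (B.map ⟨List.cons false, List.cons_injective⟩) := by
      rw [Finset.disjoint_left]
      simp
    refine ⟨(B.map ⟨List.cons true, List.cons_injective⟩).disjUnion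
      (B.map ⟨List.cons false, List.cons_injective⟩) hd, ?_, ?_⟩
    · intro r
      cases r with
      | nil => simp
      | cons b r => cases b <;> simp [hB]
    · intro f
      rw [Finset.sum_disjUnion, Finset.sum_map, Finset.sum_map, bitSum, hs, hs]
      rfl

theorem sum_composition_eq_bitSum {R : Type*} [AddCommMonoid R] (k : ℕ) (f : List Bool → R) :
    ∑ c : Composition (k + 1), f (toBits (descents c) 0 k) = bitSum k f := by
  obtain ⟨B, hB, hs⟩ := bitSum_eq_sum (R := R) k
  rw [hs]
  refine Finset.sum_bij' (fun c _ => toBits (descents c) 0 k)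
    (fun r hr => compOfBits r ((hB r).1 hr)) ?_ ?_ ?_ ?_ ?_
  · intro c _; simp [hB]
  · intro r hr; simp
  · intro c _; exact compOfBits_toBits c
  · intro r hr; exact toBits_compOfBits r _
  · intro c _; rfl

theorem mul_bitSum (c : ℚ) (k : ℕ) (f : List Bool → ℚ) :
    c * bitSum k f = bitSum k fun r => c * f r := by
  induction k generalizing f with
  | zero => rfl
  | succ k ih => rw [bitSum, bitSum, mul_add, ih, ih]

theorem bitSum_zero (k : ℕ) : bitSum k (fun _ => (0 : ℚ)) = 0 := by
  induction k with
  | zero => rfl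
  | succ k ih => rw [bitSum, ih, add_zero]

/-- Pointwise comparison of words of bits. -/
def bitLe : List Bool → List Bool → Bool
  | a :: as, b :: bs => (!a || b) && bitLe as bs
  | _, _ => true

theorem bitLe_toBits_iff (S T : Finset ℕ) (o k : ℕ) :
    bitLe (toBits S o k) (toBits T o k) = true ↔ ∀ i ∈ S, o < i → i ≤ o + k → i ∈ T := by
  induction k generalizing o with
  | zero => simp [toBits, bitLe]; omega
  | succ k ih =>
    simp only [toBits, bitLe, Bool.and_eq_true, ih]
    constructor
    · rintro ⟨h1, h2⟩ i hi hlt hle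
      rcases eq_or_ne i (o + 1) with rfl | hne
      · simpa [hi] using h1
      · exact h2 i hi (by omega) (by omega)
    · intro h
      refine ⟨?_, fun i hi h1 h2 => h i hi (by omega) (by omega)⟩
      by_cases h1 : o + 1 ∈ S
      · simp [h _ h1 (by omega) (by omega)]
      · simp [h1]

theorem descents_subset_iff {k : ℕ} (c d : Composition (k + 1)) :
    descents c ⊆ descents d ↔
      bitLe (toBits (descents c) 0 k) (toBits (descents d) 0 k) = true := by
  rw [bitLe_toBits_iff]
  constructor
  · intro h i hi _ _; exact h hi
  · intro h i hi
    have := mem_descents_bounds hi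
    exact h i hi (by omega) (by omega)

/-! ### Stembridge's map on the monomial basis -/

/-- The coefficient of `M_β` in `L_α`, for `α` and `β` encoded by the words of bits `b` and `e`,
computed from left to right; `s` is the size of the part of `α` being read. -/
def bitCoeff : ℕ → List Bool → List Bool → ℚ
  | s, true :: b, true :: e => (1 - (-1) ^ s) * bitCoeff 1 b e
  | s, true :: b, false :: e => (-1) ^ (s + 1) * bitCoeff 1 b e
  | s, false :: b, false :: e => bitCoeff (s + 1) b e
  | _, false :: _, true :: _ => 0
  | s, [], [] => 1 - (-1) ^ s
  | _, _, _ => 0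

theorem nu_append {u v : List ℕ} (hv : v ≠ []) :
    nu (u ++ v) = (u.map fun a => (-1) ^ (a + 1)).prod * nu v := by
  induction u with
  | nil => simp
  | cons a u ih => rw [List.cons_append, nu_cons (by simp [hv]), ih]; simp [mul_assoc]

/-- A cut with a prescribed weight of the first half is unique in a word of positive letters. -/
theorem charCoeff_cons_append {χ : List ℕ → ℚ} (u v δ : List ℕ) (hu : ∀ a ∈ u, 0 < a)
    (hv : ∀ a ∈ v, 0 < a) :
    charCoeff χ (u.sum :: δ) (u ++ v) = χ u * charCoeff χ δ v := by
  rw [charCoeff]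
  suffices h : ∀ G : List ℕ → List ℕ → ℚ,
      cutSum (fun p s => if p.sum = u.sum then G p s else 0) (u ++ v) = G u v from h _
  intro G
  induction u generalizing G with
  | nil =>
    cases v with
    | nil => simp
    | cons b v =>
      rw [List.nil_append, cutSum_cons, cutSum_eq_zero]
      · simp
      · intro p s _
        have := hv b (by simp)
        rw [if_neg]
        simp; omega
  | cons a u ih =>
    rw [List.forall_mem_cons] at hu
    rw [List.cons_append, cutSum_cons, if_neg (by simp; omega), zero_add]
    simp only [List.sum_cons, Nat.add_left_cancel_iff]
    exact ih hu.2 fun p s => G (a :: p) s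

/-- The coefficient is computed with a left factor `u` whose letters will all lie in the same
part of the coarser composition as the part being read; each contributes a sign. -/
theorem charCoeff_ofBits (u : List ℕ) (hu : ∀ a ∈ u, 0 < a) {s : ℕ} (hs : 0 < s)
    (b e : List Bool) (h : b.length = e.length) :
    charCoeff nu (ofBits (u.sum + s) e) (u ++ ofBits s b) =
      (u.map fun a => (-1) ^ (a + 1)).prod * bitCoeff s b e := by
  induction b generalizing e u s with
  | nil =>
    obtain rfl : e = [] := List.length_eq_zero_iff.1 h.symm
    have h1 : ∀ a ∈ u ++ [s], 0 < a := by
      intro a ha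
      rcases List.mem_append.1 ha with h | h
      · exact hu a h
      · simp at h; omega
    have := charCoeff_cons_append (χ := nu) (u ++ [s]) [] [] h1 (by simp)
    simp only [List.append_nil, List.sum_append, List.sum_singleton] at this
    simp only [ofBits, bitCoeff, this, charCoeff, nu_append (v := [s]) (by simp), nu]
    simp
  | cons x b ih =>
    cases e with
    | nil => simp at h
    | cons y e =>
      have h' : b.length = e.length := by simpa using h
      have h1 : ∀ a ∈ u ++ [s], 0 < a := by
        intro a ha
        rcases List.mem_append.1 ha with h | h
        · exact hu a h
        · simp at h; omega
      cases x <;> cases y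
      · simpa [ofBits, bitCoeff, add_assoc] using ih u hu (s := s + 1) (by omega) e h'
      · simp only [ofBits, bitCoeff, mul_zero, charCoeff]
        refine cutSum_eq_zero fun p q hpq => ?_
        rw [if_neg]
        intro hsum
        rcases List.append_eq_append_iff.1 hpq with ⟨t, ht, -⟩ | ⟨t, ht, ht'⟩
        · have := congrArg List.sum ht
          simp at this
          omega
        · subst ht
          rcases eq_or_ne t [] with rfl | hne
          · simp at hsum; omega
          · have := le_sum_ofBits_prefix ht' hne
            simp at hsum; omega
      · have := ih (u ++ [s]) h1 one_pos e h'
        simpa [ofBits, bitCoeff, add_assoc, mul_assoc] using this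
      · have := charCoeff_cons_append (χ := nu) (u ++ [s]) (ofBits 1 b) (ofBits 1 e) h1
          (pos_ofBits one_pos b)
        simp only [List.sum_append, List.sum_singleton, List.append_assoc,
          List.singleton_append] at this
        have h2 := ih [] (by simp) one_pos e h'
        simp only [List.sum_nil, zero_add, List.nil_append, List.map_nil, List.prod_nil,
          one_mul] at h2
        simp only [ofBits, bitCoeff, this, h2, nu_append (v := [s]) (by simp), nu]
        ring

/-- Whether the first letters of two words of bits are `true` and `false`. -/
def startsTF : List Bool → List Bool → Bool
  | true :: _, false :: _ => true
  | _, _ => false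

theorem startsTF_cons (x y : Bool) (a e : List Bool) :
    startsTF (x :: a) (y :: e) = (x && !y) := by
  cases x <;> cases y <;> rfl

/-- The common value of the two expansions of `K_{P(α)}`: twice a power of `2`, or `0` if some
peak of the composition encoded by the first word is not adjacent to the set encoded by the
second. -/
def bitValue : List Bool → List Bool → ℚ
  | [], [] => 2
  | _ :: as, true :: es => 2 * bitValue as es
  | true :: as, false :: es => bitValue as es
  | false :: as, false :: es => if startsTF as es then 0 else bitValue as es
  | _, _ => 0

/-- The sum, over all refinements, of the coefficients that make up `ϑ(F_α)` expressed through the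
`L_β`. Only the parity of the size `s` of the part being read matters. -/
theorem bitSum_bitCoeff (k : ℕ) (a e : List Bool) (ha : a.length = k) (he : e.length = k)
    (s : ℕ) :
    bitSum k (fun b => if bitLe a b then bitCoeff s b e else 0) =
      if Odd s then bitValue a e else if startsTF a e then - bitValue a e else 0 := by
  induction k generalizing a e s with
  | zero =>
    obtain rfl := List.length_eq_zero_iff.1 ha
    obtain rfl := List.length_eq_zero_iff.1 he
    by_cases hs : Odd s
    · simp [bitSum, bitLe, bitCoeff, bitValue, hs, hs.neg_one_pow]; norm_num
    · simp [bitSum, bitLe, bitCoeff, startsTF, hs, (Nat.not_odd_iff_even.1 hs).neg_one_pow]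
  | succ k ih =>
    obtain ⟨x, a, rfl⟩ := List.exists_cons_of_length_eq_add_one ha
    obtain ⟨y, e, rfl⟩ := List.exists_cons_of_length_eq_add_one he
    replace ih := ih a e (by simpa using ha) (by simpa using he)
    have hm : ∀ c : ℚ, bitSum k (fun b => if bitLe a b then c * bitCoeff 1 b e else 0) =
        c * bitValue a e := by
      intro c
      have := ih 1
      rw [if_pos odd_one] at this
      rw [← this, mul_bitSum]
      simp
    by_cases hs : Odd s
    · have h1 : ((-1 : ℚ) ^ (s + 1)) = 1 := hs.add_one.neg_one_pow
      have h2 : ¬ Odd (s + 1) := Nat.not_odd_iff_even.2 hs.add_one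
      have := ih (s + 1)
      have hone := hm 1
      simp only [one_mul] at hone
      cases x <;> cases y <;>
        simp [bitSum, bitLe, bitCoeff, hm, hone, bitSum_zero, bitValue, hs, hs.neg_one_pow, this,
          h1, h2] <;> norm_num
      split_ifs <;> simp
    · have hs' := Nat.not_odd_iff_even.1 hs
      have h1 : ((-1 : ℚ) ^ (s + 1)) = -1 := hs'.add_one.neg_one_pow
      have h2 : Odd (s + 1) := hs'.add_one
      have := ih (s + 1)
      have hneg := hm (-1)
      simp only [neg_mul, one_mul] at hneg
      cases x <;> cases y <;>
        simp [bitSum, bitLe, bitCoeff, hneg, bitSum_zero, bitValue, hs, hs'.neg_one_pow, this,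
          h1, h2, startsTF_cons]

/-- The weight `2^{|P|}` of a set `G` in the expansion of `K_P` if each peak is adjacent to exactly
one element of `G`, computed from left to right; the first two arguments are the letters that
precede the two words. -/
def peakWeight : Bool → Bool → List Bool → List Bool → ℚ
  | pa, pg, x :: a, y :: g =>
    (if x && !pa then (if y = pg then 0 else 2) else 1) * peakWeight x y a g
  | _, _, _, _ => 1

/-- The sum, over all `G` coarser than `e`, of the weights that make up the coefficient in `K_P`.
The factor of a position depends on the preceding letters only. -/
theorem bitSum_peakWeight (k : ℕ) (a e : List Bool) (ha : a.length = k) (he : e.length = k)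
    (pa pg : Bool) :
    2 * bitSum k (fun g => if bitLe g e then peakWeight pa pg a g else 0) =
      if !pa && startsTF a e then (if pg then 2 * bitValue a e else 0) else bitValue a e := by
  induction k generalizing a e pa pg with
  | zero =>
    obtain rfl := List.length_eq_zero_iff.1 ha
    obtain rfl := List.length_eq_zero_iff.1 he
    simp [bitSum, bitLe, peakWeight, bitValue, startsTF]
  | succ k ih =>
    obtain ⟨x, a, rfl⟩ := List.exists_cons_of_length_eq_add_one ha
    obtain ⟨y, e, rfl⟩ := List.exists_cons_of_length_eq_add_one he
    replace ih := ih a e (by simpa using ha) (by simpa using he)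
    have hm : ∀ (c : ℚ) (p q : Bool),
        bitSum k (fun g => if bitLe g e then c * peakWeight p q a g else 0) =
        c / 2 * if !p && startsTF a e then (if q then 2 * bitValue a e else 0)
          else bitValue a e := by
      intro c p q
      rw [← ih p q, ← mul_assoc, div_mul_cancel₀ c two_ne_zero, mul_bitSum]
      simp
    have hm' := hm 1
    simp only [one_mul] at hm'
    cases x <;> cases y <;> cases pa <;> cases pg <;>
      simp [bitSum, bitLe, peakWeight, bitSum_zero, bitValue, startsTF_cons, hm, hm'] <;>
      (try split_ifs) <;> ring

theorem peakWeight_toBits (S T : Finset ℕ) (o k : ℕ) :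
    peakWeight (decide (o ∈ S)) (decide (o ∈ T)) (toBits S o k) (toBits T o k) =
      ∏ p ∈ Finset.Ioc o (o + k), if p ∈ S ∧ p - 1 ∉ S then
        (if p ∈ T ↔ p - 1 ∈ T then 0 else 2) else 1 := by
  induction k generalizing o with
  | zero => simp [toBits, peakWeight]
  | succ k ih =>
    have h : Finset.Ioc o (o + (k + 1)) = insert (o + 1) (Finset.Ioc (o + 1) (o + 1 + k)) := by
      ext i; simp; omega
    rw [h, Finset.prod_insert (by simp), toBits, toBits, peakWeight, ih]
    simp

/-- The letter `true` before the first word prevents the position `1` from counting as a peak. -/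
theorem peakWeight_descents {k : ℕ} (c g : Composition (k + 1)) :
    peakWeight true false (toBits (descents c) 0 k) (toBits (descents g) 0 k) =
      if peakSet c ⊆ symmDiff (descents g) ((descents g).image (· + 1)) then
        2 ^ (peakSet c).card else 0 := by
  have h0 : 0 ∉ descents g := fun h => by have := mem_descents_bounds h; omega
  have h1 := peakWeight_toBits (insert 0 (descents c)) (descents g) 0 k
  rw [toBits_congr (T := descents c) 0 k (by intro i hi; simp; omega)] at h1
  simp only [Finset.mem_insert_self, h0, decide_true, decide_false] at h1
  rw [h1, ← Finset.prod_filter]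
  have h2 : (Finset.Ioc 0 (0 + k)).filter
      (fun p => p ∈ insert 0 (descents c) ∧ p - 1 ∉ insert 0 (descents c)) = peakSet c := by
    ext p
    simp only [peakSet, Finset.mem_filter, Finset.mem_Ioc, Finset.mem_insert, Finset.mem_inter,
      Finset.mem_Icc]
    constructor
    · rintro ⟨h1, h2, h3⟩
      have h4 : p ∈ descents c := by
        rcases h2 with h | h
        · omega
        · exact h
      refine ⟨⟨h4, ?_, by omega⟩, fun h => h3 (Or.inr h)⟩
      by_contra h
      exact h3 (Or.inl (by omega))
    · rintro ⟨⟨h1, h2, h3⟩, h4⟩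
      refine ⟨by omega, Or.inr h1, ?_⟩
      rintro (h | h)
      · omega
      · exact h4 h
  rw [h2]
  have h3 : ∀ p ∈ peakSet c, ((if p ∈ descents g ↔ p - 1 ∈ descents g then 0 else 2) : ℚ) =
      if p ∈ symmDiff (descents g) ((descents g).image (· + 1)) then 2 else 0 := by
    intro p hp
    simp only [peakSet, Finset.mem_filter, Finset.mem_inter, Finset.mem_Icc] at hp
    have h4 : p ∈ (descents g).image (· + 1) ↔ p - 1 ∈ descents g := by
      simp only [Finset.mem_image]
      constructor
      · rintro ⟨i, hi, rfl⟩; simpa using hi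
      · intro h; exact ⟨p - 1, h, by omega⟩
    simp only [Finset.mem_symmDiff, h4]
    by_cases e1 : p ∈ descents g <;> by_cases e2 : p - 1 ∈ descents g <;> simp [e1, e2]
  rw [Finset.prod_congr rfl h3, Finset.prod_ite_zero, Finset.prod_const]
  rfl

/-- The coefficient of `M_d` in `K_{P(c)}`: on the left, computed from the expansion of
`ϑ(F_c)` with `ϑ(M_b)` replaced by the series of `nu`; on the right, by the definition of `K`. Both
are evaluated as `bitValue`. -/
theorem sum_charCoeff_eq_sum_peak {k : ℕ} (c d : Composition (k + 1)) :
    ∑ b : Composition (k + 1) with descents c ⊆ descents b, charCoeff nu d.blocks b.blocks =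
      2 ^ ((peakSet c).card + 1) *
        ∑ g : Composition (k + 1) with
          peakSet c ⊆ symmDiff (descents g) ((descents g).image (· + 1)),
          if descents g ⊆ descents d then 1 else 0 := by
  have h1 : ∀ b : Composition (k + 1), charCoeff nu d.blocks b.blocks =
      bitCoeff 1 (toBits (descents b) 0 k) (toBits (descents d) 0 k) := by
    intro b
    have := charCoeff_ofBits [] (by simp) one_pos (toBits (descents b) 0 k)
      (toBits (descents d) 0 k) (by simp)
    simp only [List.sum_nil, zero_add, List.nil_append, ofBits_toBits] at this
    simpa using this
  rw [Finset.sum_filter]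
  simp only [h1, descents_subset_iff]
  rw [sum_composition_eq_bitSum k fun b => if bitLe (toBits (descents c) 0 k) b = true then
      bitCoeff 1 b (toBits (descents d) 0 k) else 0,
    bitSum_bitCoeff k _ _ (by simp) (by simp), if_pos odd_one]
  have h2 := bitSum_peakWeight k (toBits (descents c) 0 k) (toBits (descents d) 0 k)
    (by simp) (by simp) true false
  rw [Bool.not_true, Bool.false_and, if_neg (by simp), ← sum_composition_eq_bitSum k
    fun g => if bitLe g (toBits (descents d) 0 k) = true then
      peakWeight true false (toBits (descents c) 0 k) g else 0] at h2
  rw [← h2, pow_succ', mul_assoc, Finset.sum_filter]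
  simp only [peakWeight_descents]
  congr 1
  rw [Finset.mul_sum]
  refine Finset.sum_congr rfl fun g _ => ?_
  split_ifs <;> simp

theorem monomialBasis_apply (c : Comp) :
    monomialBasis c = ⟨monomialQ c, monomialQ_mem c⟩ :=
  Module.Basis.span_apply linearIndependent_monomialQ c

theorem fundamentalBasis_apply (c : Comp) :
    fundamentalBasis c = ⟨fundamentalQ c, fundamentalQ_mem c⟩ := by
  simp [fundamentalBasis]

theorem charSeries_nil (χ : List ℕ → ℚ) : charSeries χ [] = 1 := by
  ext m
  have h : ∀ δ : List ℕ, (∀ a ∈ δ, 0 < a) → charCoeff χ δ [] = if δ = [] then 1 else 0 := by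
    intro δ hδ
    cases δ with
    | nil => simp [charCoeff]
    | cons d δ =>
      have := hδ d (by simp)
      simp [charCoeff, this.ne]
  change charCoeff χ _ [] = _
  rw [h, MvPowerSeries.coeff_one]
  · have : m.support.sort (· ≤ ·) = [] ↔ m = 0 := by
      rw [← List.length_eq_zero_iff]
      simp
    simp [this]
  · intro a ha
    obtain ⟨i, hi, rfl⟩ := List.mem_map.1 ha
    have : i ∈ m.support := by simpa using hi
    simp at this
    omega

/-- Stembridge's map on the monomial basis: `L_α` is the series attached to the character `nu`. -/
theorem theta_monomialQ (c : Comp) :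
    theta ⟨monomialQ c, monomialQ_mem c⟩ = charSeries nu c.2.blocks := by
  have key : theta = monomialBasis.constr ℤ fun c => charSeries nu c.2.blocks := by
    refine fundamentalBasis.ext fun c => ?_
    rw [theta, Module.Basis.constr_basis]
    have h1 : fundamentalBasis c =
        ∑ d : Composition c.1 with descents c.2 ⊆ descents d, monomialBasis ⟨c.1, d⟩ := by
      rw [fundamentalBasis_apply]
      apply Subtype.ext
      rw [AddSubmonoidClass.coe_finsetSum]
      simp only [monomialBasis_apply]
      rfl
    rw [h1, map_sum]
    simp only [Module.Basis.constr_basis]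
    obtain ⟨n, c⟩ := c
    dsimp only
    cases n with
    | zero =>
      have h2 : ∀ d : Composition 0, d.blocks = [] := fun d => d.blocks_eq_nil.2 rfl
      have h3 : ∀ d : Composition 0, descents d = ∅ := fun d =>
        Finset.eq_empty_of_forall_notMem fun j hj => by
          have := mem_descents_bounds hj
          omega
      simp [h2, h3, charSeries_nil]
      exact pow_zero (2 : Amb)
    | succ k =>
      rw [if_neg (by simp)]
      simp only [peakK, fundamentalQ]
      simp only [charSeries_eq_sum (χ := nu) (Composition.blocks_sum _)]
      rw [Finset.sum_comm]
      simp only [← Finset.sum_smul, sum_charCoeff_eq_sum_peak]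
      simp only [Finset.sum_filter (p := fun d => descents _ ⊆ descents d)]
      rw [Finset.sum_comm' (t' := Finset.univ)
        (s' := fun _ => Finset.univ.filter fun g : Composition (k + 1) =>
          peakSet c ⊆ symmDiff (descents g) ((descents g).image (· + 1))) (by simp),
        Finset.mul_sum]
      refine Finset.sum_congr rfl fun d _ => ?_
      rw [mul_smul, Finset.sum_smul, Algebra.smul_def, map_pow, map_ofNat]
      simp
  rw [key, ← monomialBasis_apply, Module.Basis.constr_basis]

/-- The composition with a given word of positive parts. -/
def toComp (w : List ℕ) (hw : ∀ a ∈ w, 0 < a) : Comp := ⟨w.sum, ⟨w, fun {_} h => hw _ h, rfl⟩⟩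

theorem monomialQ_toComp (w : List ℕ) (hw : ∀ a ∈ w, 0 < a) :
    monomialQ (toComp w hw) = charSeries zeta w := monomialQ_eq_charSeries _

theorem charSeries_zeta_mem {w : List ℕ} (hw : ∀ a ∈ w, 0 < a) : charSeries zeta w ∈ QSym :=
  monomialQ_toComp w hw ▸ monomialQ_mem _

theorem theta_charSeries {w : List ℕ} (hw : ∀ a ∈ w, 0 < a) :
    theta ⟨charSeries zeta w, charSeries_zeta_mem hw⟩ = charSeries nu w := by
  have h := theta_monomialQ (toComp w hw)
  simp only [monomialQ_toComp w hw] at h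
  exact h

theorem QSym_eq_span :
    QSym = Submodule.span ℤ (charSeries zeta '' {w | ∀ a ∈ w, 0 < a}) := by
  rw [QSym]
  congr 1
  ext f
  constructor
  · rintro ⟨c, rfl⟩
    exact ⟨c.2.blocks, fun a ha => c.2.blocks_pos ha, (monomialQ_eq_charSeries c).symm⟩
  · rintro ⟨w, hw, rfl⟩
    exact ⟨toComp w hw, monomialQ_toComp w hw⟩

/-- Induction principle for elements of `QSym`. -/
theorem QSym_induction {P : Amb → Prop}
    (h1 : ∀ w : List ℕ, (∀ a ∈ w, 0 < a) → P (charSeries zeta w)) (h0 : P 0)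
    (hadd : ∀ f g, f ∈ QSym → g ∈ QSym → P f → P g → P (f + g))
    (hsmul : ∀ (n : ℤ) f, f ∈ QSym → P f → P (n • f)) {f : Amb} (hf : f ∈ QSym) : P f := by
  have hf' := hf
  rw [QSym_eq_span] at hf'
  induction hf' using Submodule.span_induction with
  | mem x hx => obtain ⟨w, hw, rfl⟩ := hx; exact h1 w hw
  | zero => exact h0
  | add x y hx hy ihx ihy =>
    rw [← QSym_eq_span] at hx hy
    exact hadd x y hx hy (ihx hx) (ihy hy)
  | smul n x hx ih =>
    rw [← QSym_eq_span] at hx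
    exact hsmul n x hx (ih hx)

/-- Stembridge's map is multiplicative. -/
theorem exists_theta_mul {f g : Amb} (hf : f ∈ QSym) (hg : g ∈ QSym) :
    ∃ h : f * g ∈ QSym, theta ⟨f * g, h⟩ = theta ⟨f, hf⟩ * theta ⟨g, hg⟩ := by
  suffices h : ∃ x : QSym, (x : Amb) = f * g ∧ theta x = theta ⟨f, hf⟩ * theta ⟨g, hg⟩ by
    obtain ⟨⟨x, hx⟩, rfl, h⟩ := h
    exact ⟨hx, h⟩
  revert hf hg
  intro hf
  refine QSym_induction (P := fun f => ∀ (hf : f ∈ QSym) (hg : g ∈ QSym), ∃ x : QSym,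
    (x : Amb) = f * g ∧ theta x = theta ⟨f, hf⟩ * theta ⟨g, hg⟩) ?_ ?_ ?_ ?_ hf hf
  · intro u hu _ hg
    refine QSym_induction (P := fun g => ∀ (hg : g ∈ QSym), ∃ x : QSym,
      (x : Amb) = charSeries zeta u * g ∧
        theta x = theta ⟨_, charSeries_zeta_mem hu⟩ * theta ⟨g, hg⟩) ?_ ?_ ?_ ?_ hg hg
    · intro v hv _
      rw [theta_charSeries hu, theta_charSeries hv, charSeries_mul isChar_nu hu hv,
        charSeries_mul isChar_zeta hu hv]
      have hpos := pos_of_mem_qsh u v hu hv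
      generalize qsh u v = s at hpos
      induction s using Multiset.induction with
      | empty => exact ⟨0, by simp⟩
      | cons w s ih =>
        obtain ⟨x, hx, hx'⟩ := ih fun w' hw' => hpos w' (Multiset.mem_cons_of_mem hw')
        have hw := hpos w (Multiset.mem_cons_self _ _)
        exact ⟨⟨_, charSeries_zeta_mem hw⟩ + x, by simp [hx], by
          rw [map_add, theta_charSeries hw, hx']; simp⟩
    · intro h
      exact ⟨0, by simp, by
        rw [show (⟨0, h⟩ : QSym) = 0 from rfl]; simp⟩
    · intro g₁ g₂ h₁ h₂ i₁ i₂ _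
      obtain ⟨x₁, e₁, e₁'⟩ := i₁ h₁
      obtain ⟨x₂, e₂, e₂'⟩ := i₂ h₂
      refine ⟨x₁ + x₂, by simp [e₁, e₂, mul_add], ?_⟩
      rw [map_add, e₁', e₂', ← mul_add, ← map_add]
      rfl
    · intro n g h i _
      obtain ⟨x, e, e'⟩ := i h
      refine ⟨n • x, by simp [e]; ring, ?_⟩
      rw [map_smul, e', ← mul_smul_comm, ← map_smul]
      rfl
  · intro h hg
    exact ⟨0, by simp, by rw [show (⟨0, h⟩ : QSym) = 0 from rfl]; simp⟩
  · intro g₁ g₂ h₁ h₂ i₁ i₂ _ hg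
    obtain ⟨x₁, e₁, e₁'⟩ := i₁ h₁ hg
    obtain ⟨x₂, e₂, e₂'⟩ := i₂ h₂ hg
    refine ⟨x₁ + x₂, by simp [e₁, e₂, add_mul], ?_⟩
    rw [map_add, e₁', e₂', ← add_mul, ← map_add]
    rfl
  · intro n g h i _ hg
    obtain ⟨x, e, e'⟩ := i h hg
    refine ⟨n • x, by simp [e]; ring, ?_⟩
    rw [map_smul, e', ← smul_mul_assoc, ← map_smul]
    rfl

theorem one_mem_QSym : (1 : Amb) ∈ QSym := by
  rw [← charSeries_nil zeta]
  exact charSeries_zeta_mem (by simp)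

theorem theta_one : theta ⟨1, one_mem_QSym⟩ = 1 := by
  have h := theta_charSeries (w := []) (by simp)
  simp only [charSeries_nil] at h
  exact h

/-- `QSym` as a subring. -/
def QSymRing : Subring Amb where
  carrier := QSym
  mul_mem' hf hg := (exists_theta_mul hf hg).1
  one_mem' := one_mem_QSym
  add_mem' := QSym.add_mem
  zero_mem' := QSym.zero_mem
  neg_mem' := QSym.neg_mem

/-- Stembridge's map as a ring homomorphism. -/
noncomputable def thetaHom : QSymRing →+* Amb :=
  RingHom.mk' { toFun := fun f => theta ⟨f.1, f.2⟩
                map_one' := theta_one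
                map_mul' := fun f g => (exists_theta_mul f.2 g.2).2 }
    fun f g => theta.map_add ⟨f.1, f.2⟩ ⟨g.1, g.2⟩

/-! ### The basis of `PQSym` given by words in odd letters -/

theorem coeff_stdExp_charSeries {χ : List ℕ → ℚ} (c : Comp) (w : List ℕ) :
    MvPowerSeries.coeff (stdExp c) (charSeries χ w) = charCoeff χ c.2.blocks w := by
  rw [charSeries_eq_sum (χ := χ) (w := w) rfl, map_sum]
  simp only [map_smul, coeff_stdExp, smul_eq_mul]
  by_cases h : c.1 = w.sum
  · obtain ⟨n, c⟩ := c
    dsimp only at h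
    subst h
    rw [Finset.sum_eq_single c]
    · simp
    · intro d _ hd
      simp [hd.symm]
    · simp
  · rw [charCoeff_eq_zero_of_sum_ne (by rw [c.2.blocks_sum]; exact Ne.symm h)]
    refine Finset.sum_eq_zero fun d _ => ?_
    rw [if_neg, mul_zero]
    rintro rfl
    exact h rfl

/-- The only words `δ` with `M_δ` occurring in the series of `w` are `w` and shorter ones. -/
theorem eq_or_length_lt_of_charCoeff_ne_zero {χ : List ℕ → ℚ} {δ w : List ℕ}
    (hδ : ∀ a ∈ δ, 0 < a) (h : charCoeff χ δ w ≠ 0) : δ = w ∨ δ.length < w.length := by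
  induction δ generalizing w with
  | nil =>
    rw [charCoeff] at h
    left
    by_contra hw
    exact h (if_neg (Ne.symm hw))
  | cons d δ ih =>
    rw [List.forall_mem_cons] at hδ
    have : ∃ u v, u ++ v = w ∧ u.sum = d ∧ charCoeff χ δ v ≠ 0 := by
      by_contra! hcon
      refine h (cutSum_eq_zero fun u v huv => ?_)
      split_ifs with hu
      · rw [hcon u v huv hu, mul_zero]
      · rfl
    obtain ⟨u, v, rfl, rfl, hv⟩ := this
    have hi := ih hδ.2 hv
    match u, hδ.1 with
    | [], h0 => simp at h0
    | [a], _ =>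
      rcases hi with rfl | hi
      · left; simp
      · right; simpa using hi
    | a :: b :: u, _ =>
      right
      rcases hi with rfl | hi
      · simp
      · simp; omega

theorem charCoeff_self {χ : List ℕ → ℚ} {w : List ℕ} (hw : ∀ a ∈ w, 0 < a) :
    charCoeff χ w w = (w.map fun a => χ [a]).prod := by
  induction w with
  | nil => simp [charCoeff]
  | cons a w ih =>
    have := charCoeff_cons_append (χ := χ) [a] w w (by simpa using hw a (by simp))
      (fun b hb => hw b (by simp [hb]))
    simp only [List.sum_singleton, List.singleton_append] at this
    rw [this, ih fun b hb => hw b (by simp [hb])]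
    simp

/-- Words all of whose letters are odd. -/
def IsOddWord (w : List ℕ) : Prop := ∀ a ∈ w, Odd a

theorem IsOddWord.pos {w : List ℕ} (h : IsOddWord w) : ∀ a ∈ w, 0 < a := fun a ha => (h a ha).pos

theorem charCoeff_nu_self_ne_zero {w : List ℕ} (hw : IsOddWord w) : charCoeff nu w w ≠ 0 := by
  rw [charCoeff_self hw.pos]
  refine List.prod_ne_zero fun h => ?_
  obtain ⟨a, ha, h⟩ := List.mem_map.1 h
  rw [nu, (hw a ha).neg_one_pow] at h
  norm_num at h

/-- The `L_w`, `w` a word in odd letters, are linearly independent: `L_w` is a multiple of `M_w`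
plus a combination of shorter words. -/
theorem linearIndependent_charSeries_nu :
    LinearIndependent ℤ fun w : {w // IsOddWord w} => charSeries nu w.1 := by
  rw [linearIndependent_iff']
  intro s g hg
  by_contra! hne
  obtain ⟨c0, hc0, hgc0⟩ := hne
  obtain ⟨c, hc, hmax⟩ := Finset.exists_max_image (s.filter fun c => g c ≠ 0)
    (fun c => c.1.length) ⟨c0, by simp [hc0, hgc0]⟩
  simp only [Finset.mem_filter] at hc hmax
  have := congrArg (MvPowerSeries.coeff (R := ℚ) (stdExp (toComp c.1 c.2.pos))) hg
  simp only [map_sum, map_zsmul, coeff_stdExp_charSeries, map_zero] at this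
  rw [Finset.sum_eq_single c] at this
  · rcases smul_eq_zero.1 this with h | h
    · exact hc.2 h
    · exact charCoeff_nu_self_ne_zero c.2 h
  · intro d hd hdc
    by_cases hgd : g d = 0
    · simp [hgd]
    by_contra hcon
    have h0 : charCoeff nu c.1 d.1 ≠ 0 := fun h => hcon (by
      change g d • charCoeff nu c.1 d.1 = 0
      rw [h, smul_zero])
    rcases eq_or_length_lt_of_charCoeff_ne_zero c.2.pos h0 with h | h
    · exact hdc (Subtype.ext h.symm)
    · have := hmax d ⟨hd, hgd⟩
      omega
  · exact fun h => absurd hc.1 h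

theorem nu_append_even {a : ℕ} (ha : Even a) (u : List ℕ) : nu (u ++ [a]) = 0 := by
  rw [nu_append (by simp), nu, ha.neg_one_pow, sub_self, mul_zero]

theorem charCoeff_nu_append_even {a : ℕ} (ha : Even a) (δ u : List ℕ) :
    charCoeff nu δ (u ++ [a]) = 0 := by
  induction δ generalizing u with
  | nil => simp [charCoeff]
  | cons d δ ih =>
    refine cutSum_eq_zero fun p q hpq => ?_
    rcases q.eq_nil_or_concat with rfl | ⟨q, b, rfl⟩
    · rw [List.append_nil] at hpq
      rw [hpq, nu_append_even ha]
      simp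
    · rw [List.concat_eq_append, ← List.append_assoc] at hpq
      obtain ⟨rfl, h⟩ := List.append_inj' hpq rfl
      rw [List.concat_eq_append, h, ih]
      simp

theorem nu_merge {a : ℕ} (ha : Even a) (u : List ℕ) (b : ℕ) (v : List ℕ) :
    nu (u ++ a :: b :: v) = - nu (u ++ (a + b) :: v) := by
  rw [nu_append (by simp), nu_append (by simp)]
  have : nu (a :: b :: v) = - nu ((a + b) :: v) := by
    rcases eq_or_ne v [] with rfl | hv
    · simp [nu, pow_add, ha.neg_one_pow]
    · rw [nu, nu_cons hv, nu_cons hv]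
      simp [pow_add, ha.neg_one_pow]
  rw [this]
  ring

theorem charCoeff_nu_merge {a : ℕ} (ha : Even a) (δ u : List ℕ) (b : ℕ) (v : List ℕ) :
    charCoeff nu δ (u ++ a :: b :: v) = - charCoeff nu δ (u ++ (a + b) :: v) := by
  induction δ generalizing u with
  | nil => simp [charCoeff]
  | cons d δ ih =>
    rw [charCoeff, charCoeff]
    suffices h : ∀ p, cutSum (fun x y => if (p ++ x).sum = d then
          nu (p ++ x) * charCoeff nu δ y else 0) (u ++ a :: b :: v) =
        - cutSum (fun x y => if (p ++ x).sum = d then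
          nu (p ++ x) * charCoeff nu δ y else 0) (u ++ (a + b) :: v) from h []
    intro p
    induction u generalizing p with
    | nil =>
      rw [List.nil_append, List.nil_append, cutSum_cons, cutSum_cons, cutSum_cons]
      have h1 := ih []
      simp only [List.nil_append] at h1
      rw [h1, nu_append_even ha, zero_mul, ite_self, zero_add, neg_add]
      congr 1
      · split_ifs <;> simp
      · rw [cutSum, cutSum, ← Finset.sum_neg_distrib]
        refine Finset.sum_congr rfl fun i _ => ?_
        rw [nu_merge ha]
        simp only [List.sum_append, List.sum_cons, add_assoc]
        split_ifs <;> simp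
    | cons c u ihu =>
      rw [List.cons_append, List.cons_append, cutSum_cons, cutSum_cons, ← List.cons_append,
        ← List.cons_append, ih (c :: u), neg_add]
      congr 1
      · split_ifs <;> simp
      · simpa using ihu (p ++ [c])

/-- An even letter of a word `w` is merged with the next letter in `L_w`. -/
theorem charSeries_nu_merge {a : ℕ} (ha : Even a) (u : List ℕ) (b : ℕ) (v : List ℕ) :
    charSeries nu (u ++ a :: b :: v) = - charSeries nu (u ++ (a + b) :: v) := by
  ext m
  exact charCoeff_nu_merge ha _ u b v

theorem charSeries_nu_append_even {a : ℕ} (ha : Even a) (u : List ℕ) :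
    charSeries nu (u ++ [a]) = 0 := by
  ext m
  exact charCoeff_nu_append_even ha _ u

/-- The span of the `L_w` with `w` a word in odd letters that satisfies `p`. -/
def peakSpan (p : List ℕ → Prop) : Submodule ℤ Amb :=
  Submodule.span ℤ (charSeries nu '' {w | IsOddWord w ∧ p w})

theorem charSeries_mem_peakSpan {p : List ℕ → Prop} {w : List ℕ} (h : IsOddWord w) (hp : p w) :
    charSeries nu w ∈ peakSpan p := Submodule.subset_span ⟨w, ⟨h, hp⟩, rfl⟩

theorem peakSpan_mono {p p' : List ℕ → Prop} (h : ∀ w, p w → p' w) : peakSpan p ≤ peakSpan p' :=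
  Submodule.span_mono (Set.image_mono fun _ hw => ⟨hw.1, h _ hw.2⟩)

/-- Merging even letters expresses any `L_w` by words in odd letters. -/
theorem charSeries_nu_mem (w : List ℕ) :
    charSeries nu w ∈ peakSpan fun w' => w'.sum = w.sum ∧ w'.length ≤ w.length := by
  induction hn : w.length using Nat.strong_induction_on generalizing w with
  | _ n ih =>
    by_cases hw : IsOddWord w
    · exact charSeries_mem_peakSpan hw ⟨rfl, hn.le⟩
    · simp only [IsOddWord, not_forall, Nat.not_odd_iff_even] at hw
      obtain ⟨a, ha, hev⟩ := hw
      obtain ⟨u, v, rfl⟩ := List.append_of_mem ha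
      cases v with
      | nil =>
        rw [charSeries_nu_append_even hev]
        exact zero_mem _
      | cons b v =>
        rw [charSeries_nu_merge hev]
        refine neg_mem (peakSpan_mono ?_ (ih _ ?_ (u ++ (a + b) :: v) rfl))
        · rintro w ⟨h1, h2⟩
          simp at h1 h2 hn ⊢
          omega
        · simp at hn ⊢; omega

theorem theta_mem_peakSpan (f : QSym) : theta f ∈ peakSpan fun _ => True := by
  obtain ⟨f, hf⟩ := f
  refine QSym_induction (P := fun f => ∀ hf : f ∈ QSym, theta ⟨f, hf⟩ ∈ peakSpan fun _ => True)
    ?_ ?_ ?_ ?_ hf hf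
  · intro w hw _
    rw [theta_charSeries hw]
    exact peakSpan_mono (fun _ _ => trivial) (charSeries_nu_mem w)
  · intro h
    rw [show (⟨0, h⟩ : QSym) = 0 from rfl, map_zero]
    exact zero_mem _
  · intro f g hf hg h1 h2 _
    have : theta ⟨f, hf⟩ + theta ⟨g, hg⟩ ∈ peakSpan fun _ => True := add_mem (h1 _) (h2 _)
    rwa [← map_add] at this
  · intro n f hf h _
    have : n • theta ⟨f, hf⟩ ∈ peakSpan fun _ => True := Submodule.smul_mem _ _ (h _)
    rwa [← map_smul] at this

theorem fundamental_theta (c : Comp) : theta ⟨fundamentalQ c, fundamentalQ_mem c⟩ =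
    if c.1 = 0 then 1 else peakK c.1 (peakSet c.2) := by
  rw [← fundamentalBasis_apply, theta, Module.Basis.constr_basis]

/-- The peak set `P(α)` of a composition is a peak set, so `ϑ(F_α)` is a generator. -/
theorem theta_mem_PQSym (f : QSym) : theta f ∈ PQSym := by
  induction fundamentalBasis.mem_span f using Submodule.span_induction with
  | mem x hx =>
    obtain ⟨c, rfl⟩ := hx
    rw [fundamentalBasis_apply, fundamental_theta]
    split_ifs with h
    · exact one_mem _
    · have hc : IsPeakSet c.1 (peakSet c.2) := by
        refine ⟨fun i hi => ?_, fun i hi hi' => ?_⟩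
        · simp only [peakSet, Finset.mem_filter, Finset.mem_inter] at hi
          exact hi.1.2
        · simp only [peakSet, Finset.mem_filter, Finset.mem_inter] at hi hi'
          exact hi.2 hi'.1.1
      exact Subring.subset_closure ⟨_, _, by omega, hc, rfl⟩
  | zero => rw [map_zero]; exact zero_mem _
  | add x y _ _ hx hy => rw [map_add]; exact add_mem hx hy
  | smul n x _ hx => rw [map_smul]; exact zsmul_mem hx n

/-- Additively, `PQSym` is spanned by the `L_w`, `w` a word in odd letters. -/
theorem mem_PQSym_iff (f : Amb) : f ∈ PQSym ↔ f ∈ peakSpan fun _ => True := by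
  constructor
  · intro hf
    have : PQSym ≤ thetaHom.range := by
      refine Subring.closure_le.2 ?_
      rintro _ ⟨n, P, hn, hP, rfl⟩
      obtain ⟨k, rfl⟩ : ∃ k, n = k + 1 := ⟨n - 1, by omega⟩
      -- `P` is the peak set of the composition with descent set `P`
      have hS : P ⊆ Finset.Icc 1 k := fun i hi => by
        have := Finset.mem_Icc.1 (hP.1 hi)
        exact Finset.mem_Icc.2 (by omega)
      set c := compOfBits (toBits P 0 k) (length_toBits P 0 k)
      have hc : descents c = P := descents_compOfBits_toBits P hS
      have hp : peakSet c = P := by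
        rw [peakSet, hc, Finset.inter_eq_left.2 hP.1]
        exact Finset.filter_true_of_mem hP.2
      refine ⟨⟨_, fundamentalQ_mem ⟨k + 1, c⟩⟩, ?_⟩
      refine (fundamental_theta ⟨k + 1, c⟩).trans ?_
      rw [if_neg (by simp)]
      simp [hp]
    obtain ⟨g, rfl⟩ := this hf
    exact theta_mem_peakSpan _
  · intro hf
    rw [peakSpan] at hf
    induction hf using Submodule.span_induction with
    | mem x hx =>
      obtain ⟨w, hw, rfl⟩ := hx
      rw [← theta_charSeries hw.1.pos]
      exact theta_mem_PQSym _
    | zero => exact zero_mem _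
    | add x y _ _ hx hy => exact add_mem hx hy
    | smul n x _ hx => exact zsmul_mem hx n

/-- The basis of `PQSym` formed by the `L_w`, `w` a word in odd letters. -/
noncomputable def peakBasis : Module.Basis {w // IsOddWord w} ℤ PQSym :=
  Module.Basis.mk (v := fun w => (⟨charSeries nu w.1,
      (mem_PQSym_iff _).2 (charSeries_mem_peakSpan w.2 trivial)⟩ : PQSym))
    (LinearIndependent.of_comp PQSym.subtype.toAddMonoidHom.toIntLinearMap
      linearIndependent_charSeries_nu)
    (by
      rintro ⟨x, hx⟩ -
      have h := (mem_PQSym_iff x).1 hx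
      have h' : x ∈ (Submodule.span ℤ (Set.range fun w : {w // IsOddWord w} =>
          (⟨charSeries nu w.1, (mem_PQSym_iff _).2 (charSeries_mem_peakSpan w.2 trivial)⟩ :
            PQSym))).map PQSym.subtype.toAddMonoidHom.toIntLinearMap := by
        rw [Submodule.map_span, ← Set.range_comp]
        refine Submodule.span_mono ?_ h
        rintro _ ⟨w, hw, rfl⟩
        exact ⟨⟨w, hw.1⟩, rfl⟩
      obtain ⟨y, hy, rfl⟩ := h'
      exact hy)

theorem coe_peakBasis (w : {w // IsOddWord w}) : (peakBasis w : Amb) = charSeries nu w.1 := by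
  simp [peakBasis]

theorem mem_peakSpan_iff {p : List ℕ → Prop} (x : PQSym) :
    (x : Amb) ∈ peakSpan p ↔ ∀ w, peakBasis.repr x w ≠ 0 → p w.1 := by
  have h1 : (x : Amb) ∈ peakSpan p ↔ x ∈ Submodule.span ℤ (peakBasis '' {w | p w.1}) := by
    have : peakSpan p = (Submodule.span ℤ (peakBasis '' {w | p w.1})).map
        PQSym.subtype.toAddMonoidHom.toIntLinearMap := by
      rw [Submodule.map_span, peakSpan, Set.image_image]
      congr 1
      ext y
      constructor
      · rintro ⟨w, hw, rfl⟩
        exact ⟨⟨w, hw.1⟩, hw.2, coe_peakBasis _⟩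
      · rintro ⟨w, hw, rfl⟩
        exact ⟨w.1, ⟨w.2, hw⟩, (coe_peakBasis _).symm⟩
    rw [this]
    constructor
    · rintro ⟨y, hy, h⟩
      rwa [← Subtype.ext h]
    · intro h
      exact ⟨x, h, rfl⟩
  rw [h1, Module.Basis.mem_span_image]
  constructor
  · intro h w hw
    exact h (by simpa using hw)
  · intro h w hw
    exact h w (by simpa using hw)

/-- `PQSym` is saturated with respect to the spans of sets of basis elements. -/
theorem mem_peakSpan_of_smul_mem {p : List ℕ → Prop} {x : Amb} (hx : x ∈ PQSym) {n : ℤ}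
    (hn : n ≠ 0) (h : n • x ∈ peakSpan p) : x ∈ peakSpan p := by
  lift x to PQSym using hx
  have h' : ((n • x : PQSym) : Amb) ∈ peakSpan p := by simpa using h
  rw [mem_peakSpan_iff] at h' ⊢
  intro w hw
  refine h' w ?_
  rw [map_smul, Finsupp.smul_apply, smul_eq_mul]
  exact mul_ne_zero hn hw

/-! ### Newton's identities -/

section Newton

variable {A : Type*} [CommRing A]

/-- Newton's identities between power sums `p_{j+1} = p j` and elementary symmetric functions
`e_n = e n`. -/
def IsNewton (p e : ℕ → A) : Prop :=
  e 0 = 1 ∧ ∀ n : ℕ, ((n + 1 : ℕ) : A) * e (n + 1) =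
    ∑ j ∈ Finset.range (n + 1), (-1) ^ j * p j * e (n - j)

/-- Up to degree `N`, the elementary symmetric functions are determined by the power sums. -/
theorem IsNewton.eq_of_le [IsAddTorsionFree A] {p p' e e' : ℕ → A} (h : IsNewton p e)
    (h' : IsNewton p' e') {N : ℕ} (hp : ∀ j < N, p j = p' j) {n : ℕ} (hn : n ≤ N) :
    e n = e' n := by
  induction n using Nat.strong_induction_on with
  | _ n ih =>
    cases n with
    | zero => rw [h.1, h'.1]
    | succ n =>
      have h1 := h.2 n
      have h2 : ((n + 1 : ℕ) : A) * e (n + 1) = ((n + 1 : ℕ) : A) * e' (n + 1) := by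
        rw [h.2, h'.2]
        refine Finset.sum_congr rfl fun j hj => ?_
        rw [Finset.mem_range] at hj
        rw [hp j (by omega), ih (n - j) (by omega) (by omega)]
      rw [← nsmul_eq_mul, ← nsmul_eq_mul] at h2
      exact nsmul_right_injective (Nat.succ_ne_zero n) h2

theorem IsNewton.unique [IsAddTorsionFree A] {p e e' : ℕ → A} (h : IsNewton p e)
    (h' : IsNewton p e') : e = e' :=
  funext fun n => h.eq_of_le h' (N := n) (fun _ _ => rfl) le_rfl

/-- Up to degree `N`, the power sums are determined by the elementary symmetric functions. -/
theorem IsNewton.power_eq_of_le {p p' e e' : ℕ → A} (h : IsNewton p e)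
    (h' : IsNewton p' e') {N : ℕ} (he : ∀ n ≤ N, e n = e' n) {j : ℕ} (hj : j < N) :
    p j = p' j := by
  induction j using Nat.strong_induction_on with
  | _ j ih =>
    have h1 := h.2 j
    have h2 := h'.2 j
    have h4 : ∑ i ∈ Finset.range j, (-1) ^ i * p' i * e' (j - i) =
        ∑ i ∈ Finset.range j, (-1) ^ i * p i * e (j - i) := by
      refine Finset.sum_congr rfl fun i hi => ?_
      rw [Finset.mem_range] at hi
      rw [ih i hi (by omega), he (j - i) (by omega)]
    rw [he (j + 1) (by omega), h2, Finset.sum_range_succ, Finset.sum_range_succ, h4] at h1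
    have h3 := add_left_cancel h1
    rw [Nat.sub_self, h.1, h'.1, mul_one, mul_one] at h3
    have := congrArg (fun x => (-1) ^ j * x) h3
    simpa [← mul_assoc, ← pow_add, ← two_mul, pow_mul] using this.symm

theorem IsNewton.map {B : Type*} [CommRing B] (f : A →+* B) {p e : ℕ → A} (h : IsNewton p e) :
    IsNewton (fun j => f (p j)) fun n => f (e n) := by
  refine ⟨by simp [h.1], fun n => ?_⟩
  have := congrArg f (h.2 n)
  simpa using this

theorem isNewton_mvPolynomial (σ R : Type*) [Fintype σ] [CommRing R] :
    IsNewton (fun j => MvPolynomial.psum σ R (j + 1)) fun n => MvPolynomial.esymm σ R n := by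
  refine ⟨MvPolynomial.esymm_zero _ _, fun n => ?_⟩
  have h := MvPolynomial.mul_esymm_eq_sum σ R (n + 1)
  rw [h, Finset.sum_filter, Finset.Nat.sum_antidiagonal_eq_sum_range_succ_mk,
    Finset.sum_range_succ, ← Finset.sum_range_reflect]
  simp only [lt_irrefl, if_false, add_zero, Nat.add_sub_cancel]
  rw [Finset.mul_sum]
  refine Finset.sum_congr rfl fun j hj => ?_
  rw [Finset.mem_range] at hj
  rw [if_pos (by omega), show n + 1 - (n - j) = j + 1 by omega]
  have : ((-1) ^ (n + 1 + 1) * (-1) ^ (n - j) : MvPolynomial σ R) = (-1) ^ j := by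
    rw [← pow_add, show n + 1 + 1 + (n - j) = 2 * (n - j + 1) + j by omega, pow_add, pow_mul]
    simp
  rw [← this]
  ring

/-- The exponential formula satisfies Newton's identities. -/
theorem isNewton_exp_subst [Algebra ℚ A] (p : ℕ → A) :
    IsNewton p fun n => PowerSeries.coeff n ((PowerSeries.exp ℚ).subst
      (PowerSeries.X * PowerSeries.mk fun j : ℕ =>
        ((-1 : ℚ) ^ j / (j + 1)) • p j : PowerSeries A)) := by
  set g : PowerSeries A := PowerSeries.X * PowerSeries.mk fun j : ℕ =>
        ((-1 : ℚ) ^ j / (j + 1)) • p j with hg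
  have hs : PowerSeries.HasSubst g := PowerSeries.HasSubst.of_constantCoeff_zero' (by simp [hg])
  have h1 : (PowerSeries.exp ℚ).subst g = (PowerSeries.exp A).subst g := by
    ext n
    rw [PowerSeries.coeff_subst' hs, PowerSeries.coeff_subst' hs]
    refine finsum_congr fun d => ?_
    rw [PowerSeries.coeff_exp, PowerSeries.coeff_exp, smul_eq_mul, Algebra.smul_def]
    simp
  have hd : PowerSeries.derivative A g = PowerSeries.mk fun j => (-1) ^ j * p j := by
    ext n
    rw [PowerSeries.coeff_derivative, hg, PowerSeries.coeff_succ_X_mul, PowerSeries.coeff_mk,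
      PowerSeries.coeff_mk, Algebra.smul_def]
    have h2 : (n + 1 : A) = algebraMap ℚ A (n + 1) := by simp
    have h3 : ((-1) ^ n : A) = algebraMap ℚ A ((-1) ^ n) := by simp
    rw [h2, h3, mul_right_comm, ← map_mul, div_mul_cancel₀]
    positivity
  rw [h1]
  constructor
  · change PowerSeries.coeff 0 _ = 1
    rw [PowerSeries.coeff_subst' hs, finsum_eq_single _ 0]
    · simp
    · intro d hd
      simp [hg, mul_pow, hd]
  · intro n
    have h2 := congrArg (PowerSeries.coeff n)
      (PowerSeries.derivative_subst (f := PowerSeries.exp A) hs)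
    rw [PowerSeries.coeff_derivative, PowerSeries.derivative_exp, hd, PowerSeries.coeff_mul,
      Finset.Nat.sum_antidiagonal_eq_sum_range_succ_mk, ← Finset.sum_range_reflect] at h2
    rw [Nat.cast_succ, mul_comm, h2]
    refine Finset.sum_congr rfl fun j hj => ?_
    rw [Finset.mem_range] at hj
    simp only [PowerSeries.coeff_mk]
    rw [show n + 1 - 1 - j = n - j by omega, show n - (n - j) = j by omega]
    ring

end Newton

instance : IsAddTorsionFree Amb := .of_module_rat Amb

/-! ### The lambda operations on the monomial quasisymmetric functions -/

theorem charPoly_zeta_nil (is : List ℕ) : charPoly zeta is [] = 1 := by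
  induction is with
  | nil => simp [charPoly]
  | cons i is ih => simp [charPoly, ih, zeta, MvPowerSeries.monomial_zero_one]

theorem charPoly_zeta_cons (i a : ℕ) (is w : List ℕ) :
    charPoly zeta (i :: is) (a :: w) = charPoly zeta is (a :: w) +
      MvPowerSeries.monomial (Finsupp.single i a) 1 * charPoly zeta is w := by
  rw [charPoly, cutSum_cons]
  congr 1
  · simp [zeta, MvPowerSeries.monomial_zero_one]
  · cases w with
    | nil => simp [zeta]
    | cons b w =>
      rw [cutSum_cons, cutSum_eq_zero (by intro u v _; simp [zeta])]
      simp [zeta]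

/-- The monomials that occur in the restriction of `M_w` to the variables in a list. -/
noncomputable def charMonos : List ℕ → List ℕ → List Amb
  | _, [] => [1]
  | [], _ :: _ => []
  | i :: is, a :: w => charMonos is (a :: w) ++
      (charMonos is w).map (MvPowerSeries.monomial (Finsupp.single i a) 1 * ·)

theorem charPoly_zeta_scale (k : ℕ) (is w : List ℕ) :
    charPoly zeta is (w.map (k * ·)) = ((charMonos is w).map (· ^ k)).sum := by
  induction is generalizing w with
  | nil => cases w <;> simp [charPoly, charMonos]
  | cons i is ih =>
    cases w with
    | nil => simp [charMonos, charPoly_zeta_nil]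
    | cons a w =>
      rw [List.map_cons, charPoly_zeta_cons, charMonos, List.map_append, List.sum_append,
        ← ih, ← List.map_cons (f := (k * ·)), ih, List.map_map, add_right_inj, ih,
        ← List.sum_map_mul_left]
      congr 1
      refine List.map_congr_left fun x _ => ?_
      simp [mul_pow, MvPowerSeries.monomial_pow]

/-- Power series with integer coefficients. -/
noncomputable def intSeries : Subring Amb :=
  (MvPowerSeries.map (σ := ℕ) (Int.castRingHom ℚ)).range

theorem charMonos_subset (is w : List ℕ) : ∀ x ∈ charMonos is w, x ∈ intSeries := by
  induction is generalizing w with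
  | nil =>
    cases w with
    | nil => simp [charMonos, one_mem]
    | cons a w => simp [charMonos]
  | cons i is ih =>
    cases w with
    | nil => simp [charMonos, one_mem]
    | cons a w =>
      intro x hx
      rw [charMonos, List.mem_append, List.mem_map] at hx
      rcases hx with hx | ⟨y, hy, rfl⟩
      · exact ih _ x hx
      · refine mul_mem ?_ (ih _ y hy)
        exact ⟨MvPowerSeries.monomial (Finsupp.single i a) 1, by simp⟩

/-- The elementary symmetric functions of a list of elements satisfy Newton's identities. -/
theorem exists_isNewton_list {A : Type*} [CommRing A] (B : Subring A) (l : List A)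
    (hl : ∀ x ∈ l, x ∈ B) :
    ∃ e : ℕ → A, IsNewton (fun j => (l.map (· ^ (j + 1))).sum) e ∧ ∀ n, e n ∈ B := by
  have h := (isNewton_mvPolynomial (Fin l.length) ℤ).map
    (MvPolynomial.aeval (R := ℤ) fun i : Fin l.length => l.get i).toRingHom
  refine ⟨fun n => MvPolynomial.aeval (R := ℤ) (fun i : Fin l.length => l.get i)
    (MvPolynomial.esymm (Fin l.length) ℤ n), ?_, fun n => ?_⟩
  · convert! h using 2 with j
    simp only [AlgHom.toRingHom_eq_coe, RingHom.coe_coe, MvPolynomial.psum, map_sum, map_pow,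
      MvPolynomial.aeval_X]
    conv_lhs => rw [← List.ofFn_get l]
    rw [List.map_ofFn, List.sum_ofFn]
    rfl
  · simp only [MvPolynomial.esymm, map_sum, map_prod,
      MvPolynomial.aeval_X]
    exact sum_mem fun s _ => prod_mem fun i _ => hl _ (List.get_mem _ _)

/-- The operation `λ^n (M_w)`. -/
noncomputable def lambdaM (w : List ℕ) (n : ℕ) : Amb :=
  PowerSeries.coeff n ((PowerSeries.exp ℚ).subst
      (PowerSeries.X * PowerSeries.mk fun j : ℕ =>
        ((-1 : ℚ) ^ j / (j + 1)) • charSeries zeta (w.map ((j + 1) * ·)) : PowerSeries Amb))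

theorem isNewton_lambdaM (w : List ℕ) :
    IsNewton (fun j => charSeries zeta (w.map ((j + 1) * ·))) (lambdaM w) :=
  isNewton_exp_subst _

theorem pos_scale {w : List ℕ} (hw : ∀ a ∈ w, 0 < a) {k : ℕ} (hk : 0 < k) :
    ∀ a ∈ w.map (k * ·), 0 < a := by
  intro a ha
  obtain ⟨b, hb, rfl⟩ := List.mem_map.1 ha
  exact Nat.mul_pos hk (hw b hb)

/-- The coefficients of `λ^n (M_w)` are integers: after restriction to finitely many variables,
`λ^n (M_w)` is the `n`-th elementary symmetric function of the monomials of `M_w`. -/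
theorem coeff_lambdaM {w : List ℕ} (hw : ∀ a ∈ w, 0 < a) (n : ℕ) (m : ℕ →₀ ℕ) :
    ∃ z : ℤ, MvPowerSeries.coeff m (lambdaM w n) = z := by
  set is := m.support.sort (· ≤ ·) with hdef
  have his : is.Pairwise (· < ·) := Finset.sortedLT_sort _ |>.pairwise
  have hm : ∀ m' : ℕ →₀ ℕ, m' ≤ m → ∀ i ∈ m'.support, i ∈ is := by
    intro m' h i hi
    simp only [hdef, Finset.mem_sort, Finsupp.mem_support_iff] at hi ⊢
    have := h i
    omega
  obtain ⟨e, he, heB⟩ := exists_isNewton_list intSeries _ (charMonos_subset is w)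
  suffices h : ∀ m' ≤ m, MvPowerSeries.coeff m' (lambdaM w n) = MvPowerSeries.coeff m' (e n) by
    obtain ⟨f, hf⟩ := heB n
    refine ⟨MvPowerSeries.coeff m f, ?_⟩
    rw [h m le_rfl, ← hf]
    simp
  induction n using Nat.strong_induction_on with
  | _ n ih =>
    intro m' hm'
    cases n with
    | zero => rw [he.1, (isNewton_lambdaM w).1]
    | succ n =>
      have h1 := congrArg (MvPowerSeries.coeff m') ((isNewton_lambdaM w).2 n)
      have h2 := congrArg (MvPowerSeries.coeff m') (he.2 n)
      rw [← nsmul_eq_mul, map_nsmul, map_sum] at h1 h2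
      refine nsmul_right_injective (Nat.succ_ne_zero n) (h1.trans (Eq.trans ?_ h2.symm))
      refine Finset.sum_congr rfl fun j hj => ?_
      rw [Finset.mem_range] at hj
      rw [mul_assoc, mul_assoc]
      have h3 : ∀ x : Amb, MvPowerSeries.coeff m' ((-1) ^ j * x) =
          (-1) ^ j * MvPowerSeries.coeff m' x := by
        intro x
        rcases neg_one_pow_eq_or Amb j with h | h <;> rcases Nat.even_or_odd j with h' | h' <;>
          simp [h'.neg_one_pow]
      rw [h3, h3, MvPowerSeries.coeff_mul, MvPowerSeries.coeff_mul]
      congr 1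
      refine Finset.sum_congr rfl fun p hp => ?_
      rw [Finset.HasAntidiagonal.mem_antidiagonal] at hp
      rw [ih (n - j) (by omega) p.2 ((hp ▸ le_add_self : p.2 ≤ m').trans hm'),
        coeff_charSeries_eq_coeff_charPoly rfl his
          (hm _ ((hp ▸ le_self_add : p.1 ≤ m').trans hm')) (pos_scale hw (Nat.succ_pos j)),
        charPoly_zeta_scale]

/-- Newton's identities express `λ^n (M_w)` rationally by products of monomial functions. -/
theorem lambdaM_mem_span_rat {w : List ℕ} (hw : ∀ a ∈ w, 0 < a) (n : ℕ) :
    lambdaM w n ∈ Submodule.span ℚ (charSeries zeta '' {w | ∀ a ∈ w, 0 < a}) := by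
  set V := Submodule.span ℚ (charSeries zeta '' {w | ∀ a ∈ w, 0 < a}) with hV
  have hmul : ∀ f g, f ∈ V → g ∈ V → f * g ∈ V := by
    intro f g hf hg
    have h1 : V * V ≤ V := by
      conv_lhs => rw [hV, Submodule.span_mul_span]
      refine Submodule.span_le.2 ?_
      rintro _ ⟨_, ⟨u, hu, rfl⟩, _, ⟨v, hv, rfl⟩, rfl⟩
      change charSeries zeta u * charSeries zeta v ∈ V
      rw [charSeries_mul isChar_zeta hu hv]
      refine multiset_sum_mem _ fun x hx => ?_
      obtain ⟨w, hw, rfl⟩ := Multiset.mem_map.1 hx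
      exact Submodule.subset_span ⟨w, pos_of_mem_qsh u v hu hv w hw, rfl⟩
    exact h1 (Submodule.mul_mem_mul hf hg)
  induction n using Nat.strong_induction_on with
  | _ n ih =>
    cases n with
    | zero =>
      rw [(isNewton_lambdaM w).1, ← charSeries_nil zeta]
      exact Submodule.subset_span ⟨[], by simp, rfl⟩
    | succ n =>
      have h1 := (isNewton_lambdaM w).2 n
      have h2 : lambdaM w (n + 1) = ((n + 1 : ℕ) : ℚ)⁻¹ •
          (((n + 1 : ℕ) : Amb) * lambdaM w (n + 1)) := by
        rw [← nsmul_eq_mul, ← Nat.cast_smul_eq_nsmul ℚ, smul_smul, inv_mul_cancel₀, one_smul]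
        positivity
      rw [h2, h1]
      refine V.smul_mem _ (V.sum_mem fun j hj => ?_)
      rw [Finset.mem_range] at hj
      have h3 : charSeries zeta (w.map ((j + 1) * ·)) * lambdaM w (n - j) ∈ V :=
        hmul _ _ (Submodule.subset_span ⟨_, pos_scale hw (Nat.succ_pos j), rfl⟩)
          (ih _ (by omega))
      rw [mul_assoc]
      rcases Nat.even_or_odd j with h' | h'
      · simpa [h'.neg_one_pow] using h3
      · simpa [h'.neg_one_pow] using h3

/-- A rational combination of the `M_α` whose coefficients as a series are integers is an integral
combination. -/
theorem lambdaM_mem {w : List ℕ} (hw : ∀ a ∈ w, 0 < a) (n : ℕ) : lambdaM w n ∈ QSym := by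
  have h1 : charSeries zeta '' {w | ∀ a ∈ w, 0 < a} = Set.range monomialQ := by
    ext f
    constructor
    · rintro ⟨w, hw, rfl⟩
      exact ⟨toComp w hw, monomialQ_toComp w hw⟩
    · rintro ⟨c, rfl⟩
      exact ⟨c.2.blocks, fun a ha => c.2.blocks_pos ha, (monomialQ_eq_charSeries c).symm⟩
  have h2 := lambdaM_mem_span_rat hw n
  rw [h1] at h2
  obtain ⟨c, hc⟩ := Finsupp.mem_span_range_iff_exists_finsupp.1 h2
  rw [← hc]
  refine QSym.sum_mem fun d hd => ?_
  have h3 : MvPowerSeries.coeff (stdExp d) (lambdaM w n) = c d := by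
    rw [← hc, Finsupp.sum, map_sum, Finset.sum_eq_single d]
    · simp [coeff_stdExp]
    · intro d' _ hd'
      simp [coeff_stdExp, hd'.symm]
    · intro h
      exact absurd hd h
  obtain ⟨z, hz⟩ := coeff_lambdaM hw n (stdExp d)
  change c d • monomialQ d ∈ QSym
  rw [← h3, hz]
  have : (z : ℚ) • monomialQ d = z • monomialQ d := Int.cast_smul_eq_zsmul ℚ z _
  rw [this]
  exact QSym.smul_mem _ (monomialQ_mem d)

/-! ### The lambda operations on `PQSym` -/

theorem nu_scale {k : ℕ} (hk : Odd k) (w : List ℕ) : nu (w.map (k * ·)) = nu w := by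
  induction w with
  | nil => rfl
  | cons a w ih =>
    rcases eq_or_ne w [] with rfl | hw
    · simp [nu, pow_mul, hk.neg_one_pow]
    · rw [List.map_cons, nu_cons (by simpa using hw), nu_cons hw, ih]
      simp [pow_succ, pow_mul, hk.neg_one_pow]

theorem sum_scale (k : ℕ) (w : List ℕ) : (w.map (k * ·)).sum = k * w.sum := by
  rw [List.sum_map_mul_left, List.map_id']

theorem cutSum_scale {R : Type*} [AddCommMonoid R] (k : ℕ) (G : List ℕ → List ℕ → R)
    (w : List ℕ) :
    cutSum G (w.map (k * ·)) = cutSum (fun u v => G (u.map (k * ·)) (v.map (k * ·))) w := by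
  simp [cutSum, List.map_take, List.map_drop]

theorem charCoeff_nu_scale {k : ℕ} (hk : Odd k) (δ w : List ℕ) :
    charCoeff nu (δ.map (k * ·)) (w.map (k * ·)) = charCoeff nu δ w := by
  induction δ generalizing w with
  | nil => simp [charCoeff]
  | cons d δ ih =>
    rw [List.map_cons, charCoeff, cutSum_scale, charCoeff]
    simp only [nu_scale hk, ih, sum_scale, Nat.mul_right_inj hk.pos.ne']

theorem charCoeff_scale_eq_zero {χ : List ℕ → ℚ} {k : ℕ} {δ : List ℕ} (w : List ℕ)
    (h : ∃ d ∈ δ, ¬ k ∣ d) : charCoeff χ δ (w.map (k * ·)) = 0 := by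
  induction δ generalizing w with
  | nil => simp at h
  | cons d δ ih =>
    rw [charCoeff, cutSum_scale]
    refine cutSum_eq_zero fun u v _ => ?_
    split_ifs with hu
    · rw [ih, mul_zero]
      obtain ⟨x, hx, hkx⟩ := h
      rcases List.mem_cons.1 hx with rfl | hx
      · exact absurd ⟨_, hu.symm.trans (sum_scale k u)⟩ hkx
      · exact ⟨x, hx, hkx⟩
    · rfl

theorem charSeries_nu_scale_even {k : ℕ} (hk : Even k) {w : List ℕ} (hw : w ≠ []) :
    charSeries nu (w.map (k * ·)) = 0 := by
  rcases w.eq_nil_or_concat with rfl | ⟨u, a, rfl⟩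
  · exact absurd rfl hw
  · rw [List.concat_eq_append, List.map_append]
    exact charSeries_nu_append_even (hk.mul_right a) _

theorem adamsQ_charSeries (k : ℕ+) {w : List ℕ} (hw : ∀ a ∈ w, 0 < a) :
    theta (adamsQ k ⟨charSeries zeta w, charSeries_zeta_mem hw⟩) =
      charSeries nu (w.map ((k : ℕ) * ·)) := by
  have h1 : (⟨charSeries zeta w, charSeries_zeta_mem hw⟩ : QSym) = monomialBasis (toComp w hw) := by
    rw [monomialBasis_apply]
    exact Subtype.ext (monomialQ_toComp w hw).symm
  rw [h1, adamsQ, Module.Basis.constr_basis, monomialBasis_apply, theta_monomialQ]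
  rfl

open scoped Classical in
/-- The scaling of all exponents by `k`. -/
noncomputable def scaleExpFun (k : ℕ) (f : Amb) : Amb := fun m =>
  if ∀ i, k ∣ m i then MvPowerSeries.coeff (m.mapRange (· / k) (Nat.zero_div k)) f else 0

open scoped Classical in
theorem coeff_scaleExpFun (k : ℕ) (f : Amb) (m : ℕ →₀ ℕ) :
    MvPowerSeries.coeff m (scaleExpFun k f) = if ∀ i, k ∣ m i then
      MvPowerSeries.coeff (m.mapRange (· / k) (Nat.zero_div k)) f else 0 := rfl

/-- The scaling of all exponents by `k`, as a linear map. -/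
noncomputable def scaleExp (k : ℕ) : Amb →ₗ[ℤ] Amb where
  toFun := scaleExpFun k
  map_add' f g := by
    ext m
    rw [map_add, coeff_scaleExpFun, coeff_scaleExpFun, coeff_scaleExpFun]
    split_ifs <;> simp
  map_smul' n f := by
    ext m
    rw [RingHom.id_apply, map_zsmul, coeff_scaleExpFun, coeff_scaleExpFun]
    split_ifs
    · exact map_zsmul _ _ _
    · exact (smul_zero n).symm

theorem scaleExp_charSeries {k : ℕ} (hk : Odd k) (w : List ℕ) :
    scaleExp k (charSeries nu w) = charSeries nu (w.map (k * ·)) := by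
  ext m
  change MvPowerSeries.coeff m (scaleExpFun k _) = charCoeff _ _ _
  rw [coeff_scaleExpFun]
  split_ifs with h
  · change charCoeff _ _ _ = _
    set m' := m.mapRange (· / k) (Nat.zero_div k) with hm'
    have h1 : ∀ i, m i = k * m' i := fun i => by
      simp [hm', Nat.mul_div_cancel' (h i)]
    have h2 : m'.support = m.support := by
      ext i
      simp [h1, hk.pos.ne']
    rw [h2, ← charCoeff_nu_scale hk, List.map_map]
    congr 1
    exact List.map_congr_left fun i _ => (h1 i).symm
  · rw [charCoeff_scale_eq_zero]
    push Not at h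
    obtain ⟨i, hi⟩ := h
    refine ⟨m i, List.mem_map.2 ⟨i, ?_, rfl⟩, hi⟩
    simp only [Finset.mem_sort, Finsupp.mem_support_iff]
    intro h0
    simp [h0] at hi

/-- The Adams operations are compatible with Stembridge's map: `ϑ ∘ Ψ^k` factors through `ϑ`. -/
theorem exists_theta_adamsQ (k : ℕ+) :
    ∃ g : Amb →ₗ[ℤ] Amb, ∀ f, theta (adamsQ k f) = g (theta f) := by
  suffices h : ∃ g : Amb →ₗ[ℤ] Amb, theta ∘ₗ adamsQ k = g ∘ₗ theta by
    obtain ⟨g, hg⟩ := h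
    exact ⟨g, fun f => LinearMap.congr_fun hg f⟩
  have h1 : ∀ (c : Comp) (g : Amb →ₗ[ℤ] Amb),
      g (charSeries nu c.2.blocks) = charSeries nu (c.2.blocks.map ((k : ℕ) * ·)) →
      (theta ∘ₗ adamsQ k) (monomialBasis c) = (g ∘ₗ theta) (monomialBasis c) := by
    intro c g h
    have h2 := adamsQ_charSeries k (w := c.2.blocks) fun a ha => c.2.blocks_pos ha
    rw [LinearMap.comp_apply, LinearMap.comp_apply, monomialBasis_apply, theta_monomialQ, h, ← h2]
    congr 3
    exact monomialQ_eq_charSeries c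
  -- for even `k` all `L_{kα}` with nonempty `α` vanish, and `g` takes the constant term
  rcases Nat.even_or_odd (k : ℕ) with hk | hk
  · refine ⟨((MvPowerSeries.C.comp
        MvPowerSeries.constantCoeff : Amb →+* Amb)).toAddMonoidHom.toIntLinearMap,
      monomialBasis.ext fun c => h1 c _ ?_⟩
    change MvPowerSeries.C (MvPowerSeries.coeff 0 (charSeries nu c.2.blocks)) = _
    rcases eq_or_ne c.2.blocks [] with h | h
    · simp [h, charSeries_nil]
    · rw [charSeries_nu_scale_even hk h]
      have : MvPowerSeries.coeff 0 (charSeries nu c.2.blocks) = 0 := by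
        rw [coeff_charSeries rfl (is := []) List.Pairwise.nil (by simp)
          fun a ha => c.2.blocks_pos ha]
        simp [charCoeff, h]
      rw [this, map_zero]
  · exact ⟨scaleExp k, monomialBasis.ext fun c => h1 c _ (scaleExp_charSeries hk _)⟩

/-- As `ϑ ∘ Ψ^k` factors through `ϑ`, the value of the extension by `0` that defines `Φ^k` is the
intended one on the image of `ϑ`. -/
theorem adamsP_theta (k : ℕ+) (f : QSym) : adamsP k (theta f) = theta (adamsQ k f) := by
  obtain ⟨g, hg⟩ := exists_theta_adamsQ k
  have h : Function.FactorsThrough (fun f => theta (adamsQ k f)) theta := by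
    intro a b hab
    simp only [hg, hab]
  exact h.extend_apply 0 f

/-- The operation `λ̃^n (L_w)`. -/
noncomputable def lambdaL (w : List ℕ) (n : ℕ) : Amb :=
  PowerSeries.coeff n ((PowerSeries.exp ℚ).subst
      (PowerSeries.X * PowerSeries.mk fun j : ℕ =>
        ((-1 : ℚ) ^ j / (j + 1)) • charSeries nu (w.map ((j + 1) * ·)) : PowerSeries Amb))

theorem isNewton_lambdaL (w : List ℕ) :
    IsNewton (fun j => charSeries nu (w.map ((j + 1) * ·))) (lambdaL w) :=
  isNewton_exp_subst _

theorem lambdaOp_monomialPeak (n : ℕ) (c : Comp) :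
    lambdaOp n (monomialPeak c) = lambdaL c.2.blocks n := by
  have h : ∀ k, adamsP k (monomialPeak c) = charSeries nu (c.2.blocks.map ((k : ℕ) * ·)) := by
    intro k
    rw [monomialPeak, adamsP_theta, ← adamsQ_charSeries k fun a ha => c.2.blocks_pos ha]
    congr 3
    exact monomialQ_eq_charSeries c
  simp only [lambdaOp, lambdaSeries, h, lambdaL]
  rfl

/-- Stembridge's map is a morphism of lambda rings. -/
theorem theta_lambdaM {w : List ℕ} (hw : ∀ a ∈ w, 0 < a) (n : ℕ) :
    theta ⟨lambdaM w n, lambdaM_mem hw n⟩ = lambdaL w n := by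
  have h : IsNewton (A := QSymRing)
      (fun j => ⟨charSeries zeta (w.map ((j + 1) * ·)),
        charSeries_zeta_mem (pos_scale hw (Nat.succ_pos j))⟩)
      (fun n => ⟨lambdaM w n, lambdaM_mem hw n⟩) := by
    refine ⟨Subtype.ext (isNewton_lambdaM w).1, fun n => Subtype.ext ?_⟩
    have := (isNewton_lambdaM w).2 n
    simpa using this
  have h2 := h.map thetaHom
  have h3 : IsNewton (fun j => charSeries nu (w.map ((j + 1) * ·)))
      (fun n => theta ⟨lambdaM w n, lambdaM_mem hw n⟩) := by
    convert! h2 using 2 with j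
    exact (theta_charSeries (pos_scale hw (Nat.succ_pos j))).symm
  exact congrFun (h3.unique (isNewton_lambdaL w)) n

/-- Integrality is inherited from `QSym`. -/
theorem lambdaL_mem {w : List ℕ} (hw : ∀ a ∈ w, 0 < a) (n : ℕ) : lambdaL w n ∈ PQSym := by
  rw [← theta_lambdaM hw]
  exact theta_mem_PQSym _

/-! ### The symmetric functions `q_n` -/

/-- The words obtained by inserting the letter `k` into `1^j`. -/
def insertOnes (k : ℕ) : ℕ → Multiset (List ℕ)
  | 0 => {[k]}
  | j + 1 => {k :: List.replicate (j + 1) 1} + (insertOnes k j).map (1 :: ·)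

/-- The words with a letter `k` inserted into `1^{j+1}`, and those with `k` added to one of the
letters. -/
theorem qsh_singleton_replicate (k j : ℕ) :
    qsh [k] (List.replicate (j + 1) 1) = insertOnes k (j + 1) + insertOnes (k + 1) j := by
  induction j with
  | zero =>
    rw [List.replicate_succ, qsh_cons_cons]
    simp [insertOnes]
  | succ j ih =>
    have h1 : insertOnes k (j + 1 + 1) =
        {k :: List.replicate (j + 1 + 1) 1} + (insertOnes k (j + 1)).map (1 :: ·) := rfl
    have h2 : insertOnes (k + 1) (j + 1) =
        {(k + 1) :: List.replicate (j + 1) 1} + (insertOnes (k + 1) j).map (1 :: ·) := rfl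
    rw [List.replicate_succ, qsh_cons_cons, ih, h1, h2]
    generalize insertOnes k (j + 1) = A
    simp only [qsh_nil_left, Multiset.map_singleton, Multiset.map_add, List.replicate_succ]
    abel

theorem insertOnes_one (j : ℕ) :
    insertOnes 1 j = Multiset.replicate (j + 1) (List.replicate (j + 1) 1) := by
  induction j with
  | zero => simp [insertOnes]
  | succ j ih =>
    rw [insertOnes, ih, Multiset.map_replicate, Multiset.replicate_succ _ (j + 1),
      ← List.replicate_succ, Multiset.singleton_add]

/-- In the case of `zeta`: the `M_{1^n}` are the elementary symmetric functions for the power sums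
`M_k`. In the alternating sum the words with an inserted letter `k ≥ 2` cancel in pairs. -/
theorem isNewton_replicate {χ : List ℕ → ℚ} (hχ : IsChar χ) :
    IsNewton (fun j => charSeries χ [j + 1]) fun n => charSeries χ (List.replicate n 1) := by
  refine ⟨charSeries_nil χ, fun n => ?_⟩
  have hmul : ∀ j i, charSeries χ [j + 1] * charSeries χ (List.replicate i 1) =
      ((qsh [j + 1] (List.replicate i 1)).map (charSeries χ)).sum := fun j i =>
    charSeries_mul hχ (by simp) (by simp)
  have key : ∀ i ≤ n, ∑ j ∈ Finset.range (i + 1),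
      (-1) ^ j * charSeries χ [j + 1] * charSeries χ (List.replicate (n - j) 1) =
      ((insertOnes 1 n).map (charSeries χ)).sum + if i = n then 0 else
        (-1) ^ i * ((insertOnes (i + 2) (n - i - 1)).map (charSeries χ)).sum := by
    intro i hi
    induction i with
    | zero =>
      rw [Finset.sum_range_one, pow_zero, one_mul, hmul, Nat.sub_zero]
      cases n with
      | zero => simp [insertOnes]
      | succ n =>
        rw [qsh_singleton_replicate]
        simp
    | succ i ih =>
      rw [Finset.sum_range_succ, ih (by omega), if_neg (by omega), mul_assoc, hmul]
      obtain ⟨d, rfl⟩ : ∃ d, n = i + 1 + d := ⟨n - (i + 1), by omega⟩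
      rw [show i + 1 + d - i - 1 = d by omega, show i + 1 + d - (i + 1) = d by omega]
      cases d with
      | zero =>
        simp [insertOnes]
        ring
      | succ d =>
        rw [qsh_singleton_replicate, if_neg (by omega)]
        simp only [Multiset.map_add, Multiset.sum_add, Nat.add_sub_cancel]
        ring
  rw [key n le_rfl, if_pos rfl, add_zero, insertOnes_one, Multiset.map_replicate,
    Multiset.sum_replicate, nsmul_eq_mul]

theorem nu_replicate_one (n : ℕ) : nu (List.replicate (n + 1) 1) = 2 := by
  induction n with
  | zero => norm_num [nu]
  | succ n ih => rw [List.replicate_succ, nu_cons (by simp), ih]; norm_num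

theorem charCoeff_replicate_one {δ : List ℕ} (hδ : ∀ a ∈ δ, 0 < a) :
    charCoeff nu δ (List.replicate δ.sum 1) = 2 ^ δ.length := by
  induction δ with
  | nil => simp [charCoeff]
  | cons d δ ih =>
    rw [List.forall_mem_cons] at hδ
    have h := charCoeff_cons_append (χ := nu) (List.replicate d 1) (List.replicate δ.sum 1) δ
      (by simp) (by simp)
    rw [List.sum_replicate, smul_eq_mul, mul_one, ← List.replicate_add] at h
    obtain ⟨d, rfl⟩ : ∃ e, d = e + 1 := ⟨d - 1, by omega⟩
    rw [List.sum_cons, h, ih hδ.2, nu_replicate_one, List.length_cons, pow_succ']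

theorem sum_sort_map {m : ℕ →₀ ℕ} : ((m.support.sort (· ≤ ·)).map m).sum = m.degree := by
  rw [show m.degree = ∑ i ∈ m.support, m i from rfl, ← Finset.sum_map_toList]
  exact ((Finset.sort_perm_toList _ _).map _).sum_eq

/-- A monomial of degree `n` arises from each choice of a set of variables taken from the
elementary symmetric factor. -/
theorem coeff_qSym (n : ℕ) (m : ℕ →₀ ℕ) :
    MvPowerSeries.coeff m (qSym n) = if m.degree = n then 2 ^ m.support.card else 0 := by
  have h1 : ∀ i a, MvPowerSeries.coeff a (completeSym i) = if a.degree = i then 1 else 0 :=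
    fun _ _ => rfl
  have h2 : ∀ i a, MvPowerSeries.coeff a (elemSym i) =
      if a.degree = i ∧ ∀ i ∈ a.support, a i = 1 then 1 else 0 := fun _ _ => rfl
  simp only [qSym, map_sum, MvPowerSeries.coeff_mul, h1, h2]
  rw [Finset.sum_comm]
  have h3 : ∀ p ∈ Finset.HasAntidiagonal.antidiagonal m, ∑ i ∈ Finset.range (n + 1),
      (if p.1.degree = i then (1 : ℚ) else 0) *
        (if p.2.degree = n - i ∧ ∀ i ∈ p.2.support, p.2 i = 1 then 1 else 0) =
      if m.degree = n then (if ∀ i ∈ p.2.support, p.2 i = 1 then 1 else 0) else 0 := by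
    intro p hp
    rw [Finset.HasAntidiagonal.mem_antidiagonal] at hp
    have hd : p.1.degree + p.2.degree = m.degree := by rw [← map_add, hp]
    by_cases hm : m.degree = n
    · rw [Finset.sum_eq_single p.1.degree]
      · have : p.2.degree = n - p.1.degree := by omega
        rw [if_pos rfl, one_mul, if_pos hm]
        simp only [this, true_and]
      · intro i _ hi
        simp [hi.symm]
      · intro h
        exact absurd (Finset.mem_range.2 (by omega)) h
    · rw [if_neg hm]
      refine Finset.sum_eq_zero fun i hi => ?_
      rw [Finset.mem_range] at hi
      by_cases h : p.1.degree = i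
      · rw [if_neg (c := _ ∧ _), mul_zero]
        omega
      · simp [h]
  rw [Finset.sum_congr rfl h3]
  split_ifs with hm
  · have h4 : (2 : ℚ) ^ m.support.card = (m.support.powerset.card : ℕ) := by
      rw [Finset.card_powerset]; norm_cast
    rw [h4, Finset.sum_boole, Nat.cast_inj]
    let one (S : Finset ℕ) : ℕ →₀ ℕ :=
      Finsupp.onFinset S (fun i => if i ∈ S then 1 else 0) (by intro a; simp)
    have hone : ∀ S i, one S i = if i ∈ S then 1 else 0 := fun _ _ => rfl
    have hsupp : ∀ S, (one S).support = S := by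
      intro S; ext i; simp [hone]
    refine Finset.card_nbij' (fun p => p.2.support) (fun S => (m - one S, one S)) ?_ ?_ ?_ ?_
    · intro p hp
      simp only [Finset.mem_coe, Finset.mem_filter,
        Finset.HasAntidiagonal.mem_antidiagonal] at hp
      simp only [Finset.mem_coe, Finset.mem_powerset]
      intro i hi
      rw [Finsupp.mem_support_iff] at hi ⊢
      rw [← hp.1, Finsupp.add_apply]
      omega
    · intro S hS
      simp only [Finset.mem_coe, Finset.mem_powerset] at hS
      simp only [Finset.mem_coe, Finset.mem_filter,
        Finset.HasAntidiagonal.mem_antidiagonal, hsupp]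
      refine ⟨?_, fun i hi => by simp [hone, hi]⟩
      ext i
      have : i ∈ S → m i ≠ 0 := fun h => by simpa using hS h
      simp only [Finsupp.add_apply, Finsupp.tsub_apply, hone]
      split_ifs with h
      · have := this h; omega
      · simp
    · intro p hp
      simp only [Finset.mem_coe, Finset.mem_filter,
        Finset.HasAntidiagonal.mem_antidiagonal] at hp
      have h4 : one p.2.support = p.2 := by
        ext i
        rw [hone]
        split_ifs with h
        · exact (hp.2 i h).symm
        · simpa [eq_comm] using h
      refine Prod.ext ?_ h4
      change m - one p.2.support = p.1
      rw [h4, ← hp.1, add_tsub_cancel_right]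
    · intro S _
      exact hsupp S
  · simp

theorem qSym_eq_charSeries (n : ℕ) : qSym n = charSeries nu (List.replicate n 1) := by
  ext m
  rw [coeff_qSym]
  change _ = charCoeff nu _ _
  split_ifs with h
  · rw [← h, ← sum_sort_map, charCoeff_replicate_one]
    · simp
    · intro a ha
      obtain ⟨i, hi, rfl⟩ := List.mem_map.1 ha
      have : i ∈ m.support := by simpa using hi
      simp at this
      omega
  · rw [charCoeff_eq_zero_of_sum_ne]
    rw [sum_sort_map]
    simpa using Ne.symm h

theorem lambdaL_one (n : ℕ) : lambdaL [1] n = qSym n := by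
  have h := isNewton_lambdaL [1]
  simp only [List.map_cons, List.map_nil, mul_one] at h
  rw [qSym_eq_charSeries]
  exact congrFun (h.unique (isNewton_replicate isChar_nu)) n

/-! ### Lyndon words -/

/-- The strong lexicographic order on words: at the first position where both words have a
letter and these differ, the letter of the first word is smaller. Words one of which is a prefix
of the other are incomparable. -/
def SLt : List ℕ → List ℕ → Prop
  | a :: u, b :: v => a < b ∨ a = b ∧ SLt u v
  | _, _ => False

@[simp] theorem not_SLt_nil_left (v : List ℕ) : ¬ SLt [] v := by simp [SLt]

@[simp] theorem not_SLt_nil_right (u : List ℕ) : ¬ SLt u [] := by cases u <;> simp [SLt]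

@[simp] theorem SLt_cons_cons (a b : ℕ) (u v : List ℕ) :
    SLt (a :: u) (b :: v) ↔ a < b ∨ a = b ∧ SLt u v := Iff.rfl

theorem SLt.append {u v : List ℕ} (h : SLt u v) (s t : List ℕ) : SLt (u ++ s) (v ++ t) := by
  induction u generalizing v with
  | nil => simp at h
  | cons a u ih =>
    cases v with
    | nil => simp at h
    | cons b v =>
      simp only [SLt_cons_cons, List.cons_append] at h ⊢
      exact h.imp_right fun h => ⟨h.1, ih h.2⟩

theorem SLt_append_left_iff (c u v : List ℕ) : SLt (c ++ u) (c ++ v) ↔ SLt u v := by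
  induction c with
  | nil => rfl
  | cons a c ih => simp [ih]

theorem SLt.trans {u v w : List ℕ} (h1 : SLt u v) (h2 : SLt v w) : SLt u w := by
  induction u generalizing v w with
  | nil => simp at h1
  | cons a u ih =>
    cases v with
    | nil => simp at h1
    | cons b v =>
      cases w with
      | nil => simp at h2
      | cons c w =>
        simp only [SLt_cons_cons] at h1 h2 ⊢
        rcases h1 with h1 | ⟨rfl, h1⟩ <;> rcases h2 with h2 | ⟨rfl, h2⟩
        · exact .inl (h1.trans h2)
        · exact .inl h1
        · exact .inl h2
        · exact .inr ⟨rfl, ih h1 h2⟩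

theorem not_SLt_append (u s : List ℕ) : ¬ SLt u (u ++ s) := by
  intro h
  have := (SLt_append_left_iff u [] s).1 (by simpa using h)
  simp at this

theorem not_append_SLt (u s : List ℕ) : ¬ SLt (u ++ s) u := by
  intro h
  have := (SLt_append_left_iff u s []).1 (by simpa using h)
  simp at this

theorem SLt_trichotomy (u v : List ℕ) : SLt u v ∨ SLt v u ∨ u <+: v ∨ v <+: u := by
  induction u generalizing v with
  | nil => simp
  | cons a u ih =>
    cases v with
    | nil => simp
    | cons b v =>
      simp only [SLt_cons_cons, List.cons_prefix_cons]
      rcases lt_trichotomy a b with h | rfl | h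
      · simp [h]
      · simpa using ih v
      · simp [h]

theorem lt_iff_SLt (u v : List ℕ) : u < v ↔ SLt u v ∨ u <+: v ∧ u ≠ v := by
  induction u generalizing v with
  | nil => cases v <;> simp
  | cons a u ih =>
    cases v with
    | nil => simp
    | cons b v =>
      rw [List.cons_lt_cons_iff, ih, SLt_cons_cons, List.cons_prefix_cons]
      constructor
      · rintro (h | ⟨rfl, h | h⟩)
        · exact .inl (.inl h)
        · exact .inl (.inr ⟨rfl, h⟩)
        · exact .inr ⟨⟨rfl, h.1⟩, by simpa using h.2⟩
      · rintro ((h | ⟨rfl, h⟩) | ⟨⟨rfl, h⟩, h'⟩)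
        · exact .inl h
        · exact .inr ⟨rfl, .inl h⟩
        · exact .inr ⟨rfl, .inr ⟨h, by simpa using h'⟩⟩

theorem SLt.lt {u v : List ℕ} (h : SLt u v) : u < v := (lt_iff_SLt u v).2 (.inl h)

theorem append_lt_append_left_iff (c u v : List ℕ) : c ++ u < c ++ v ↔ u < v := by
  rw [lt_iff_SLt, lt_iff_SLt, SLt_append_left_iff, List.prefix_append_right_inj]
  simp

theorem SLt_of_lt_of_length_le {u v : List ℕ} (h : u < v) (hl : v.length ≤ u.length) :
    SLt u v := by
  rcases (lt_iff_SLt u v).1 h with h | ⟨h1, h2⟩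
  · exact h
  · exact absurd (h1.eq_of_length_le hl) h2

/-- Nonempty Lyndon words. -/
def IsLyndonWord (w : List ℕ) : Prop := w ≠ [] ∧ IsLyndon w

/-- A Lyndon word is smaller than its proper tails in the strong sense, as a word is not a prefix of
a shorter one. -/
theorem IsLyndonWord.slt_right {s t : List ℕ} (h : IsLyndonWord (s ++ t)) (hs : s ≠ [])
    (ht : t ≠ []) : SLt (s ++ t) t := by
  refine SLt_of_lt_of_length_le (h.2 t (List.suffix_append s t) ht ?_) (by simp)
  intro h'
  have := congrArg List.length h'
  simp at this
  exact hs this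

theorem isLyndonWord_singleton (a : ℕ) : IsLyndonWord [a] := by
  refine ⟨by simp, fun t ht h1 h2 => ?_⟩
  rcases List.suffix_cons_iff.1 ht with h | h
  · exact absurd h h2
  · exact absurd (List.suffix_nil.1 h) h1

theorem IsLyndonWord.append {u v : List ℕ} (hu : IsLyndonWord u) (hv : IsLyndonWord v)
    (h : u < v) : IsLyndonWord (u ++ v) := by
  refine ⟨by simp [hu.1], fun t ht h1 h2 => ?_⟩
  obtain ⟨s, hs⟩ := ht
  have hs0 : s ≠ [] := by rintro rfl; exact h2 (by simpa using hs)
  rcases List.append_eq_append_iff.1 hs with ⟨c, rfl, rfl⟩ | ⟨c, rfl, rfl⟩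
  · by_cases hc : c = []
    · subst hc
      simp only [List.append_nil, List.nil_append] at *
      rcases (lt_iff_SLt s v).1 h with h | ⟨⟨r, rfl⟩, h⟩
      · simpa using (h.append v []).lt
      · rw [append_lt_append_left_iff]
        exact (hv.slt_right hs0 (by rintro rfl; simp at h)).lt
    · exact ((hu.slt_right hs0 hc).append v v).lt
  · have h3 : u ++ (c ++ t) < c ++ t := by
      rcases (lt_iff_SLt u (c ++ t)).1 h with h | ⟨⟨r, hr⟩, h⟩
      · simpa using (h.append (c ++ t) []).lt
      · conv_rhs => rw [← hr]
        rw [append_lt_append_left_iff, ← hr]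
        rw [← hr] at hv h
        exact (hv.slt_right hu.1 (by rintro rfl; simp at h)).lt
    by_cases hc : c = []
    · subst hc; simpa using h3
    · exact h3.trans (hv.slt_right hc h1).lt

/-- The standard factorization: the right factor is the smallest proper tail. -/
theorem IsLyndonWord.exists_factorization {u : List ℕ} (hu : IsLyndonWord u)
    (hl : 2 ≤ u.length) :
    ∃ v w, u = v ++ w ∧ IsLyndonWord v ∧ IsLyndonWord w := by
  let T : Finset (List ℕ) := u.tails.toFinset.filter fun t => t ≠ [] ∧ t ≠ u
  have hT : ∀ t, t ∈ T ↔ t <:+ u ∧ t ≠ [] ∧ t ≠ u := by simp [T]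
  have hne : T.Nonempty := by
    cases u with
    | nil => simp at hl
    | cons a u =>
      refine ⟨u, (hT u).2 ⟨List.suffix_cons a u, ?_, by simp⟩⟩
      rintro rfl
      simp at hl
  obtain ⟨w, hw, hmin⟩ := T.exists_min_image id hne
  obtain ⟨⟨v, rfl⟩, hw0, hwu⟩ := (hT w).1 hw
  have hv0 : v ≠ [] := by rintro rfl; simp at hwu
  refine ⟨v, w, rfl, ⟨hv0, fun t ht h1 h2 => ?_⟩, hw0, fun t ht h1 h2 => ?_⟩
  · obtain ⟨s, rfl⟩ := ht
    have hs0 : s ≠ [] := by rintro rfl; simp at h2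
    have hlt : SLt (s ++ t ++ w) (t ++ w) := by
      rw [List.append_assoc] at hu ⊢
      exact hu.slt_right hs0 (by simp [h1])
    rw [lt_iff_SLt]
    rcases SLt_trichotomy (s ++ t) t with h | h | h | h
    · exact .inl h
    · exact absurd (hlt.trans (h.append w w)) (fun h => by
        have := not_SLt_append (s ++ t ++ w) []
        simp only [List.append_nil] at this
        exact this h)
    · exact absurd h.length_le (by simp [hs0])
    · exfalso
      obtain ⟨r, hr⟩ := h
      rw [← hr, List.append_assoc, SLt_append_left_iff] at hlt
      have hr0 : r ≠ [] := by
        rintro rfl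
        have := congrArg List.length hr
        simp at this
        exact hs0 this
      have hmem : r ++ w ∈ T := by
        refine (hT _).2 ⟨⟨t, by rw [← List.append_assoc, hr]⟩, by simp [hr0], ?_⟩
        intro h
        have := congrArg List.length hr
        have h' := congrArg List.length h
        simp at this h'
        have := List.length_pos_iff.2 h1
        omega
      exact absurd hlt.lt (not_lt.2 (hmin _ hmem))
  · have hmem : t ∈ T := by
      refine (hT _).2 ⟨ht.trans (List.suffix_append v w), h1, ?_⟩
      rintro rfl
      have := ht.length_le
      simp at this
      exact hv0 this
    exact lt_of_le_of_ne (hmin t hmem) (Ne.symm h2)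

/-- Induction along the standard factorization. -/
theorem IsLyndonWord.induction {motive : List ℕ → Prop} (single : ∀ a, motive [a])
    (append : ∀ v w, IsLyndonWord v → IsLyndonWord w → IsLyndonWord (v ++ w) → motive v →
      motive w → motive (v ++ w)) {u : List ℕ} (hu : IsLyndonWord u) : motive u := by
  induction hn : u.length using Nat.strong_induction_on generalizing u with
  | _ n ih =>
    by_cases hl : 2 ≤ u.length
    · obtain ⟨v, w, rfl, hv, hw⟩ := hu.exists_factorization hl
      have h1 := List.length_pos_iff.2 hv.1
      have h2 := List.length_pos_iff.2 hw.1
      rw [List.length_append] at hn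
      exact append v w hv hw hu (ih _ (by omega) hv rfl) (ih _ (by omega) hw rfl)
    · have h1 := List.length_pos_iff.2 hu.1
      obtain ⟨a, rfl⟩ := List.length_eq_one_iff.1 (show u.length = 1 by omega)
      exact single a

/-! ### Factorization into a nonincreasing sequence of Lyndon words -/

/-- Nonincreasing sequences of nonempty Lyndon words. -/
def IsLyndonSeq (ls : List (List ℕ)) : Prop :=
  (∀ l ∈ ls, IsLyndonWord l) ∧ ls.Pairwise (· ≥ ·)

theorem isLyndonSeq_cons {l : List ℕ} {ls : List (List ℕ)} :
    IsLyndonSeq (l :: ls) ↔ IsLyndonWord l ∧ (∀ k ∈ ls, k ≤ l) ∧ IsLyndonSeq ls := by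
  simp only [IsLyndonSeq, List.forall_mem_cons, List.pairwise_cons]
  tauto

/-- A Lyndon word is put in front of a nonincreasing sequence by joining it with the first member
as long as that is larger. -/
theorem IsLyndonSeq.exists_flatten_append {ls : List (List ℕ)} (h : IsLyndonSeq ls)
    {u : List ℕ} (hu : IsLyndonWord u) :
    ∃ ks, IsLyndonSeq ks ∧ ks.flatten = u ++ ls.flatten := by
  induction ls generalizing u with
  | nil => exact ⟨[u], ⟨by simpa using hu, by simp⟩, by simp⟩
  | cons l ls ih =>
    have h' := isLyndonSeq_cons.1 h
    rcases le_or_gt l u with hle | hlt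
    · refine ⟨u :: l :: ls, isLyndonSeq_cons.2 ⟨hu, ?_, h⟩, by simp⟩
      intro k hk
      rcases List.mem_cons.1 hk with rfl | hk
      · exact hle
      · exact (h'.2.1 k hk).trans hle
    · obtain ⟨ks, h1, h2⟩ := ih h'.2.2 (hu.append h'.1 hlt)
      exact ⟨ks, h1, by rw [h2]; simp⟩

theorem exists_isLyndonSeq (w : List ℕ) : ∃ ls, IsLyndonSeq ls ∧ ls.flatten = w := by
  induction w with
  | nil => exact ⟨[], ⟨by simp, by simp⟩, rfl⟩
  | cons a w ih =>
    obtain ⟨ls, h1, rfl⟩ := ih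
    exact h1.exists_flatten_append (isLyndonWord_singleton a)

/-- A product of a nonincreasing sequence of Lyndon words `≤ u` does not exceed `u` in the strong
order. -/
theorem IsLyndonSeq.not_SLt_flatten {ls : List (List ℕ)} (h : IsLyndonSeq ls)
    {u : List ℕ} (hu : IsLyndonWord u) (hle : ∀ l ∈ ls, l ≤ u) : ¬ SLt u ls.flatten := by
  induction ls with
  | nil => simp
  | cons l ls ih =>
    intro hlt
    rw [isLyndonSeq_cons] at h
    have ih := ih h.2.2 fun k hk => hle k (List.mem_cons_of_mem _ hk)
    rw [List.flatten_cons] at hlt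
    rcases SLt_trichotomy u l with h1 | h1 | h1 | h1
    · exact absurd (hle l (by simp)) (not_le.2 h1.lt)
    · have := hlt.trans (by simpa using h1.append ls.flatten [])
      exact not_SLt_append u [] (by simpa using this)
    · obtain ⟨r, rfl⟩ := h1
      rw [List.append_assoc] at hlt
      exact not_SLt_append _ _ hlt
    · obtain ⟨r, rfl⟩ := h1
      rw [SLt_append_left_iff] at hlt
      have hr : r ≠ [] := by rintro rfl; simp at hlt
      exact ih ((hu.slt_right h.1.1 hr).trans hlt)

theorem IsLyndonSeq.not_prefix_flatten {ls : List (List ℕ)} (h : IsLyndonSeq ls)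
    {u : List ℕ} (hu : IsLyndonWord u) (hlt : ∀ l ∈ ls, l < u) : ¬ u <+: ls.flatten := by
  rintro ⟨y, hy⟩
  cases ls with
  | nil => simp [hu.1] at hy
  | cons l ls =>
    rw [isLyndonSeq_cons] at h
    rw [List.flatten_cons] at hy
    rcases (lt_iff_SLt l u).1 (hlt l (by simp)) with h1 | ⟨⟨r, rfl⟩, h1⟩
    · have := h1.append ls.flatten y
      rw [hy] at this
      exact not_SLt_append _ [] (by simpa using this)
    · rw [List.append_assoc, List.append_cancel_left_eq] at hy
      have hr : r ≠ [] := by rintro rfl; simp at h1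
      refine h.2.2.not_SLt_flatten hu (fun k hk => (hlt k (List.mem_cons_of_mem _ hk)).le) ?_
      rw [← hy]
      simpa using (hu.slt_right h.1.1 hr).append [] y

/-- If the first factor of one factorization were longer than that of the other, the excess `r`
would be a tail of `l` with `l < r` strongly, while `r` begins a product of words `≤ l`. -/
theorem IsLyndonSeq.head_length_le {l k : List ℕ} {ls ks : List (List ℕ)}
    (h1 : IsLyndonSeq (l :: ls)) (h2 : IsLyndonSeq (k :: ks))
    (h : l ++ ls.flatten = k ++ ks.flatten) : l.length ≤ k.length := by
  by_contra! hlt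
  rw [isLyndonSeq_cons] at h1 h2
  rcases List.append_eq_append_iff.1 h with ⟨r, rfl, -⟩ | ⟨r, rfl, hr⟩
  · simp at hlt
  · have hr0 : r ≠ [] := by rintro rfl; simp at hlt
    refine h2.2.2.not_SLt_flatten h1.1 (fun m hm => (h2.2.1 m hm).trans ?_) ?_
    · rcases (lt_iff_SLt k (k ++ r)) with h
      exact (h.2 (.inr ⟨List.prefix_append k r, by simpa using hr0⟩)).le
    · rw [hr]
      simpa using (h1.1.slt_right h2.1.1 hr0).append [] ls.flatten

/-- The factorization of a word into a nonincreasing sequence of Lyndon words is unique. -/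
theorem IsLyndonSeq.eq_of_flatten_eq {ls ks : List (List ℕ)} (h1 : IsLyndonSeq ls)
    (h2 : IsLyndonSeq ks) (h : ls.flatten = ks.flatten) : ls = ks := by
  induction ls generalizing ks with
  | nil =>
    cases ks with
    | nil => rfl
    | cons k ks => simp [(isLyndonSeq_cons.1 h2).1.1] at h
  | cons l ls ih =>
    cases ks with
    | nil => simp [(isLyndonSeq_cons.1 h1).1.1] at h
    | cons k ks =>
      rw [List.flatten_cons, List.flatten_cons] at h
      obtain ⟨rfl, h'⟩ := List.append_inj h
        ((h1.head_length_le h2 h).antisymm (h2.head_length_le h1 h.symm))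
      rw [ih (isLyndonSeq_cons.1 h1).2.2 (isLyndonSeq_cons.1 h2).2.2 h']

/-! ### Shuffles of Lyndon words -/

/-- The shuffles of two words, with multiplicities. -/
def shuffle : List ℕ → List ℕ → Multiset (List ℕ)
  | [], v => {v}
  | a :: u, [] => {a :: u}
  | a :: u, b :: v =>
    (shuffle u (b :: v)).map (a :: ·) + (shuffle (a :: u) v).map (b :: ·)
termination_by u v => u.length + v.length

@[simp] theorem shuffle_nil_left (v : List ℕ) : shuffle [] v = {v} := by rw [shuffle]

@[simp] theorem shuffle_nil_right (u : List ℕ) : shuffle u [] = {u} := by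
  cases u <;> rw [shuffle]

theorem shuffle_cons_cons (a b : ℕ) (u v : List ℕ) : shuffle (a :: u) (b :: v) =
    (shuffle u (b :: v)).map (a :: ·) + (shuffle (a :: u) v).map (b :: ·) := by
  rw [shuffle]

theorem length_of_mem_shuffle (u v : List ℕ) :
    ∀ w ∈ shuffle u v, w.length = u.length + v.length := by
  induction u, v using word_pair_induction with
  | h1 v => simp
  | h2 u => simp
  | h3 a u b v i1 i2 i3 =>
    intro w hw
    rw [shuffle_cons_cons, Multiset.mem_add, Multiset.mem_map, Multiset.mem_map] at hw
    rcases hw with ⟨x, hx, rfl⟩ | ⟨x, hx, rfl⟩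
    · rw [List.length_cons, i1 x hx]; simp only [List.length_cons]; omega
    · rw [List.length_cons, i2 x hx]; simp only [List.length_cons]; omega

theorem exists_mem_shuffle (u v : List ℕ) : ∃ w, w ∈ shuffle u v := by
  induction u, v using word_pair_induction with
  | h1 v => exact ⟨v, by simp⟩
  | h2 u => exact ⟨u, by simp⟩
  | h3 a u b v i1 i2 i3 =>
    obtain ⟨w, hw⟩ := i1
    exact ⟨a :: w, by rw [shuffle_cons_cons]; simp [hw]⟩

/-- The quasi-shuffles that are not shuffles are shorter. -/
theorem exists_qsh_eq (u v : List ℕ) : ∃ r, qsh u v = shuffle u v + r ∧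
    ∀ w ∈ r, w.length < u.length + v.length := by
  induction u, v using word_pair_induction with
  | h1 v => exact ⟨0, by simp⟩
  | h2 u => exact ⟨0, by simp⟩
  | h3 a u b v i1 i2 i3 =>
    obtain ⟨r1, h1, h1'⟩ := i1
    obtain ⟨r2, h2, h2'⟩ := i2
    obtain ⟨r3, h3, h3'⟩ := i3
    refine ⟨r1.map (a :: ·) + r2.map (b :: ·) + (qsh u v).map ((a + b) :: ·), ?_, ?_⟩
    · rw [qsh_cons_cons, h1, h2, shuffle_cons_cons]
      simp only [Multiset.map_add]
      abel
    · intro w hw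
      simp only [Multiset.mem_add, Multiset.mem_map] at hw
      rcases hw with (⟨x, hx, rfl⟩ | ⟨x, hx, rfl⟩) | ⟨x, hx, rfl⟩
      · have := h1' x hx; simp only [List.length_cons] at *; omega
      · have := h2' x hx; simp only [List.length_cons] at *; omega
      · rw [h3, Multiset.mem_add] at hx
        rcases hx with hx | hx
        · have := length_of_mem_shuffle u v x hx; simp only [List.length_cons]; omega
        · have := h3' x hx; simp only [List.length_cons]; omega

/-- The letters of `y₁` in a shuffle are replaced by those of `y₂`. -/
theorem exists_lt_mem_shuffle {y₁ y₂ : List ℕ} (p : List ℕ) (h : y₁ < y₂)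
    (hl : y₁.length = y₂.length) : ∀ z ∈ shuffle p y₁, ∃ z' ∈ shuffle p y₂, z < z' := by
  induction p, y₁ using word_pair_induction generalizing y₂ with
  | h1 v => simpa using h
  | h2 u =>
    rw [List.length_nil, eq_comm, List.length_eq_zero_iff] at hl
    simp [hl] at h
  | h3 a u b v i1 i2 i3 =>
    intro z hz
    cases y₂ with
    | nil => simp at hl
    | cons c y =>
      rw [shuffle_cons_cons, Multiset.mem_add, Multiset.mem_map, Multiset.mem_map] at hz
      simp only [shuffle_cons_cons a c, Multiset.mem_add, Multiset.mem_map]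
      rcases hz with ⟨x, hx, rfl⟩ | ⟨x, hx, rfl⟩
      · obtain ⟨x', hx', hlt⟩ := i1 h hl x hx
        exact ⟨a :: x', .inl ⟨x', hx', rfl⟩, List.cons_lt_cons_iff.2 (.inr ⟨rfl, hlt⟩)⟩
      · rcases List.cons_lt_cons_iff.1 h with hbc | ⟨rfl, hlt⟩
        · obtain ⟨x', hx'⟩ := exists_mem_shuffle (a :: u) y
          exact ⟨c :: x', .inr ⟨x', hx', rfl⟩, List.cons_lt_cons_iff.2 (.inl hbc)⟩
        · obtain ⟨x', hx', hlt'⟩ := i2 hlt (by simpa using hl) x hx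
          exact ⟨b :: x', .inr ⟨x', hx', rfl⟩, List.cons_lt_cons_iff.2 (.inr ⟨rfl, hlt'⟩)⟩

/-- The number of shuffles of `p` and `y` equal to `u ++ x` in which the prefix `u` comes
entirely from one of the two words. -/
def countPrefix (u x p y : List ℕ) : ℕ :=
  (if u <+: p then (shuffle (p.drop u.length) y).count x else 0) +
    if u <+: y then (shuffle p (y.drop u.length)).count x else 0

theorem count_map_cons (a b : ℕ) (x : List ℕ) (s : Multiset (List ℕ)) :
    (s.map (b :: ·)).count (a :: x) = if a = b then s.count x else 0 := by
  split_ifs with h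
  · subst h
    exact Multiset.count_map_eq_count' _ _ (List.cons_injective) _
  · rw [Multiset.count_eq_zero]
    simp only [Multiset.mem_map, List.cons.injEq, not_exists, not_and]
    exact fun _ _ h' => absurd h'.symm h

theorem mem_shuffle_of_countPrefix_pos {u x p y : List ℕ} (h : 0 < countPrefix u x p y) :
    (u <+: p ∧ x ∈ shuffle (p.drop u.length) y) ∨
      (u <+: y ∧ x ∈ shuffle p (y.drop u.length)) := by
  unfold countPrefix at h
  by_cases h1 : u <+: p <;> by_cases h2 : u <+: y
  · rw [if_pos h1, if_pos h2] at h
    rcases Nat.add_pos_iff_pos_or_pos.1 h with h | h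
    · exact .inl ⟨h1, Multiset.count_pos.1 h⟩
    · exact .inr ⟨h2, Multiset.count_pos.1 h⟩
  · rw [if_pos h1, if_neg h2, add_zero] at h
    exact .inl ⟨h1, Multiset.count_pos.1 h⟩
  · rw [if_neg h1, if_pos h2, zero_add] at h
    exact .inr ⟨h2, Multiset.count_pos.1 h⟩
  · simp [h1, h2] at h

/-- If neither `p` nor `y` exceeds the Lyndon word `u` in the strong order, then a shuffle of `p`
and `y` with prefix `u` takes this prefix from one of the two words, and no shuffle exceeds `u`.
This goes by induction along the standard factorization `u = vw`: a prefix `v` comes from one of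
the words, and so does the following `w`; it cannot come from the other word, because `u` precedes
`w`. -/
theorem IsLyndonWord.count_shuffle {u : List ℕ} (hu : IsLyndonWord u) :
    ∀ p y : List ℕ, ¬ SLt u p → ¬ SLt u y →
      (∀ x, (shuffle p y).count (u ++ x) = countPrefix u x p y) ∧
      ∀ z ∈ shuffle p y, ¬ SLt u z := by
  refine IsLyndonWord.induction (motive := fun u => ∀ p y : List ℕ, ¬ SLt u p → ¬ SLt u y →
      (∀ x, (shuffle p y).count (u ++ x) = countPrefix u x p y) ∧
      ∀ z ∈ shuffle p y, ¬ SLt u z) (fun a => ?_) (fun v w hv hw hu ihv ihw => ?_) hu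
  · intro p y hp hy
    rcases p with _ | ⟨b, p⟩
    · refine ⟨fun x => ?_, by simpa using hy⟩
      rcases y with _ | ⟨c, y⟩
      · simp [countPrefix]
      · by_cases h : a = c <;> simp [countPrefix, h, Multiset.count_singleton]
    rcases y with _ | ⟨c, y⟩
    · refine ⟨fun x => ?_, by simpa using hp⟩
      by_cases h : a = b <;> simp [countPrefix, h, Multiset.count_singleton]
    refine ⟨fun x => ?_, fun z hz => ?_⟩
    · rw [shuffle_cons_cons, List.singleton_append, Multiset.count_add, count_map_cons,
        count_map_cons]
      simp [countPrefix]
    · rw [shuffle_cons_cons, Multiset.mem_add, Multiset.mem_map, Multiset.mem_map] at hz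
      rcases hz with ⟨z, -, rfl⟩ | ⟨z, -, rfl⟩
      · simpa using hp
      · simpa using hy
  · intro p y hp hy
    have huw : SLt (v ++ w) w := hu.slt_right hv.1 hw.1
    have hpv : ∀ p, ¬ SLt (v ++ w) p → ¬ SLt v p := fun p hp h =>
      hp (by simpa using h.append w [])
    have hpw : ∀ p, ¬ SLt (v ++ w) p → ¬ SLt w p := fun p hp h => hp (huw.trans h)
    have hpw' : ∀ p, ¬ SLt (v ++ w) p → ¬ w <+: p := by
      rintro p hp ⟨t, rfl⟩
      exact hp (by simpa using huw.append [] t)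
    have hdrop : ∀ p, ¬ SLt (v ++ w) p → v <+: p → ¬ SLt w (p.drop v.length) := by
      rintro _ hp ⟨t, rfl⟩
      simpa [SLt_append_left_iff] using hp
    obtain ⟨hc, hm⟩ := ihv p y (hpv p hp) (hpv y hy)
    refine ⟨fun x => ?_, fun z hz hlt => ?_⟩
    · have key : ∀ p, v ++ w <+: p ↔ v <+: p ∧ w <+: p.drop v.length := by
        intro p
        constructor
        · rintro ⟨t, rfl⟩
          simp
        · rintro ⟨⟨t, rfl⟩, h⟩
          simpa using h
      rw [List.append_assoc, hc]
      unfold countPrefix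
      congr 1
      · by_cases h1 : v <+: p
        · rw [if_pos h1, (ihw _ _ (hdrop p hp h1) (hpw y hy)).1 x, countPrefix,
            if_neg (hpw' y hy), add_zero, List.drop_drop, ← List.length_append]
          exact if_congr ((key p).trans (by simp [h1])).symm rfl rfl
        · rw [if_neg h1, if_neg fun h => h1 ((key p).1 h).1]
      · by_cases h1 : v <+: y
        · rw [if_pos h1, (ihw _ _ (hpw p hp) (hdrop y hy h1)).1 x, countPrefix,
            if_neg (hpw' p hp), zero_add, List.drop_drop, ← List.length_append]
          exact if_congr ((key y).trans (by simp [h1])).symm rfl rfl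
        · rw [if_neg h1, if_neg fun h => h1 ((key y).1 h).1]
    · have hz' := hm z hz
      rcases SLt_trichotomy v z with h | h | h | h
      · exact hz' h
      · exact not_SLt_append _ [] (by simpa using hlt.trans (by simpa using h.append [] w))
      · obtain ⟨t, rfl⟩ := h
        rw [SLt_append_left_iff] at hlt
        have hpos := Multiset.count_pos.2 hz
        rw [hc] at hpos
        rcases mem_shuffle_of_countPrefix_pos hpos with ⟨h1, h2⟩ | ⟨h1, h2⟩
        · exact (ihw _ _ (hdrop p hp h1) (hpw y hy)).2 t h2 hlt
        · exact (ihw _ _ (hpw p hp) (hdrop y hy h1)).2 t h2 hlt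
      · obtain ⟨t, rfl⟩ := h
        rw [List.append_assoc] at hlt
        exact not_append_SLt _ _ hlt

/-- The largest shuffle of a Lyndon word `u` with a product of a nonincreasing sequence of Lyndon
words not exceeding `u` is the concatenation. -/
theorem IsLyndonSeq.le_of_mem_shuffle {ls : List (List ℕ)} {u : List ℕ}
    (h : IsLyndonSeq (u :: ls)) : ∀ z ∈ shuffle u ls.flatten, z ≤ u ++ ls.flatten := by
  induction ls with
  | nil => simp
  | cons l ls ih =>
    intro z hz
    have h' := isLyndonSeq_cons.1 h
    have hn : ¬ SLt u (l :: ls).flatten := h'.2.2.not_SLt_flatten h'.1 h'.2.1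
    have hc := h'.1.count_shuffle u _ (by simpa using not_SLt_append u []) hn
    rcases SLt_trichotomy u z with h1 | h1 | h1 | h1
    · exact absurd h1 (hc.2 z hz)
    · simpa using (h1.append [] (l :: ls).flatten).lt.le
    · obtain ⟨x, rfl⟩ := h1
      have hpos := Multiset.count_pos.2 hz
      rw [hc.1] at hpos
      have hx : x ≤ (l :: ls).flatten := by
        rcases mem_shuffle_of_countPrefix_pos hpos with ⟨-, hx⟩ | ⟨hp, hx⟩
        · simp at hx
          simp [hx]
        · have hlu : l = u := by
            by_contra hne
            refine h'.2.2.not_prefix_flatten h'.1 (fun k hk => ?_) hp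
            have hlt : l < u := lt_of_le_of_ne (h'.2.1 l (by simp)) hne
            rcases List.mem_cons.1 hk with rfl | hk
            · exact hlt
            · exact ((isLyndonSeq_cons.1 h'.2.2).2.1 k hk).trans_lt hlt
          subst hlu
          rw [List.flatten_cons, List.drop_left] at hx
          exact ih h'.2.2 x hx
      rcases hx.lt_or_eq with hx | rfl
      · exact ((append_lt_append_left_iff u _ _).2 hx).le
      · exact le_rfl
    · have := length_of_mem_shuffle _ _ z hz
      have h2 := h1.length_le
      have h3 : 0 < l.length := List.length_pos_iff.2 (isLyndonSeq_cons.1 h'.2.2).1.1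
      simp only [List.flatten_cons, List.length_append] at this
      omega

theorem IsLyndonSeq.count_shuffle {ls : List (List ℕ)} {u : List ℕ}
    (h : IsLyndonSeq (u :: ls)) :
    (shuffle u ls.flatten).count (u ++ ls.flatten) = ls.count u + 1 := by
  induction ls with
  | nil => simp
  | cons l ls ih =>
    have h' := isLyndonSeq_cons.1 h
    have hn : ¬ SLt u (l :: ls).flatten := h'.2.2.not_SLt_flatten h'.1 h'.2.1
    rw [(h'.1.count_shuffle u _ (by simpa using not_SLt_append u []) hn).1, countPrefix,
      if_pos (List.prefix_refl u), List.drop_length, shuffle_nil_left,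
      Multiset.count_singleton_self]
    by_cases hlu : l = u
    · subst hlu
      rw [List.flatten_cons, if_pos (List.prefix_append _ _), List.drop_left, ih h'.2.2]
      simp
      omega
    · have hlt : ∀ k ∈ l :: ls, k < u := by
        have hlt : l < u := lt_of_le_of_ne (h'.2.1 l (by simp)) hlu
        intro k hk
        rcases List.mem_cons.1 hk with rfl | hk
        · exact hlt
        · exact ((isLyndonSeq_cons.1 h'.2.2).2.1 k hk).trans_lt hlt
      rw [if_neg (h'.2.2.not_prefix_flatten h'.1 hlt),
        List.count_eq_zero.2 fun hm => lt_irrefl u (hlt u hm)]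

/-! ### Leading terms of products of the `λ̃^n(L_u)` -/

theorem charSeries_mul_mem {p q r : List ℕ → Prop} {f g : Amb} (hf : f ∈ peakSpan p)
    (hg : g ∈ peakSpan q)
    (h : ∀ u v, IsOddWord u → IsOddWord v → p u → q v →
      charSeries nu u * charSeries nu v ∈ peakSpan r) : f * g ∈ peakSpan r := by
  induction hf using Submodule.span_induction with
  | mem f hf =>
    obtain ⟨u, ⟨hu, hpu⟩, rfl⟩ := hf
    induction hg using Submodule.span_induction with
    | mem g hg =>
      obtain ⟨v, ⟨hv, hqv⟩, rfl⟩ := hg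
      exact h u v hu hv hpu hqv
    | zero => simp
    | add x y _ _ hx hy => rw [mul_add]; exact Submodule.add_mem _ hx hy
    | smul n x _ hx => rw [mul_smul_comm]; exact Submodule.smul_mem _ _ hx
  | zero => simp
  | add x y _ _ hx hy => rw [add_mul]; exact Submodule.add_mem _ hx hy
  | smul n x _ hx => rw [smul_mul_assoc]; exact Submodule.smul_mem _ _ hx

theorem length_of_mem_qsh {u v w : List ℕ} (h : w ∈ qsh u v) :
    w.length ≤ u.length + v.length := by
  obtain ⟨r, hr, hlt⟩ := exists_qsh_eq u v
  rw [hr, Multiset.mem_add] at h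
  rcases h with h | h
  · exact (length_of_mem_shuffle u v w h).le
  · exact (hlt w h).le

theorem sum_charSeries_mem {p : List ℕ → Prop} {s : Multiset (List ℕ)}
    (h : ∀ w ∈ s, charSeries nu w ∈ peakSpan p) : (s.map (charSeries nu)).sum ∈ peakSpan p := by
  refine multiset_sum_mem (S := peakSpan p) _ fun x hx => ?_
  obtain ⟨w, hw, rfl⟩ := Multiset.mem_map.1 hx
  exact h w hw

/-- The span of the `L_w` with `w` an odd word of sum `s` and length at most `l`. -/
abbrev boundedSpan (s l : ℕ) : Submodule ℤ Amb := peakSpan fun w => w.sum = s ∧ w.length ≤ l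

theorem mul_mem_boundedSpan {s l s' l' : ℕ} {f g : Amb} (hf : f ∈ boundedSpan s l)
    (hg : g ∈ boundedSpan s' l') : f * g ∈ boundedSpan (s + s') (l + l') := by
  refine charSeries_mul_mem hf hg fun u v hu hv ⟨h1, h2⟩ ⟨h3, h4⟩ => ?_
  rw [charSeries_mul isChar_nu hu.pos hv.pos]
  refine sum_charSeries_mem fun w hw => peakSpan_mono ?_ (charSeries_nu_mem w)
  rintro x ⟨hx1, hx2⟩
  have := length_of_mem_qsh hw
  rw [sum_of_mem_qsh u v w hw] at hx1
  exact ⟨by omega, by omega⟩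

theorem one_mem_boundedSpan : (1 : Amb) ∈ boundedSpan 0 0 := by
  rw [← charSeries_nil nu]
  exact charSeries_mem_peakSpan (by simp [IsOddWord]) (by simp)

theorem lambdaL_zero (w : List ℕ) : lambdaL w 0 = 1 := (isNewton_lambdaL w).1

theorem lambdaL_mem_boundedSpan {u : List ℕ} (hu : ∀ a ∈ u, 0 < a) (n : ℕ) :
    lambdaL u n ∈ boundedSpan (n * u.sum) (n * u.length) := by
  induction n using Nat.strong_induction_on with
  | _ n ih =>
    cases n with
    | zero => rw [lambdaL_zero, zero_mul, zero_mul]; exact one_mem_boundedSpan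
    | succ n =>
      refine mem_peakSpan_of_smul_mem (lambdaL_mem hu _) (n := ((n + 1 : ℕ) : ℤ)) (by positivity) ?_
      rw [zsmul_eq_mul, Int.cast_natCast, (isNewton_lambdaL u).2 n]
      refine Submodule.sum_mem _ fun j hj => ?_
      rw [Finset.mem_range] at hj
      have h1 := charSeries_nu_mem (u.map ((j + 1) * ·))
      rw [sum_scale, List.length_map] at h1
      have h2 := mul_mem_boundedSpan h1 (ih (n - j) (by omega))
      obtain ⟨d, rfl⟩ : ∃ d, n = j + d := ⟨n - j, by omega⟩
      rw [show j + d - j = d by omega] at h2 ⊢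
      have h3 : charSeries nu (u.map ((j + 1) * ·)) * lambdaL u d ∈
          boundedSpan ((j + d + 1) * u.sum) ((j + d + 1) * u.length) := by
        refine peakSpan_mono (fun w hw => ⟨?_, ?_⟩) h2
        · rw [hw.1]; ring
        · refine hw.2.trans ?_
          nlinarith [Nat.zero_le (j * u.length)]
      rw [mul_assoc]
      rcases neg_one_pow_eq_or Amb j with h | h <;> rw [h]
      · rwa [one_mul]
      · rw [neg_one_mul]; exact Submodule.neg_mem _ h3

/-- Sums and lengths are additive under products. -/
theorem prod_lambdaL_mem_boundedSpan (S : Finset (List ℕ)) (hS : ∀ u ∈ S, ∀ a ∈ u, 0 < a)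
    (c : List ℕ → ℕ) : ∏ u ∈ S, lambdaL u (c u) ∈
      boundedSpan (∑ u ∈ S, c u * u.sum) (∑ u ∈ S, c u * u.length) := by
  classical
  induction S using Finset.induction_on with
  | empty => simpa using one_mem_boundedSpan
  | insert u S hu ih =>
    rw [Finset.prod_insert hu, Finset.sum_insert hu, Finset.sum_insert hu]
    exact mul_mem_boundedSpan (lambdaL_mem_boundedSpan (hS u (by simp)) _)
      (ih fun v hv => hS v (by simp [hv]))

/-- `x` precedes `w`: both have the same sum, and `x` is shorter, or of equal length and
lexicographically smaller. -/
def Precedes (w x : List ℕ) : Prop :=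
  x.sum = w.sum ∧ (x.length < w.length ∨ x.length = w.length ∧ x < w)

theorem mem_or_mem_of_mem_shuffle (u v : List ℕ) :
    ∀ w ∈ shuffle u v, ∀ a ∈ w, a ∈ u ∨ a ∈ v := by
  induction u, v using word_pair_induction with
  | h1 v => simp
  | h2 u => simp
  | h3 a u b v i1 i2 i3 =>
    intro w hw
    rw [shuffle_cons_cons, Multiset.mem_add, Multiset.mem_map, Multiset.mem_map] at hw
    rcases hw with ⟨x, hx, rfl⟩ | ⟨x, hx, rfl⟩
    · have := i1 x hx
      intro c hc
      rcases List.mem_cons.1 hc with rfl | hc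
      · simp
      · rcases this c hc with h | h
        · simp [h]
        · exact .inr h
    · have := i2 x hx
      intro c hc
      rcases List.mem_cons.1 hc with rfl | hc
      · simp
      · rcases this c hc with h | h
        · exact .inl h
        · simp [h]

theorem IsOddWord.of_mem_shuffle {u v w : List ℕ} (hu : IsOddWord u) (hv : IsOddWord v)
    (h : w ∈ shuffle u v) : IsOddWord w := fun a ha =>
  (mem_or_mem_of_mem_shuffle u v w h a ha).elim (hu a) (hv a)

theorem sum_of_mem_shuffle {u v w : List ℕ} (h : w ∈ shuffle u v) :
    w.sum = u.sum + v.sum := by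
  obtain ⟨r, hr, -⟩ := exists_qsh_eq u v
  exact sum_of_mem_qsh u v w (by rw [hr]; exact Multiset.mem_add.2 (.inl h))

/-- A word that is shorter than `w` may have even letters: merging them does not lengthen it. -/
theorem charSeries_mem_precedes {w x : List ℕ} (h1 : x.sum = w.sum) (h2 : x.length < w.length) :
    charSeries nu x ∈ peakSpan (Precedes w) :=
  peakSpan_mono (fun y hy => ⟨by omega, .inl (by omega)⟩) (charSeries_nu_mem x)

/-- The leading term of a product, for a word `w` not exceeded by any shuffle. -/
theorem charSeries_mul_sub_mem {u v w : List ℕ} (hu : IsOddWord u) (hv : IsOddWord v)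
    (hs : w.sum = u.sum + v.sum) (hl : w.length = u.length + v.length)
    (hle : ∀ z ∈ shuffle u v, z ≤ w) :
    charSeries nu u * charSeries nu v - (shuffle u v).count w • charSeries nu w ∈
      peakSpan (Precedes w) := by
  classical
  obtain ⟨r, hr, hlt⟩ := exists_qsh_eq u v
  rw [charSeries_mul isChar_nu hu.pos hv.pos, hr, Multiset.map_add, Multiset.sum_add]
  have h1 : shuffle u v = Multiset.replicate ((shuffle u v).count w) w +
      (shuffle u v).filter (· ≠ w) := by
    conv_lhs => rw [← Multiset.filter_add_not (· = w) (shuffle u v)]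
    rw [Multiset.filter_eq']
  have h2 : ((shuffle u v).map (charSeries nu)).sum - (shuffle u v).count w • charSeries nu w =
      (((shuffle u v).filter (· ≠ w)).map (charSeries nu)).sum := by
    conv_lhs => enter [1]; rw [h1]
    rw [Multiset.map_add, Multiset.sum_add, Multiset.map_replicate, Multiset.sum_replicate]
    simp
  rw [add_sub_right_comm, h2]
  refine Submodule.add_mem _ (sum_charSeries_mem fun x hx => ?_) (sum_charSeries_mem fun x hx => ?_)
  · rw [Multiset.mem_filter] at hx
    refine charSeries_mem_peakSpan (hu.of_mem_shuffle hv hx.1)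
      ⟨by rw [sum_of_mem_shuffle hx.1, hs], .inr ⟨?_, lt_of_le_of_ne (hle x hx.1) hx.2⟩⟩
    rw [length_of_mem_shuffle u v x hx.1, hl]
  · refine charSeries_mem_precedes ?_ (by rw [hl]; exact hlt x hx)
    rw [hs]
    exact sum_of_mem_qsh u v x (by rw [hr]; exact Multiset.mem_add.2 (.inr hx))

/-- Multiplication by `L_u` preserves the order of the remaining terms. -/
theorem charSeries_mul_mem_precedes {u y : List ℕ} (hu : IsOddWord u)
    (hle : ∀ z ∈ shuffle u y, z ≤ u ++ y) {f : Amb} (hf : f ∈ peakSpan (Precedes y)) :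
    charSeries nu u * f ∈ peakSpan (Precedes (u ++ y)) := by
  refine charSeries_mul_mem (charSeries_mem_peakSpan (p := (· = u)) hu rfl) hf ?_
  rintro _ x - hx rfl ⟨hs, hp⟩
  rw [charSeries_mul isChar_nu hu.pos hx.pos]
  rename_i w
  obtain ⟨r, hr, hlt⟩ := exists_qsh_eq w x
  refine sum_charSeries_mem fun z hz => ?_
  have hzs := sum_of_mem_qsh w x z hz
  rcases hp with hp | ⟨hp, hxy⟩
  · have := length_of_mem_qsh hz
    exact charSeries_mem_precedes (by rw [hzs, List.sum_append, hs])
      (by rw [List.length_append]; omega)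
  · rw [hr, Multiset.mem_add] at hz
    rcases hz with hz | hz
    · obtain ⟨z', hz', hlt'⟩ := exists_lt_mem_shuffle w hxy hp z hz
      refine charSeries_mem_peakSpan (hu.of_mem_shuffle hx hz) ⟨?_, .inr ⟨?_, ?_⟩⟩
      · rw [hzs, List.sum_append, hs]
      · rw [length_of_mem_shuffle _ _ z hz, List.length_append, hp]
      · exact hlt'.trans_le (hle z' hz')
    · have := hlt z hz
      exact charSeries_mem_precedes (by rw [hzs, List.sum_append, hs])
        (by rw [List.length_append]; omega)

/-- The product of the `λ̃^n(L_u)`, where `n` is the multiplicity of `u` in a list. -/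
noncomputable def lyndonProd (ls : List (List ℕ)) : Amb :=
  ∏ u ∈ ls.toFinset, lambdaL u (ls.count u)

theorem lyndonProd_eq {ls : List (List ℕ)} {S : Finset (List ℕ)} (h : ls.toFinset ⊆ S) :
    lyndonProd ls = ∏ u ∈ S, lambdaL u (ls.count u) := by
  refine Finset.prod_subset h fun u _ hu => ?_
  rw [List.count_eq_zero.2 (by simpa using hu), lambdaL_zero]

theorem lyndonProd_mem {ls : List (List ℕ)} (h : ∀ u ∈ ls, IsOddWord u) :
    lyndonProd ls ∈ PQSym :=
  Subring.prod_mem _ fun u hu => lambdaL_mem (h u (by simpa using hu)).pos _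

/-- The leading term of the product belonging to a nonincreasing sequence of Lyndon words is `L_w`,
where `w` is the concatenation of the sequence. In passing from the multiplicity `k` of a maximal
word `u` to `k + 1`, multiplication by `L_u` produces the factor `k + 1`, which cancels against the
factor `k + 1` in Newton's identity. -/
theorem IsLyndonSeq.lyndonProd_sub_mem {ls : List (List ℕ)} (h : IsLyndonSeq ls)
    (hodd : ∀ u ∈ ls, IsOddWord u) :
    lyndonProd ls - charSeries nu ls.flatten ∈ peakSpan (Precedes ls.flatten) := by
  induction ls with
  | nil => simp [lyndonProd, charSeries_nil]
  | cons u ls ih =>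
    have h' := isLyndonSeq_cons.1 h
    have hu : IsOddWord u := hodd u (by simp)
    have hodd' : ∀ v ∈ ls, IsOddWord v := fun v hv => hodd v (by simp [hv])
    have ih := ih h'.2.2 hodd'
    have hle := h.le_of_mem_shuffle
    have hy : IsOddWord ls.flatten := by
      intro a ha
      obtain ⟨v, hv, hav⟩ := List.mem_flatten.1 ha
      exact hodd' v hv a hav
    set k := ls.count u with hk
    set y := ls.flatten with hy'
    set S := ls.toFinset.erase u
    set Q := ∏ v ∈ S, lambdaL v (ls.count v) with hQ
    have hins : insert u ls.toFinset = insert u S := by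
      ext v
      simp only [S, Finset.mem_insert, Finset.mem_erase]
      tauto
    have huS : u ∉ S := by simp [S]
    have h1 : lyndonProd ls = lambdaL u k * Q := by
      rw [lyndonProd_eq (Finset.subset_insert u _), hins, Finset.prod_insert huS]
    have h2 : lyndonProd (u :: ls) = lambdaL u (k + 1) * Q := by
      rw [lyndonProd, List.toFinset_cons, hins, Finset.prod_insert huS, List.count_cons_self]
      congr 1
      refine Finset.prod_congr rfl fun v hv => ?_
      rw [List.count_cons_of_ne]
      rintro rfl
      exact huS hv
    have hQmem : Q ∈ boundedSpan (∑ v ∈ S, ls.count v * v.sum) (∑ v ∈ S, ls.count v * v.length) :=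
      prod_lambdaL_mem_boundedSpan S
        (fun v hv => (hodd' v (List.mem_toFinset.1 (Finset.mem_of_mem_erase hv))).pos) _
    have hcount : ∀ g : List ℕ → ℕ, (ls.map g).sum =
        k * g u + ∑ v ∈ S, ls.count v * g v := by
      intro g
      have hg : (ls.map g).sum = ∑ v ∈ ls.toFinset, ls.count v * g v := by
        rw [Finset.sum_list_map_count]
        refine Finset.sum_congr rfl fun v _ => congrArg (· * g v) ?_
        congr 1
        exact lawful_beq_subsingleton _ _
      rw [hg]
      by_cases hmem : u ∈ ls.toFinset
      · rw [← Finset.add_sum_erase _ _ hmem]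
      · have : k = 0 := List.count_eq_zero.2 (by simpa using hmem)
        rw [this, zero_mul, zero_add]
        simp only [S]
        rw [Finset.erase_eq_of_notMem hmem]
    have hsum : y.sum = k * u.sum + ∑ v ∈ S, ls.count v * v.sum := by
      rw [← hcount List.sum, hy', List.sum_flatten]
    have hlen : y.length = k * u.length + ∑ v ∈ S, ls.count v * v.length := by
      rw [← hcount List.length, hy', List.length_flatten]
    rw [List.flatten_cons, h2]
    refine mem_peakSpan_of_smul_mem (n := ((k + 1 : ℕ) : ℤ)) ?_ (by positivity) ?_
    · refine Subring.sub_mem _ ?_ ?_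
      · rw [← h2]; exact lyndonProd_mem hodd
      · refine (mem_PQSym_iff _).2 (charSeries_mem_peakSpan ?_ trivial)
        intro a ha
        exact (List.mem_append.1 ha).elim (hu a) (hy a)
    -- the terms with `j ≥ 1` in Newton's identity are shorter, since `(j + 1)u` is as short as `u`
    have hN := (isNewton_lambdaL u).2 k
    rw [Finset.sum_range_succ'] at hN
    have key : ((k + 1 : ℕ) : ℤ) • (lambdaL u (k + 1) * Q - charSeries nu (u ++ y)) =
        (∑ j ∈ Finset.range k, (-1) ^ (j + 1) * (charSeries nu (u.map ((j + 1 + 1) * ·)) *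
          lambdaL u (k - (j + 1)) * Q)) +
        charSeries nu u * (lyndonProd ls - charSeries nu y) +
        (charSeries nu u * charSeries nu y - (k + 1) • charSeries nu (u ++ y)) := by
      rw [zsmul_eq_mul, Int.cast_natCast, mul_sub, ← mul_assoc, hN, h1, add_mul, Finset.sum_mul,
        nsmul_eq_mul]
      simp only [pow_zero, one_mul, zero_add, Nat.sub_zero, List.map_id', ← mul_assoc]
      ring
    rw [key]
    refine Submodule.add_mem _ (Submodule.add_mem _ (Submodule.sum_mem _ fun j hj => ?_)
      (charSeries_mul_mem_precedes hu hle ih)) ?_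
    · rw [Finset.mem_range] at hj
      have h3 := charSeries_nu_mem (u.map ((j + 1 + 1) * ·))
      rw [sum_scale, List.length_map] at h3
      have h4 := mul_mem_boundedSpan (mul_mem_boundedSpan h3
        (lambdaL_mem_boundedSpan hu.pos (k - (j + 1)))) hQmem
      obtain ⟨d, hd⟩ : ∃ d, k = j + 1 + d := ⟨k - (j + 1), by omega⟩
      have hd' : k - (j + 1) = d := by omega
      rw [hd'] at h4 ⊢
      have h5 : charSeries nu (u.map ((j + 1 + 1) * ·)) * lambdaL u d * Q ∈
          peakSpan (Precedes (u ++ y)) := by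
        refine peakSpan_mono (fun w hw => ⟨?_, .inl (hw.2.trans_lt ?_)⟩) h4
        · rw [hw.1, List.sum_append, hsum, hd]; ring
        · rw [List.length_append, hlen, hd]
          have := List.length_pos_iff.2 h'.1.1
          nlinarith [Nat.zero_le (j * u.length)]
      rcases neg_one_pow_eq_or Amb (j + 1) with h | h <;> rw [h]
      · rwa [one_mul]
      · rw [neg_one_mul]; exact Submodule.neg_mem _ h5
    · rw [hk, ← h.count_shuffle]
      exact charSeries_mul_sub_mem hu hy List.sum_append List.length_append hle

theorem finite_words (n : ℕ) : {w : List ℕ | (∀ a ∈ w, 0 < a) ∧ w.sum = n}.Finite := by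
  refine (Set.finite_range fun c : Composition n => c.blocks).subset ?_
  rintro w ⟨h1, h2⟩
  exact ⟨⟨w, fun {i} hi => h1 i hi, h2⟩, rfl⟩

/-- `PQSym` is generated by the `λ̃^n(L_u)`, `u` a Lyndon word in odd letters. -/
theorem charSeries_mem_of_lambdaL_mem {S : Subring Amb}
    (hS : ∀ u, IsLyndonWord u → IsOddWord u → ∀ n, lambdaL u n ∈ S) {w : List ℕ}
    (hw : IsOddWord w) : charSeries nu w ∈ S := by
  have hwf : ∀ n : ℕ, WellFounded fun x y : {w : List ℕ // (∀ a ∈ w, 0 < a) ∧ w.sum = n} =>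
      Precedes y.1 x.1 := by
    intro n
    have : Finite {w : List ℕ // (∀ a ∈ w, 0 < a) ∧ w.sum = n} := (finite_words n).to_subtype
    have : IsTrans {w : List ℕ // (∀ a ∈ w, 0 < a) ∧ w.sum = n} fun x y => Precedes y.1 x.1 :=
      ⟨fun x y z ⟨h1, h2⟩ ⟨h3, h4⟩ => ⟨h1.trans h3, by
        rcases h2 with h2 | ⟨h2, h2'⟩ <;> rcases h4 with h4 | ⟨h4, h4'⟩
        · exact .inl (by omega)
        · exact .inl (by omega)
        · exact .inl (by omega)
        · exact .inr ⟨by omega, h2'.trans h4'⟩⟩⟩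
    have : Std.Irrefl fun x y : {w : List ℕ // (∀ a ∈ w, 0 < a) ∧ w.sum = n} =>
        Precedes y.1 x.1 := ⟨fun x ⟨_, h⟩ => by
          rcases h with h | ⟨_, h⟩ <;> exact lt_irrefl _ h⟩
    exact Finite.wellFounded_of_trans_of_irrefl _
  suffices h : ∀ n, ∀ w : {w : List ℕ // (∀ a ∈ w, 0 < a) ∧ w.sum = n}, IsOddWord w.1 →
      charSeries nu w.1 ∈ S from h w.sum ⟨w, hw.pos, rfl⟩ hw
  intro n w
  induction w using (hwf n).induction with
  | _ w ih =>
    intro hw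
    obtain ⟨w, hpos, rfl⟩ := w
    obtain ⟨ls, hls, rfl⟩ := exists_isLyndonSeq w
    have hodd : ∀ u ∈ ls, IsOddWord u := fun u hu a ha => hw a (List.mem_flatten.2 ⟨u, hu, ha⟩)
    have h1 := hls.lyndonProd_sub_mem hodd
    have h2 : peakSpan (Precedes ls.flatten) ≤ S.toAddSubgroup.toIntSubmodule := by
      refine Submodule.span_le.2 ?_
      rintro _ ⟨x, ⟨hx, hxw⟩, rfl⟩
      exact ih ⟨x, hx.pos, hxw.1⟩ hxw hx
    have h3 : lyndonProd ls ∈ S := Subring.prod_mem _ fun u hu =>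
      hS u (hls.1 u (by simpa using hu)) (hodd u (by simpa using hu)) _
    have h4 := S.sub_mem h3 (h2 h1)
    rwa [sub_sub_cancel] at h4

/-! ### Reduction to elementary words -/

theorem IsNewton.of_map {A B : Type*} [CommRing A] [CommRing B] {f : A →+* B}
    (hf : Function.Injective f) {p e : ℕ → A}
    (h : IsNewton (fun j => f (p j)) fun n => f (e n)) : IsNewton p e :=
  ⟨hf (by simpa using h.1), fun n => hf (by simpa using h.2 n)⟩

/-- The `λ̃^n` of `L_{dα}` are polynomials in those of `L_α`, since the elementary symmetric
functions of the `d`-th powers of variables are polynomials in the elementary symmetric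
functions. -/
theorem lambdaL_scale_mem {d : ℕ} (hd : 0 < d) (w : List ℕ) (n : ℕ) :
    lambdaL (w.map (d * ·)) n ∈ Subring.closure (Set.range (lambdaL w)) := by
  let N := n * d
  let A := MvPolynomial.symmetricSubalgebra (Fin N) ℤ
  let E := MvPolynomial.esymmAlgEquiv (Fin N) ℤ (Fintype.card_fin N)
  let φ : A →+* Amb := (MvPolynomial.aeval fun i : Fin N => lambdaL w (i + 1)).toRingHom.comp
    (E.symm : A →+* MvPolynomial (Fin N) ℤ)
  have hφ : ∀ a, φ a ∈ Subring.closure (Set.range (lambdaL w)) := by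
    intro a
    have : ∀ f : MvPolynomial (Fin N) ℤ, MvPolynomial.aeval (fun i : Fin N => lambdaL w (i + 1)) f ∈
        Subring.closure (Set.range (lambdaL w)) := by
      intro f
      induction f using MvPolynomial.induction_on with
      | C a => simp
      | add p q hp hq => rw [map_add]; exact Subring.add_mem _ hp hq
      | mul_X p i hp =>
        rw [map_mul, MvPolynomial.aeval_X]
        exact Subring.mul_mem _ hp (Subring.subset_closure ⟨_, rfl⟩)
    exact this _
  let p : ℕ → A := fun j => ⟨MvPolynomial.psum (Fin N) ℤ j, MvPolynomial.psum_isSymmetric _ _ _⟩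
  let e : ℕ → A := fun n => ⟨MvPolynomial.esymm (Fin N) ℤ n, MvPolynomial.esymm_isSymmetric _ _ _⟩
  let e' : ℕ → A := fun n => ⟨MvPolynomial.expand d (MvPolynomial.esymm (Fin N) ℤ n), by
    intro σ
    rw [MvPolynomial.rename_expand]
    rw [MvPolynomial.esymm_isSymmetric]⟩
  have hinj : Function.Injective (A.val.toRingHom : A →+* MvPolynomial (Fin N) ℤ) :=
    Subtype.val_injective
  have h1 : IsNewton (fun j => p (j + 1)) e :=
    IsNewton.of_map hinj (isNewton_mvPolynomial (Fin N) ℤ)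
  have h2 : IsNewton (fun j => p (d * (j + 1))) e' := by
    refine IsNewton.of_map hinj ?_
    have := (isNewton_mvPolynomial (Fin N) ℤ).map (MvPolynomial.expand d).toRingHom
    convert! this using 2 with j
    simp [p, MvPolynomial.psum, pow_mul]
  have h3 := h1.map φ
  have he : ∀ k ≤ N, φ (e k) = lambdaL w k := by
    intro k hk
    cases k with
    | zero => rw [lambdaL_zero]; exact h3.1
    | succ k =>
      change MvPolynomial.aeval _ (E.symm (e (k + 1))) = _
      have := MvPolynomial.esymmAlgEquiv_symm_apply (R := ℤ) (Fintype.card_fin N) ⟨k, hk⟩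
      rw [show E.symm (e (k + 1)) = _ from this, MvPolynomial.aeval_X]
  have hp : ∀ j < N, φ (p (j + 1)) = charSeries nu (w.map ((j + 1) * ·)) := fun j hj =>
    h3.power_eq_of_le (isNewton_lambdaL w) he hj
  have h4 : φ (e' n) = lambdaL (w.map (d * ·)) n := by
    refine (h2.map φ).eq_of_le (isNewton_lambdaL _) (N := n) (fun j hj => ?_) le_rfl
    have h5 : 0 < d * (j + 1) := by positivity
    have h6 : d * (j + 1) ≤ N := by rw [mul_comm]; exact Nat.mul_le_mul_right d hj
    obtain ⟨i, hi⟩ : ∃ i, d * (j + 1) = i + 1 := ⟨d * (j + 1) - 1, by omega⟩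
    rw [hi, hp i (by omega), ← hi, List.map_map]
    congr 1
    refine List.map_congr_left fun a _ => ?_
    simp only [Function.comp]
    ring
  rw [← h4]
  exact hφ _

/-! ### Euler relations and squarefree monomials -/

/-- The relation `∑_{i=0}^n (-1)^i y_i y_{n-i} = 0` for all `n ≥ 1`. -/
def IsEuler {A : Type*} [CommRing A] (y : ℕ → A) : Prop :=
  y 0 = 1 ∧ ∀ n, 0 < n → ∑ i ∈ Finset.range (n + 1), (-1) ^ i * y i * y (n - i) = 0

/-- If the power sums of even degree vanish, the elementary symmetric functions satisfy the Euler
relations, that is, their generating series `E` satisfies `E(t) E(-t) = 1`: the logarithmic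
derivatives of `E(t)` and `E(-t)` are opposite. -/
theorem IsNewton.isEuler {A : Type*} [CommRing A] [IsAddTorsionFree A] {p e : ℕ → A}
    (h : IsNewton p e) (hp : ∀ j, Odd j → p j = 0) : IsEuler e := by
  refine ⟨h.1, fun n hn => ?_⟩
  let E : PowerSeries A := PowerSeries.mk e
  let E' : PowerSeries A := PowerSeries.mk fun n => (-1) ^ n * e n
  let P : PowerSeries A := PowerSeries.mk p
  have hp' : ∀ j, (-1) ^ j * p j = p j := by
    intro j
    rcases Nat.even_or_odd j with hj | hj
    · rw [hj.neg_one_pow, one_mul]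
    · rw [hp j hj, mul_zero]
  have h1 : PowerSeries.derivative A E = P * E := by
    ext n
    rw [PowerSeries.coeff_derivative, PowerSeries.coeff_mk, PowerSeries.coeff_mul,
      Finset.Nat.sum_antidiagonal_eq_sum_range_succ_mk]
    have := h.2 n
    push_cast at this
    rw [mul_comm, this]
    refine Finset.sum_congr rfl fun j _ => ?_
    rw [hp', PowerSeries.coeff_mk, PowerSeries.coeff_mk]
  have h2 : PowerSeries.derivative A E' = - (P * E') := by
    ext n
    rw [PowerSeries.coeff_derivative, PowerSeries.coeff_mk, map_neg, PowerSeries.coeff_mul,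
      Finset.Nat.sum_antidiagonal_eq_sum_range_succ_mk]
    have := h.2 n
    push_cast at this
    rw [mul_assoc, mul_comm (e (n + 1)), this, Finset.mul_sum, ← Finset.sum_neg_distrib]
    refine Finset.sum_congr rfl fun j hj => ?_
    rw [Finset.mem_range] at hj
    simp only [E', P, PowerSeries.coeff_mk]
    rw [hp']
    obtain ⟨d, rfl⟩ : ∃ d, n = j + d := ⟨n - j, by omega⟩
    rw [show j + d - j = d by omega]
    linear_combination (-(-1) ^ d * e d) * hp' j
  have h3 : PowerSeries.derivative A (E' * E) = 0 := by
    rw [Derivation.leibniz, h1, h2, smul_eq_mul, smul_eq_mul]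
    ring
  obtain ⟨n, rfl⟩ : ∃ k, n = k + 1 := ⟨n - 1, by omega⟩
  have h4 := congrArg (PowerSeries.coeff n) h3
  rw [PowerSeries.coeff_derivative, map_zero, PowerSeries.coeff_mul,
    Finset.Nat.sum_antidiagonal_eq_sum_range_succ_mk] at h4
  simp only [E, E', PowerSeries.coeff_mk] at h4
  have h5 : (n + 1) • ∑ i ∈ Finset.range (n + 1 + 1), (-1) ^ i * e i * e (n + 1 - i) =
      (n + 1) • (0 : A) := by
    rw [nsmul_eq_mul, smul_zero, mul_comm]
    push_cast
    exact h4
  exact nsmul_right_injective (Nat.succ_ne_zero n) h5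

theorem IsEuler.map {A B : Type*} [CommRing A] [CommRing B] (f : A →+* B) {y : ℕ → A}
    (h : IsEuler y) : IsEuler fun n => f (y n) := by
  refine ⟨by simp [h.1], fun n hn => ?_⟩
  have := congrArg f (h.2 n hn)
  simpa using this

theorem IsEuler.of_map {A B : Type*} [CommRing A] [CommRing B] {f : A →+* B}
    (hf : Function.Injective f) {y : ℕ → A} (h : IsEuler fun n => f (y n)) : IsEuler y :=
  ⟨hf (by simpa using h.1), fun n hn => hf (by simpa using h.2 n hn)⟩

/-- Rationally, the elements of odd index generate the others. -/
theorem IsEuler.mem_of_odd {B : Type*} [CommRing B] [Algebra ℚ B] {y : ℕ → B} (h : IsEuler y)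
    {S : Subalgebra ℚ B} (hS : ∀ n, Odd n → y n ∈ S) (n : ℕ) : y n ∈ S := by
  induction n using Nat.strong_induction_on with
  | _ n ih =>
    rcases Nat.even_or_odd n with he | ho
    · rcases Nat.eq_zero_or_pos n with rfl | hn
      · rw [h.1]; exact S.one_mem
      have h1 := h.2 n hn
      obtain ⟨m, rfl⟩ : ∃ m, n = m + 1 := ⟨n - 1, by omega⟩
      rw [Finset.sum_range_succ, Finset.sum_range_succ', he.neg_one_pow] at h1
      simp only [pow_zero, Nat.sub_zero, Nat.sub_self, h.1, one_mul, mul_one] at h1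
      have h2 : y (m + 1) = (-(1 / 2) : ℚ) • ∑ i ∈ Finset.range m,
          (-1) ^ (i + 1) * y (i + 1) * y (m + 1 - (i + 1)) := by
        have h3 : (2 : ℚ) • y (m + 1) = - ∑ i ∈ Finset.range m,
          (-1) ^ (i + 1) * y (i + 1) * y (m + 1 - (i + 1)) := by
          rw [two_smul]
          linear_combination h1
        rw [neg_smul, ← smul_neg, ← h3, smul_smul]
        norm_num
      rw [h2]
      refine S.smul_mem (S.sum_mem fun i hi => ?_) _
      rw [Finset.mem_range] at hi
      exact S.mul_mem (S.mul_mem (S.pow_mem (S.neg_mem S.one_mem) _) (ih _ (by omega)))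
        (ih _ (by omega))
    · exact hS n ho

section Squarefree

variable {I : Type*}

theorem sum_sq_le_sq_sum (s : Multiset (I × ℕ+)) :
    (s.map fun p => (p.2 : ℕ) ^ 2).sum ≤ (s.map fun p => (p.2 : ℕ)).sum ^ 2 := by
  induction s using Multiset.induction_on with
  | empty => simp
  | cons a s ih =>
    simp only [Multiset.map_cons, Multiset.sum_cons]
    nlinarith [Nat.zero_le ((a.2 : ℕ) * (s.map fun p => (p.2 : ℕ)).sum)]

/-- Multiplication of a monomial by `y_i`, where `y_0 = 1`, with its effect on the sum of the
indices and on that of their squares. -/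
theorem exists_cons (α : I) (i : ℕ) (s : Multiset (I × ℕ+)) :
    ∃ s' : Multiset (I × ℕ+),
      (s'.map fun p => (p.2 : ℕ)).sum = i + (s.map fun p => (p.2 : ℕ)).sum ∧
      (s'.map fun p => (p.2 : ℕ) ^ 2).sum = i ^ 2 + (s.map fun p => (p.2 : ℕ) ^ 2).sum ∧
      ∀ (B : Type _) [CommRing B] (y : I → ℕ → B), y α 0 = 1 →
        (s'.map fun p => y p.1 p.2).prod = y α i * (s.map fun p => y p.1 p.2).prod := by
  by_cases h : 0 < i
  · exact ⟨(α, ⟨i, h⟩) ::ₘ s, by simp, by simp, fun B _ y _ => by simp⟩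
  · obtain rfl : i = 0 := by omega
    exact ⟨s, by simp, by simp, fun B _ y h => by simp [h]⟩

/-- By means of the Euler relations, every monomial is a linear combination of squarefree
monomials: the relation of degree `2m` replaces a square `y_m²` by products `y_i y_{2m-i}` with
`i ≠ m`, which increases the sum of the squares of the indices and keeps their sum. -/
theorem prod_mem_span_squarefree {R B : Type*} [CommRing R] [CommRing B] [Algebra R B]
    {y : I → ℕ → B} (hy : ∀ α, IsEuler (y α)) (s : Multiset (I × ℕ+)) :
    (s.map fun p => y p.1 p.2).prod ∈
      Submodule.span R (Set.range fun S : Finset (I × ℕ+) => ∏ p ∈ S, y p.1 p.2) := by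
  induction hk : (s.map fun p => (p.2 : ℕ)).sum ^ 2 - (s.map fun p => (p.2 : ℕ) ^ 2).sum using
    Nat.strong_induction_on generalizing s with
  | _ k ih =>
    by_cases hs : s.Nodup
    · exact Submodule.subset_span ⟨⟨s, hs⟩, rfl⟩
    · rw [Multiset.nodup_iff_le] at hs
      push Not at hs
      obtain ⟨⟨α, m⟩, hle⟩ := hs
      obtain ⟨t, rfl⟩ := Multiset.le_iff_exists_add.1 hle
      have hm := m.pos
      have h1 := (hy α).2 (m + m) (by omega)
      rw [← Finset.add_sum_erase _ _ (Finset.mem_range.2 (show (m : ℕ) < m + m + 1 by omega))] at h1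
      have h2 : y α m * y α m = - (-1) ^ (m : ℕ) *
          ∑ i ∈ (Finset.range (m + m + 1)).erase m, (-1) ^ i * y α i * y α (m + m - i) := by
        have h3 : ((-1) ^ (m : ℕ) * (-1) ^ (m : ℕ) : B) = 1 := by rw [← mul_pow]; simp
        rw [Nat.add_sub_cancel] at h1
        linear_combination (-1) ^ (m : ℕ) * h1 - y α m * y α m * h3
      simp only [Multiset.cons_add, zero_add, Multiset.map_cons, Multiset.prod_cons,
        Multiset.sum_cons, ← mul_assoc, ← add_assoc] at hk ⊢
      rw [h2, mul_assoc, Finset.sum_mul]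
      have hneg : ∀ (n : ℕ) (x : B), x ∈ Submodule.span R (Set.range fun S : Finset (I × ℕ+) =>
          ∏ p ∈ S, y p.1 p.2) → (-1) ^ n * x ∈ Submodule.span R (Set.range
            fun S : Finset (I × ℕ+) => ∏ p ∈ S, y p.1 p.2) := by
        intro n x hx
        rcases neg_one_pow_eq_or B n with h | h <;> rw [h]
        · rwa [one_mul]
        · rw [neg_one_mul]; exact Submodule.neg_mem _ hx
      rw [neg_mul]
      refine Submodule.neg_mem _ (hneg _ _ (Submodule.sum_mem _ fun i hi => ?_))
      rw [Finset.mem_erase, Finset.mem_range] at hi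
      rw [mul_assoc, mul_assoc]
      refine hneg _ _ ?_
      obtain ⟨s₁, w₁, q₁, p₁⟩ := exists_cons α (m + m - i) t
      obtain ⟨s₂, w₂, q₂, p₂⟩ := exists_cons α i s₁
      rw [← p₁ B y (hy α).1, ← p₂ B y (hy α).1]
      refine ih _ ?_ s₂ rfl
      have h4 := sum_sq_le_sq_sum s₂
      rw [w₁] at w₂
      rw [q₁] at q₂
      rw [← hk]
      have h5 : i + (m + m - i + (t.map fun p => (p.2 : ℕ)).sum) =
          m + m + (t.map fun p => (p.2 : ℕ)).sum := by omega
      rw [h5] at w₂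
      rw [w₂] at h4 ⊢
      have h6 : (m : ℕ) ^ 2 + (m : ℕ) ^ 2 < i ^ 2 + (m + m - i) ^ 2 := by
        rcases Nat.lt_or_gt_of_ne hi.1 with h | h
        · obtain ⟨d, hd⟩ : ∃ d, (m : ℕ) = i + d := ⟨m - i, by omega⟩
          rw [hd, show i + d + (i + d) - i = i + d + d by omega]
          have : 0 < d := by omega
          nlinarith
        · obtain ⟨d, hd⟩ : ∃ d, i = m + d := ⟨i - m, by omega⟩
          obtain ⟨e, he⟩ : ∃ e, (m : ℕ) = d + e := ⟨m - d, by omega⟩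
          rw [show (m : ℕ) + m - i = e by omega, hd, he]
          have : 0 < d := by omega
          nlinarith
      omega

theorem mem_span_squarefree {R B : Type*} [CommRing R] [CommRing B] [Algebra R B]
    {y : I → ℕ → B} (hy : ∀ α, IsEuler (y α)) {x : B}
    (hx : x ∈ Algebra.adjoin R (Set.range fun p : I × ℕ+ => y p.1 p.2)) :
    x ∈ Submodule.span R (Set.range fun S : Finset (I × ℕ+) => ∏ p ∈ S, y p.1 p.2) := by
  rw [← Subalgebra.mem_toSubmodule, Algebra.adjoin_eq_span] at hx
  refine Submodule.span_le.2 ?_ hx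
  intro z hz
  obtain ⟨s, hs, rfl⟩ := Submonoid.exists_multiset_of_mem_closure hz
  have : ∃ t : Multiset (I × ℕ+), s = t.map fun p => y p.1 p.2 := by
    clear hz
    induction s using Multiset.induction_on with
    | empty => exact ⟨0, rfl⟩
    | cons a s ih =>
      obtain ⟨p, hp⟩ := hs a (by simp)
      obtain ⟨t, ht⟩ := ih fun b hb => hs b (by simp [hb])
      exact ⟨p ::ₘ t, by rw [Multiset.map_cons, ← ht, ← hp]⟩
  obtain ⟨t, rfl⟩ := this
  exact prod_mem_span_squarefree hy t

end Squarefree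

/-! ### Linear independence by counting -/

/-- A homogeneous spanning family whose index set is no larger, degree by degree, than that of a
homogeneous basis with finitely many members in each degree is linearly independent: it is the
image of part of the basis under a surjective graded endomorphism, which is injective. -/
theorem linearIndependent_of_span_eq_top {R V J K : Type*} [CommRing R] [AddCommGroup V]
    [Module R V] (b : Module.Basis J R V) (wt : J → ℕ) (hfin : ∀ n, {j | wt j = n}.Finite)
    {v : K → V} (hspan : Submodule.span R (Set.range v) = ⊤) {φ : K → J}
    (hφ : Function.Injective φ) (hv : ∀ i j, b.repr (v i) j ≠ 0 → wt j = wt (φ i)) :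
    LinearIndependent R v := by
  classical
  let T : V →ₗ[R] V := b.constr R (Function.extend φ v 0)
  have hT : ∀ i, T (b (φ i)) = v i := by
    intro i
    rw [Module.Basis.constr_basis, hφ.extend_apply]
  have hT0 : ∀ j, (¬ ∃ i, φ i = j) → T (b j) = 0 := by
    intro j hj
    rw [Module.Basis.constr_basis, Function.extend_apply' _ _ _ hj]
    rfl
  let P : ℕ → V →ₗ[R] V := fun N => b.constr R fun j => if wt j ≤ N then b j else 0
  have hP : ∀ N x j, b.repr (P N x) j = if wt j ≤ N then b.repr x j else 0 := by
    intro N x j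
    induction b.mem_span x using Submodule.span_induction with
    | mem x hx =>
      obtain ⟨k, rfl⟩ := hx
      simp only [P, Module.Basis.constr_basis]
      by_cases hk : wt k ≤ N
      · rw [if_pos hk, Module.Basis.repr_self, Finsupp.single_apply]
        split_ifs <;> simp_all
      · rw [if_neg hk, map_zero, Module.Basis.repr_self, Finsupp.single_apply]
        split_ifs <;> simp_all
    | zero => simp
    | add x y _ _ hx hy => simp only [map_add, Finsupp.add_apply, hx, hy]; split_ifs <;> simp
    | smul c x _ hx => simp only [map_smul, Finsupp.smul_apply, hx]; split_ifs <;> simp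
  have hcomm : ∀ N x, T (P N x) = P N (T x) := by
    intro N x
    have : T ∘ₗ P N = P N ∘ₗ T := by
      refine b.ext fun j => ?_
      simp only [LinearMap.comp_apply]
      have h1 : P N (b j) = if wt j ≤ N then b j else 0 := Module.Basis.constr_basis _ _ _ _
      rw [h1]
      by_cases hj : ∃ i, φ i = j
      · obtain ⟨i, rfl⟩ := hj
        rw [apply_ite T, hT, map_zero]
        apply b.repr.injective
        ext j
        rw [hP]
        by_cases h0 : b.repr (v i) j = 0
        · split_ifs <;> simp [h0]
        · rw [hv i j h0]
          split_ifs <;> simp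
      · rw [apply_ite T, hT0 j hj]
        simp
    exact LinearMap.congr_fun this x
  have hsurj : Function.Surjective T := by
    rw [← LinearMap.range_eq_top, eq_top_iff, ← hspan, Submodule.span_le]
    rintro _ ⟨i, rfl⟩
    exact ⟨_, hT i⟩
  have hinj : LinearMap.ker T = ⊥ := by
    rw [LinearMap.ker_eq_bot']
    intro x hx
    let N := (b.repr x).support.sup wt
    have hPx : P N x = x := by
      apply b.repr.injective
      ext j
      rw [hP]
      split_ifs with h
      · rfl
      · by_contra h0
        exact h (Finset.le_sup (f := wt) (Finsupp.mem_support_iff.2 (Ne.symm h0)))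
    let M := LinearMap.range (P N)
    have hfg : Module.Finite R M := by
      rw [Module.Finite.iff_fg]
      have : M = Submodule.span R (Set.range fun j => if wt j ≤ N then b j else 0) :=
        Module.Basis.constr_range _ _
      rw [this]
      refine Submodule.fg_span (Set.Finite.subset (s := insert 0 (b '' {j | wt j ≤ N})) ?_ ?_)
      · refine Set.Finite.insert _ (Set.Finite.image _ ?_)
        have : {j | wt j ≤ N} = ⋃ n ∈ Finset.range (N + 1), {j | wt j = n} := by
          ext j; simp
        rw [this]
        exact Set.Finite.biUnion (Finset.finite_toSet _) fun n _ => hfin n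
      · rintro _ ⟨j, rfl⟩
        by_cases h : wt j ≤ N
        · simp only [if_pos h]
          exact Set.mem_insert_of_mem _ ⟨j, h, rfl⟩
        · simp [if_neg h]
    have hmaps : ∀ z ∈ M, T z ∈ M := by
      rintro _ ⟨z, rfl⟩
      exact ⟨T z, (hcomm N z).symm⟩
    have hsurj' : Function.Surjective (T.restrict hmaps) := by
      rintro ⟨_, ⟨z, rfl⟩⟩
      obtain ⟨z, rfl⟩ := hsurj z
      exact ⟨⟨P N z, ⟨z, rfl⟩⟩, Subtype.ext (hcomm N z)⟩
    have h1 := OrzechProperty.injective_of_surjective_endomorphism _ hsurj'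
    have h2 : (⟨x, ⟨x, hPx⟩⟩ : M) = 0 := h1 (by
      rw [map_zero]
      exact Subtype.ext hx)
    exact congrArg Subtype.val h2
  have := (b.linearIndependent.comp φ hφ).map' T hinj
  convert! this using 1
  ext i
  exact (hT i).symm

/-! ### Multiples of elementary Lyndon words -/

theorem map_mul_lt_map_mul_iff {d : ℕ} (hd : 0 < d) (u v : List ℕ) :
    u.map (d * ·) < v.map (d * ·) ↔ u < v := by
  induction u generalizing v with
  | nil => cases v <;> simp
  | cons a u ih =>
    cases v with
    | nil => simp
    | cons b v =>
      simp only [List.map_cons, List.cons_lt_cons_iff, ih, Nat.mul_lt_mul_left hd,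
        Nat.mul_right_inj hd.ne']

theorem isLyndonWord_scale_iff {d : ℕ} (hd : 0 < d) (w : List ℕ) :
    IsLyndonWord (w.map (d * ·)) ↔ IsLyndonWord w := by
  have hinj : Function.Injective (List.map (d * ·)) :=
    List.map_injective_iff.2 fun a b h => Nat.eq_of_mul_eq_mul_left hd h
  refine and_congr (by simp) ⟨fun h t ht h1 h2 => ?_, fun h t ht h1 h2 => ?_⟩
  · rw [← map_mul_lt_map_mul_iff hd]
    exact h _ (ht.map _) (by simpa using h1) (hinj.ne h2)
  · obtain ⟨s, hs⟩ := ht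
    obtain ⟨s', t', rfl, rfl, rfl⟩ := List.map_eq_append_iff.1 hs.symm
    rw [map_mul_lt_map_mul_iff hd]
    exact h t' (List.suffix_append _ _) (by simpa using h1) fun h => h2 (by rw [← h])

theorem foldr_gcd_dvd {w : List ℕ} : ∀ a ∈ w, w.foldr Nat.gcd 0 ∣ a := by
  induction w with
  | nil => simp
  | cons b w ih =>
    intro a ha
    rcases List.mem_cons.1 ha with rfl | ha
    · exact Nat.gcd_dvd_left _ _
    · exact (Nat.gcd_dvd_right _ _).trans (ih a ha)

theorem foldr_gcd_scale (d : ℕ) (w : List ℕ) :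
    (w.map (d * ·)).foldr Nat.gcd 0 = d * w.foldr Nat.gcd 0 := by
  induction w with
  | nil => simp
  | cons a w ih => rw [List.map_cons, List.foldr_cons, ih, Nat.gcd_mul_left, List.foldr_cons]

theorem ELod.isLyndonWord (α : ELod) : IsLyndonWord α.1.2.blocks := by
  refine ⟨fun h => α.2.1 ?_, α.2.2.2.2⟩
  rw [← α.1.2.blocks_sum, h, List.sum_nil]

/-- A Lyndon word in odd letters is an odd multiple of an elementary one. -/
theorem exists_eq_scale {u : List ℕ} (hu : IsLyndonWord u) (ho : IsOddWord u) :
    ∃ (α : ELod) (d : ℕ), Odd d ∧ u = α.1.2.blocks.map (d * ·) := by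
  set d := u.foldr Nat.gcd 0 with hd
  have hdvd : ∀ a ∈ u, d ∣ a := foldr_gcd_dvd
  obtain ⟨a, ha⟩ := List.exists_mem_of_ne_nil u hu.1
  have hodd : Odd d := Odd.of_dvd_nat (ho a ha) (hdvd a ha)
  have hw : u = (u.map (· / d)).map (d * ·) := by
    rw [List.map_map]
    conv_lhs => rw [← List.map_id u]
    exact List.map_congr_left fun a ha => (Nat.mul_div_cancel' (hdvd a ha)).symm
  have hw' : IsOddWord (u.map (· / d)) := by
    intro b hb
    obtain ⟨a, ha, rfl⟩ := List.mem_map.1 hb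
    exact Odd.of_dvd_nat (ho a ha) (Nat.div_dvd_of_dvd (hdvd a ha))
  have hl : IsLyndonWord (u.map (· / d)) := by
    rw [← isLyndonWord_scale_iff hodd.pos, ← hw]
    exact hu
  refine ⟨⟨toComp _ hw'.pos, ?_, hw', ?_, hl.2⟩, d, hodd, hw⟩
  · change (u.map (· / d)).sum ≠ 0
    obtain ⟨b, hb⟩ := List.exists_mem_of_ne_nil _ hl.1
    have := List.single_le_sum (l := u.map (· / d)) (by simp) b hb
    have := hw'.pos b hb
    omega
  · change (u.map (· / d)).foldr Nat.gcd 0 = 1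
    have := foldr_gcd_scale d (u.map (· / d))
    rw [← hw, ← hd] at this
    exact Nat.eq_of_mul_eq_mul_left hodd.pos (by rw [← this, mul_one])

/-! ### The generators -/

/-- The element `q_n(α) = λ̃^n(L_α)` of `PQSym`. -/
noncomputable def genQ (α : ELod) (n : ℕ) : PQSym :=
  ⟨lambdaL α.1.2.blocks n, lambdaL_mem (fun _ h => α.1.2.blocks_pos h) n⟩

theorem isEuler_lambdaL {w : List ℕ} (hw : w ≠ []) : IsEuler (lambdaL w) :=
  (isNewton_lambdaL w).isEuler fun _ hj => charSeries_nu_scale_even (by simpa using hj.add_one) hw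

theorem isEuler_genQ (α : ELod) : IsEuler (genQ α) :=
  IsEuler.of_map (f := PQSym.subtype) Subtype.val_injective (isEuler_lambdaL α.isLyndonWord.1)

theorem adjoin_genQ :
    Algebra.adjoin ℤ (Set.range fun p : ELod × ℕ+ => genQ p.1 p.2) = ⊤ := by
  set S := Algebra.adjoin ℤ (Set.range fun p : ELod × ℕ+ => genQ p.1 p.2) with hS
  let S' : Subring Amb := S.toSubring.map PQSym.subtype
  have h1 : ∀ (α : ELod) n, lambdaL α.1.2.blocks n ∈ S' := by
    intro α n
    refine ⟨genQ α n, ?_, rfl⟩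
    change genQ α n ∈ S
    rcases Nat.eq_zero_or_pos n with rfl | hn
    · rw [(isEuler_genQ α).1]; exact S.one_mem
    · exact Algebra.subset_adjoin ⟨(α, ⟨n, hn⟩), rfl⟩
  have h2 : ∀ w, IsOddWord w → charSeries nu w ∈ S' := by
    intro w hw
    refine charSeries_mem_of_lambdaL_mem (fun u hu ho n => ?_) hw
    obtain ⟨α, d, hd, rfl⟩ := exists_eq_scale hu ho
    refine Subring.closure_le.2 ?_ (lambdaL_scale_mem hd.pos α.1.2.blocks n)
    rintro _ ⟨k, rfl⟩
    exact h1 α k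
  rw [eq_top_iff]
  rintro x -
  have h3 : peakSpan (fun _ => True) ≤ S'.toAddSubgroup.toIntSubmodule := by
    refine Submodule.span_le.2 ?_
    rintro _ ⟨w, ⟨hw, -⟩, rfl⟩
    exact h2 w hw
  obtain ⟨y, hy, hyx⟩ := h3 ((mem_PQSym_iff _).1 x.2)
  rwa [← Subtype.ext hyx]

/-! ### Independence of the generators -/

/-- The product of the `q_n(α)` over a multiset of pairs `(α, n)`. -/
noncomputable def monomialGenQ (s : Multiset (ELod × ℕ+)) : PQSym :=
  (s.map fun p => genQ p.1 p.2).prod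

/-- The degree of `monomialGenQ s`. -/
def genWeight (s : Multiset (ELod × ℕ+)) : ℕ := (s.map fun p => (p.2 : ℕ) * p.1.1.1).sum

/-- The `q_n(α)` are homogeneous of degree `n |α|`. -/
theorem sum_eq_of_repr_monomialGenQ_ne_zero (s : Multiset (ELod × ℕ+)) {w : {w // IsOddWord w}}
    (h : peakBasis.repr (monomialGenQ s) w ≠ 0) : w.1.sum = genWeight s := by
  have key : (monomialGenQ s : Amb) ∈
      boundedSpan (genWeight s) (s.map fun p => (p.2 : ℕ) * p.1.1.2.blocks.length).sum := by
    clear h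
    induction s using Multiset.induction_on with
    | empty => simpa [monomialGenQ, genWeight] using one_mem_boundedSpan
    | cons p s ih =>
      simp only [monomialGenQ, genWeight, Multiset.map_cons, Multiset.prod_cons,
        Multiset.sum_cons, Subring.coe_mul]
      refine mul_mem_boundedSpan ?_ ih
      have := lambdaL_mem_boundedSpan (fun _ h => p.1.1.2.blocks_pos h) (p.2 : ℕ)
      rwa [p.1.1.2.blocks_sum] at this
  exact ((mem_peakSpan_iff _).1 key w h).1

/-- Odd positive integers. -/
abbrev OddPNat : Type := {n : ℕ+ // Odd (n : ℕ)}

/-- The Lyndon word `dα`. -/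
def scaledWord (p : ELod × OddPNat) : List ℕ := p.1.1.2.blocks.map ((p.2.1 : ℕ) * ·)

theorem isLyndonWord_scaledWord (p : ELod × OddPNat) : IsLyndonWord (scaledWord p) :=
  (isLyndonWord_scale_iff p.2.1.pos _).2 p.1.isLyndonWord

theorem isOddWord_scaledWord (p : ELod × OddPNat) : IsOddWord (scaledWord p) := by
  intro a ha
  obtain ⟨b, hb, rfl⟩ := List.mem_map.1 ha
  exact p.2.2.mul (p.1.2.2.1 b hb)

theorem scaledWord_injective : Function.Injective scaledWord := by
  rintro ⟨α, d⟩ ⟨β, e⟩ h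
  have h1 := congrArg (List.foldr Nat.gcd 0) h
  simp only [scaledWord, foldr_gcd_scale, α.2.2.2.1, β.2.2.2.1, mul_one] at h1
  obtain rfl : d = e := Subtype.ext (PNat.eq h1)
  have hinj : Function.Injective (List.map ((d.1 : ℕ) * ·)) :=
    List.map_injective_iff.2 fun a b h => Nat.eq_of_mul_eq_mul_left d.1.pos h
  have h2 : α.1.2.blocks = β.1.2.blocks := hinj h
  rw [Subtype.ext (Composition.sigma_eq_iff_blocks_eq.2 h2)]

/-- The odd word obtained by concatenating, in nonincreasing order, the Lyndon words `dα` with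
multiplicity `f (α, d)`. -/
noncomputable def lyndonConcat (f : ELod × OddPNat →₀ ℕ) : {w // IsOddWord w} :=
  ⟨((f.toMultiset.map scaledWord).sort (· ≥ ·)).flatten, by
    intro a ha
    obtain ⟨u, hu, hau⟩ := List.mem_flatten.1 ha
    rw [Multiset.mem_sort, Multiset.mem_map] at hu
    obtain ⟨p, -, rfl⟩ := hu
    exact isOddWord_scaledWord p a hau⟩

/-- The factorization into Lyndon words recovers the multiset of the `dα`, and the gcd of the
letters of `dα` recovers `d`. -/
theorem lyndonConcat_injective : Function.Injective lyndonConcat := by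
  have hseq : ∀ f : ELod × OddPNat →₀ ℕ,
      IsLyndonSeq ((f.toMultiset.map scaledWord).sort (· ≥ ·)) := by
    intro f
    refine ⟨fun u hu => ?_, Multiset.pairwise_sort _ _⟩
    rw [Multiset.mem_sort, Multiset.mem_map] at hu
    obtain ⟨p, -, rfl⟩ := hu
    exact isLyndonWord_scaledWord p
  intro f g h
  have h1 := (hseq f).eq_of_flatten_eq (hseq g) (congrArg Subtype.val h)
  have h2 := congrArg (fun l : List (List ℕ) => (l : Multiset (List ℕ))) h1
  simp only [Multiset.sort_eq] at h2
  exact Multiset.toFinsupp.symm.injective (Multiset.map_injective scaledWord_injective h2)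

/-- A pair `(α, d)` with `d` odd as a pair of `ELod × ℕ+`. -/
def oddPair (p : ELod × OddPNat) : ELod × ℕ+ := (p.1, p.2.1)

theorem sum_lyndonConcat (f : ELod × OddPNat →₀ ℕ) :
    (lyndonConcat f).1.sum = genWeight (f.toMultiset.map oddPair) := by
  have h : ((f.toMultiset.map scaledWord).sort (· ≥ ·)).flatten.sum =
      ((f.toMultiset.map scaledWord).map List.sum).sum := by
    conv_rhs => rw [← Multiset.sort_eq (f.toMultiset.map scaledWord) (· ≥ ·)]
    rw [Multiset.map_coe, Multiset.sum_coe, List.sum_flatten]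
  rw [lyndonConcat, h, genWeight, Multiset.map_map, Multiset.map_map]
  congr 1
  refine Multiset.map_congr rfl fun p _ => ?_
  simp only [Function.comp, scaledWord, sum_scale, p.1.1.2.blocks_sum, oddPair]

theorem exists_two_pow_mul (n : ℕ+) : ∃ (k : ℕ) (d : OddPNat), (n : ℕ) = 2 ^ k * d.1 := by
  obtain ⟨k, m, hm, h⟩ := Nat.exists_eq_two_pow_mul_odd n.ne_zero
  exact ⟨k, ⟨⟨m, hm.pos⟩, hm⟩, h⟩

/-- The exponent of `2` in a positive integer. -/
noncomputable def twoExp (n : ℕ+) : ℕ := (exists_two_pow_mul n).choose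

/-- The odd part of a positive integer. -/
noncomputable def oddPart (n : ℕ+) : OddPNat := (exists_two_pow_mul n).choose_spec.choose

theorem two_pow_mul_oddPart (n : ℕ+) : (n : ℕ) = 2 ^ twoExp n * (oddPart n).1 :=
  (exists_two_pow_mul n).choose_spec.choose_spec

/-- Euler's bijection between sets of positive integers and multisets of odd ones: `2^k d` is
replaced by `2^k` copies of `d`. -/
noncomputable def binarySplit (S : Finset (ELod × ℕ+)) : ELod × OddPNat →₀ ℕ :=
  ∑ p ∈ S, Finsupp.single (p.1, oddPart p.2) (2 ^ twoExp p.2)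

theorem binarySplit_injective : Function.Injective binarySplit := by
  classical
  have key : ∀ (S : Finset (ELod × ℕ+)) (p : ELod × ℕ+),
      p ∈ S ↔ twoExp p.2 ∈ (binarySplit S (p.1, oddPart p.2)).bitIndices.toFinset := by
    intro S p
    set T := S.filter fun x => x.1 = p.1 ∧ oddPart x.2 = oddPart p.2 with hT
    have hinj : Set.InjOn (fun x : ELod × ℕ+ => twoExp x.2) T := by
      intro x hx y hy hxy
      simp only [hT, Finset.coe_filter, Set.mem_ofPred_eq] at hx hy
      refine Prod.ext (hx.2.1.trans hy.2.1.symm) (PNat.eq ?_)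
      rw [two_pow_mul_oddPart x.2, two_pow_mul_oddPart y.2, hx.2.2, hy.2.2]
      simp only at hxy
      rw [hxy]
    have h1 : binarySplit S (p.1, oddPart p.2) =
        ∑ j ∈ T.image fun x => twoExp x.2, 2 ^ j := by
      rw [Finset.sum_image hinj, hT, Finset.sum_filter, binarySplit, Finsupp.finsetSum_apply]
      refine Finset.sum_congr rfl fun x _ => ?_
      rw [Finsupp.single_apply]
      exact if_congr Prod.ext_iff rfl rfl
    rw [h1, Finset.toFinset_bitIndices_sum_two_pow, Finset.mem_image]
    constructor
    · intro hp
      exact ⟨p, by simp [hT, hp], rfl⟩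
    · rintro ⟨x, hx, hxp⟩
      simp only [hT, Finset.mem_filter] at hx
      have : x = p := by
        refine Prod.ext hx.2.1 (PNat.eq ?_)
        rw [two_pow_mul_oddPart x.2, two_pow_mul_oddPart p.2, hx.2.2, hxp]
      exact this ▸ hx.1
  intro S S' h
  ext p
  rw [key, key, h]

theorem genWeight_binarySplit (S : Finset (ELod × ℕ+)) :
    genWeight ((binarySplit S).toMultiset.map oddPair) = genWeight S.val := by
  let W : Multiset (ELod × ℕ+) →+ ℕ := Multiset.sumAddMonoidHom.comp
    (Multiset.mapAddMonoidHom fun p : ELod × ℕ+ => (p.2 : ℕ) * p.1.1.1)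
  let W' : (ELod × OddPNat →₀ ℕ) →+ ℕ :=
    (W.comp (Multiset.mapAddMonoidHom oddPair)).comp Finsupp.toMultiset
  change W' (binarySplit S) = ∑ p ∈ S, (p.2 : ℕ) * p.1.1.1
  rw [binarySplit, map_sum]
  refine Finset.sum_congr rfl fun p _ => ?_
  simp only [W', W, AddMonoidHom.comp_apply, Finsupp.toMultiset_single, map_nsmul]
  rw [two_pow_mul_oddPart p.2]
  simp [oddPair, mul_assoc]

theorem finite_oddWords (n : ℕ) : {w : {w // IsOddWord w} | w.1.sum = n}.Finite := by
  refine Set.Finite.of_finite_image ((finite_words n).subset ?_) Subtype.val_injective.injOn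
  rintro _ ⟨w, hw, rfl⟩
  exact ⟨w.2.pos, hw⟩

theorem span_squarefree_genQ :
    Submodule.span ℤ (Set.range fun S : Finset (ELod × ℕ+) => ∏ p ∈ S, genQ p.1 p.2) = ⊤ := by
  rw [eq_top_iff]
  rintro x -
  exact mem_span_squarefree isEuler_genQ (by rw [adjoin_genQ]; trivial)

theorem linearIndependent_squarefree_genQ :
    LinearIndependent ℤ fun S : Finset (ELod × ℕ+) => ∏ p ∈ S, genQ p.1 p.2 := by
  refine linearIndependent_of_span_eq_top peakBasis (fun w => w.1.sum) finite_oddWords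
    span_squarefree_genQ (lyndonConcat_injective.comp binarySplit_injective) fun S w h => ?_
  rw [sum_eq_of_repr_monomialGenQ_ne_zero S.val h, Function.comp, sum_lyndonConcat,
    genWeight_binarySplit]

/-! ### Completeness of the relations -/

theorem aeval_genY (α : ELod) (n : ℕ) :
    MvPolynomial.aeval (fun p : ELod × ℕ+ => genQ p.1 p.2) (genY α n) = genQ α n := by
  unfold genY
  split_ifs with h
  · exact MvPolynomial.aeval_X _ _
  · obtain rfl : n = 0 := by omega
    rw [map_one, (isEuler_genQ α).1]

/-- Modulo the ideal of the Euler relations, each polynomial is a combination of squarefree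
monomials, and these are independent in `PQSym`. -/
theorem ker_aeval_genQ :
    RingHom.ker (MvPolynomial.aeval (R := ℤ) fun p : ELod × ℕ+ => genQ p.1 p.2) =
      Ideal.span (Set.range fun p : ELod × ℕ+ => eulerRel p.1 p.2) := by
  set J := Ideal.span (Set.range fun p : ELod × ℕ+ => eulerRel p.1 p.2) with hJ
  have hle : J ≤ RingHom.ker (MvPolynomial.aeval (R := ℤ) fun p : ELod × ℕ+ => genQ p.1 p.2) := by
    refine Ideal.span_le.2 ?_
    rintro _ ⟨⟨α, n⟩, rfl⟩
    change MvPolynomial.aeval (fun p : ELod × ℕ+ => genQ p.1 p.2) (eulerRel α n) = 0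
    rw [eulerRel, map_sum, ← (isEuler_genQ α).2 n n.pos]
    refine Finset.sum_congr rfl fun i _ => ?_
    simp only [map_mul, map_pow, map_neg, map_one, aeval_genY]
  refine le_antisymm (fun f hf => ?_) hle
  let y : ELod → ℕ → MvPolynomial (ELod × ℕ+) ℤ ⧸ J := fun α n => Ideal.Quotient.mk J (genY α n)
  have hy : ∀ α, IsEuler (y α) := by
    intro α
    refine ⟨by simp [y, genY], fun n hn => ?_⟩
    have : Ideal.Quotient.mk J (eulerRel α n) = 0 :=
      Ideal.Quotient.eq_zero_iff_mem.2 (Ideal.subset_span ⟨(α, ⟨n, hn⟩), rfl⟩)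
    rw [← this, eulerRel, map_sum]
    simp [y]
  have hX : ∀ p : ELod × ℕ+, y p.1 p.2 = Ideal.Quotient.mk J (MvPolynomial.X p) := by
    intro p
    simp only [y, genY, dif_pos p.2.pos]
    rfl
  have h1 : Ideal.Quotient.mk J f ∈
      Algebra.adjoin ℤ (Set.range fun p : ELod × ℕ+ => y p.1 p.2) := by
    simp only [hX]
    clear hf
    induction f using MvPolynomial.induction_on with
    | C a => simp
    | add f g hf hg => rw [map_add]; exact add_mem hf hg
    | mul_X f p hf =>
      rw [map_mul]
      exact mul_mem hf (Algebra.subset_adjoin ⟨p, rfl⟩)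
  have h2 := mem_span_squarefree hy h1
  obtain ⟨c, hc⟩ := (Finsupp.mem_span_range_iff_exists_finsupp).1 h2
  let g : MvPolynomial (ELod × ℕ+) ℤ := c.sum fun S a => a • ∏ p ∈ S, MvPolynomial.X p
  have hg : f - g ∈ J := by
    rw [← Ideal.Quotient.eq_zero_iff_mem, map_sub, sub_eq_zero, ← hc]
    simp [g, Finsupp.sum, hX]
  have h3 : MvPolynomial.aeval (fun p : ELod × ℕ+ => genQ p.1 p.2) g = 0 := by
    have h4 : MvPolynomial.aeval (fun p : ELod × ℕ+ => genQ p.1 p.2) (f - g) = 0 := hle hg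
    have h5 : MvPolynomial.aeval (fun p : ELod × ℕ+ => genQ p.1 p.2) f = 0 := hf
    rwa [map_sub, h5, zero_sub, neg_eq_zero] at h4
  have h6 : c = 0 := by
    refine linearIndependent_iff.1 linearIndependent_squarefree_genQ c ?_
    rw [← h3]
    simp [g, Finsupp.sum, Finsupp.linearCombination_apply]
  have h7 : g = 0 := by simp [g, h6]
  rwa [h7, sub_zero] at hg

/-! ### Families of strict partitions -/

theorem StrictFamily.finite (l : StrictFamily) :
    {p : ELod × ℕ+ | (p.2 : ℕ) ∈ l.1 p.1}.Finite := by
  have : {p : ELod × ℕ+ | (p.2 : ℕ) ∈ l.1 p.1} ⊆ ⋃ α ∈ {α | l.1 α ≠ []},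
      (fun p : ELod × ℕ+ => (p.1, (p.2 : ℕ))) ⁻¹' ({α} ×ˢ {n | n ∈ l.1 α}) := by
    intro p hp
    simp only [Set.mem_iUnion]
    exact ⟨p.1, List.ne_nil_of_mem hp, rfl, hp⟩
  refine (Set.Finite.biUnion l.2.2 fun α _ => ?_).subset this
  refine Set.Finite.preimage ?_ ((Set.finite_singleton _).prod (List.finite_toSet _))
  intro p _ p' _ h
  simp only [Prod.mk.injEq] at h
  exact Prod.ext h.1 (PNat.eq h.2)

/-- The set of pairs `(α, n)` such that `n` is a part of the partition belonging to `α`. -/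
noncomputable def StrictFamily.toFinset (l : StrictFamily) : Finset (ELod × ℕ+) :=
  l.finite.toFinset

theorem StrictFamily.mem_toFinset (l : StrictFamily) (p : ELod × ℕ+) :
    p ∈ l.toFinset ↔ (p.2 : ℕ) ∈ l.1 p.1 := by simp [StrictFamily.toFinset]

theorem StrictFamily.toFinset_injective : Function.Injective StrictFamily.toFinset := by
  intro l l' h
  refine Subtype.ext (funext fun α => ?_)
  have hnd : ∀ l : StrictFamily, (l.1 α).Nodup := fun l => (l.2.1 α).1.imp fun h => h.ne'
  refine List.Perm.eq_of_pairwise (le := (· > ·)) (fun a b _ _ h1 h2 => absurd h1 h2.asymm)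
    (l.2.1 α).1 (l'.2.1 α).1 ((List.perm_ext_iff_of_nodup (hnd l) (hnd l')).2 fun n => ?_)
  have h0 : ∀ l : StrictFamily, n ∈ l.1 α → 0 < n := fun l hl => (l.2.1 α).2 n hl
  constructor
  · intro hn
    have := (l.mem_toFinset (α, ⟨n, h0 l hn⟩)).2 hn
    rw [h] at this
    exact (l'.mem_toFinset _).1 this
  · intro hn
    have := (l'.mem_toFinset (α, ⟨n, h0 l' hn⟩)).2 hn
    rw [← h] at this
    exact (l.mem_toFinset _).1 this

theorem StrictFamily.toFinset_surjective : Function.Surjective StrictFamily.toFinset := by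
  classical
  intro S
  have hmem : ∀ α n, n ∈ ((S.filter fun p => p.1 = α).image fun p => (p.2 : ℕ)).sort (· ≥ ·) ↔
      ∃ p ∈ S, p.1 = α ∧ (p.2 : ℕ) = n := by
    intro α n
    simp [and_assoc]
  refine ⟨⟨fun α => ((S.filter fun p => p.1 = α).image fun p => (p.2 : ℕ)).sort (· ≥ ·),
    fun α => ⟨(Finset.sortedGT_sort _).pairwise, fun n hn => ?_⟩, ?_⟩, ?_⟩
  · obtain ⟨p, -, -, rfl⟩ := (hmem α n).1 hn
    exact p.2.pos
  · refine (S.image Prod.fst).finite_toSet.subset fun α hα => ?_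
    obtain ⟨n, hn⟩ := List.exists_mem_of_ne_nil _ hα
    obtain ⟨p, hp, rfl, -⟩ := (hmem α n).1 hn
    exact Finset.mem_image_of_mem _ hp
  · ext p
    rw [StrictFamily.mem_toFinset]
    refine (hmem p.1 p.2).trans ⟨?_, fun hp => ⟨p, hp, rfl, rfl⟩⟩
    rintro ⟨p', hp', h1, h2⟩
    rwa [← Prod.ext h1 (PNat.eq h2)]

theorem StrictFamily.finprod_genQ (l : StrictFamily) :
    ∏ᶠ α : ELod, ((l.1 α).map (genQ α)).prod = ∏ p ∈ l.toFinset, genQ p.1 p.2 := by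
  classical
  rw [finprod_eq_prod_of_mulSupport_subset (s := l.2.2.toFinset)]
  · rw [← Finset.prod_fiberwise_of_maps_to (s := l.toFinset) (t := l.2.2.toFinset) (g := Prod.fst)]
    · refine Finset.prod_congr rfl fun α _ => ?_
      have hnd : (l.1 α).Nodup := (l.2.1 α).1.imp fun h => h.ne'
      rw [← List.prod_toFinset _ hnd]
      symm
      refine Finset.prod_bij (fun p _ => (p.2 : ℕ)) ?_ ?_ ?_ ?_
      · intro p hp
        rw [Finset.mem_filter, StrictFamily.mem_toFinset] at hp
        obtain ⟨hp, rfl⟩ := hp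
        simpa using hp
      · intro p hp p' hp' h
        rw [Finset.mem_filter] at hp hp'
        exact Prod.ext (hp.2.trans hp'.2.symm) (PNat.eq h)
      · intro n hn
        rw [List.mem_toFinset] at hn
        exact ⟨(α, ⟨n, (l.2.1 α).2 n hn⟩), by simpa [StrictFamily.mem_toFinset] using hn, rfl⟩
      · intro p hp
        rw [Finset.mem_filter] at hp
        rw [hp.2]
    · intro p hp
      rw [StrictFamily.mem_toFinset] at hp
      simpa using List.ne_nil_of_mem hp
  · intro α hα
    rw [Set.Finite.coe_toFinset]
    intro h
    simp [h] at hα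

/-! ### Rational polynomial bases -/

theorem aeval_eq_linearCombination {R A ι : Type*} [CommRing R] [CommRing A] [Algebra R A]
    (x : ι → A) (f : MvPolynomial ι R) : MvPolynomial.aeval x f =
      Finsupp.linearCombination R (fun m : ι →₀ ℕ => (m.toMultiset.map x).prod)
        ((MvPolynomial.basisMonomials ι R).repr f) := by
  have : (MvPolynomial.aeval x).toLinearMap = Finsupp.linearCombination R
      (fun m : ι →₀ ℕ => (m.toMultiset.map x).prod) ∘ₗ
        (MvPolynomial.basisMonomials ι R).repr.toLinearMap := by
    refine (MvPolynomial.basisMonomials ι R).ext fun m => ?_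
    simp only [AlgHom.toLinearMap_apply, LinearMap.comp_apply, LinearEquiv.coe_coe,
      Module.Basis.repr_self, Finsupp.linearCombination_single, one_smul]
    rw [MvPolynomial.coe_basisMonomials, MvPolynomial.aeval_monomial, map_one, one_mul]
    induction m using Finsupp.induction_linear with
    | zero => simp
    | add f g hf hg =>
      rw [Finsupp.prod_add_index' (by simp) (by simp [pow_add]), hf, hg]
      simp
    | single a n => simp [Multiset.map_nsmul, Multiset.prod_nsmul]
  exact LinearMap.congr_fun this f

theorem algebraicIndependent_of_linearIndependent {R A ι : Type*} [CommRing R] [CommRing A]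
    [Algebra R A] {x : ι → A}
    (h : LinearIndependent R fun m : ι →₀ ℕ => (m.toMultiset.map x).prod) :
    AlgebraicIndependent R x := by
  rw [algebraicIndependent_iff_injective_aeval]
  intro f g hfg
  rw [aeval_eq_linearCombination, aeval_eq_linearCombination] at hfg
  exact (MvPolynomial.basisMonomials ι R).repr.injective (h hfg)

theorem span_monomials_eq_top {R A ι : Type*} [CommRing R] [CommRing A]
    [Algebra R A] {x : ι → A} (h : Algebra.adjoin R (Set.range x) = ⊤) :
    Submodule.span R (Set.range fun m : ι →₀ ℕ => (m.toMultiset.map x).prod) = ⊤ := by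
  rw [eq_top_iff]
  rintro z -
  have hz : z ∈ Algebra.adjoin R (Set.range x) := by rw [h]; trivial
  rw [Algebra.adjoin_range_eq_range_aeval] at hz
  obtain ⟨f, rfl⟩ := hz
  rw [← Finsupp.range_linearCombination]
  exact ⟨_, (aeval_eq_linearCombination x f).symm⟩

theorem eq_top_of_tmul_mem {A : Type*} [CommRing A] {S : Subalgebra ℚ (ℚ ⊗[ℤ] A)}
    (h : ∀ a : A, (1 : ℚ) ⊗ₜ[ℤ] a ∈ S) : S = ⊤ := by
  rw [eq_top_iff]
  rintro z -
  induction z using TensorProduct.induction_on with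
  | zero => exact S.zero_mem
  | tmul r a =>
    have := S.smul_mem (h a) r
    rwa [TensorProduct.smul_tmul', smul_eq_mul, mul_one] at this
  | add x y hx hy => exact S.add_mem hx hy

theorem adjoin_odd_genQ : Algebra.adjoin ℚ (Set.range fun p : ELod × OddPNat =>
    ((1 : ℚ) ⊗ₜ[ℤ] genQ p.1 p.2.1 : ℚ ⊗[ℤ] PQSym)) = ⊤ := by
  set S := Algebra.adjoin ℚ (Set.range fun p : ELod × OddPNat =>
    ((1 : ℚ) ⊗ₜ[ℤ] genQ p.1 p.2.1 : ℚ ⊗[ℤ] PQSym)) with hS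
  let ι : PQSym →+* ℚ ⊗[ℤ] PQSym := Algebra.TensorProduct.includeRight.toRingHom
  have h0 : ∀ α n, Odd n → ι (genQ α n) ∈ S := by
    intro α n hn
    rw [hS]
    exact Algebra.subset_adjoin (Set.mem_range.2 ⟨(α, ⟨⟨n, hn.pos⟩, hn⟩), rfl⟩)
  have h1 : ∀ α n, ι (genQ α n) ∈ S := fun α =>
    ((isEuler_genQ α).map ι).mem_of_odd (h0 α)
  refine eq_top_of_tmul_mem fun a => ?_
  have ha : a ∈ Algebra.adjoin ℤ (Set.range fun p : ELod × ℕ+ => genQ p.1 p.2) := by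
    rw [adjoin_genQ]; trivial
  rw [Algebra.adjoin_int] at ha
  have h2 : Subring.closure (Set.range fun p : ELod × ℕ+ => genQ p.1 p.2) ≤
      S.toSubring.comap ι := by
    refine Subring.closure_le.2 ?_
    rintro _ ⟨p, rfl⟩
    exact h1 p.1 p.2
  exact h2 ha

theorem isPolynomialBasis_genQ : IsPolynomialBasis ℚ fun p : ELod × OddPNat =>
    ((1 : ℚ) ⊗ₜ[ℤ] genQ p.1 p.2.1 : ℚ ⊗[ℤ] PQSym) := by
  refine ⟨algebraicIndependent_of_linearIndependent ?_, adjoin_odd_genQ⟩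
  refine linearIndependent_of_span_eq_top (peakBasis.baseChange ℚ) (fun w => w.1.sum)
    finite_oddWords (span_monomials_eq_top adjoin_odd_genQ) lyndonConcat_injective
    fun f w h => ?_
  have h1 : (f.toMultiset.map fun p : ELod × OddPNat =>
      ((1 : ℚ) ⊗ₜ[ℤ] genQ p.1 p.2.1 : ℚ ⊗[ℤ] PQSym)).prod =
      (1 : ℚ) ⊗ₜ[ℤ] monomialGenQ (f.toMultiset.map oddPair) := by
    let ι : PQSym →+* ℚ ⊗[ℤ] PQSym := Algebra.TensorProduct.includeRight.toRingHom
    have hι : ∀ a, ι a = (1 : ℚ) ⊗ₜ[ℤ] a := fun _ => rfl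
    rw [← hι, monomialGenQ, map_multiset_prod, Multiset.map_map, Multiset.map_map]
    congr 1
  rw [h1, Module.Basis.baseChange_repr_tmul] at h
  rw [sum_lyndonConcat]
  exact sum_eq_of_repr_monomialGenQ_ne_zero _ (left_ne_zero_of_smul h)

theorem coe_genQ_oneComp (n : ℕ) : (genQ oneComp n : Amb) = qSym n := by
  have : oneComp.1.2.blocks = [1] := by simp [oneComp]
  exact (congrArg (fun w => lambdaL w n) this).trans (lambdaL_one n)

theorem Gam_le_PQSym : Gam ≤ PQSym := by
  refine Subring.closure_le.2 ?_
  rintro _ ⟨n, -, rfl⟩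
  rw [← coe_genQ_oneComp]
  exact (genQ oneComp n).2

/-- The independence is inherited from `PQSym`, which contains `Γ`. -/
theorem isPolynomialBasis_qSym : IsPolynomialBasis ℚ fun n : OddPNat =>
    ((1 : ℚ) ⊗ₜ[ℤ] (⟨qSym n.1, qSym_mem n.1⟩ : Gam) : ℚ ⊗[ℤ] Gam) := by
  constructor
  · let i : Gam →ₐ[ℤ] PQSym := (Subring.inclusion Gam_le_PQSym).toIntAlgHom
    let F : ℚ ⊗[ℤ] Gam →ₐ[ℚ] ℚ ⊗[ℤ] PQSym := Algebra.TensorProduct.map (AlgHom.id ℚ ℚ) i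
    refine AlgebraicIndependent.of_comp F ?_
    have h := isPolynomialBasis_genQ.1.comp (fun n : OddPNat => (oneComp, n))
      fun a b h => (Prod.ext_iff.1 h).2
    convert! h using 1
    ext n
    change (1 : ℚ) ⊗ₜ[ℤ] _ = (1 : ℚ) ⊗ₜ[ℤ] _
    congr 1
    exact Subtype.ext (coe_genQ_oneComp n.1).symm
  · set S := Algebra.adjoin ℚ (Set.range fun n : OddPNat =>
      ((1 : ℚ) ⊗ₜ[ℤ] (⟨qSym n.1, qSym_mem n.1⟩ : Gam) : ℚ ⊗[ℤ] Gam)) with hS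
    let ι : Gam →+* ℚ ⊗[ℤ] Gam := Algebra.TensorProduct.includeRight.toRingHom
    have hmem : ∀ n, qSym n ∈ Gam := by
      intro n
      rcases Nat.eq_zero_or_pos n with rfl | hn
      · rw [← lambdaL_one, lambdaL_zero]; exact Gam.one_mem
      · exact qSym_mem ⟨n, hn⟩
    have hE : IsEuler fun n => (⟨qSym n, hmem n⟩ : Gam) := by
      refine IsEuler.of_map (f := Gam.subtype) Subtype.val_injective ?_
      have := isEuler_lambdaL (w := [1]) (by simp)
      rwa [show lambdaL [1] = qSym from funext lambdaL_one] at this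
    have h0 : ∀ n, Odd n → ι ⟨qSym n, hmem n⟩ ∈ S := by
      intro n hn
      rw [hS]
      exact Algebra.subset_adjoin (Set.mem_range.2 ⟨⟨⟨n, hn.pos⟩, hn⟩, rfl⟩)
    have h1 : ∀ n, ι ⟨qSym n, hmem n⟩ ∈ S := (hE.map ι).mem_of_odd h0
    refine eq_top_of_tmul_mem fun a => ?_
    obtain ⟨a, ha⟩ := a
    have h2 : Gam ≤ (S.toSubring.comap ι).map Gam.subtype := by
      refine Subring.closure_le.2 ?_
      rintro _ ⟨n, -, rfl⟩
      exact ⟨⟨qSym n, hmem n⟩, h1 n, rfl⟩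
    obtain ⟨b, hb, hba⟩ := h2 ha
    rw [← show b = ⟨a, ha⟩ from Subtype.ext hba]
    exact hb

end Peak

theorem theorem3p8 :
    ∃ q : Peak.ELod → ℕ → Peak.PQSym,
      -- the elements `q_n(α) = λ̃^n(L_α)` lie in `PQSym`
      (∀ (α : Peak.ELod) (n : ℕ),
        (q α n : Peak.Amb) = Peak.lambdaOp n (Peak.monomialPeak α.1)) ∧
      -- (i) generators of the ring `PQSym`
      Algebra.adjoin ℤ (Set.range fun p : Peak.ELod × ℕ+ => q p.1 p.2) = ⊤ ∧
      -- the Euler relations are a complete set of relations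
      RingHom.ker (MvPolynomial.aeval (R := ℤ) fun p : Peak.ELod × ℕ+ => q p.1 p.2) =
        Ideal.span (Set.range fun p : Peak.ELod × ℕ+ => Peak.eulerRel p.1 p.2) ∧
      -- the integral basis
      LinearIndependent ℤ
        (fun l : Peak.StrictFamily => ∏ᶠ α : Peak.ELod, ((l.1 α).map (q α)).prod) ∧
      Submodule.span ℤ (Set.range
        (fun l : Peak.StrictFamily => ∏ᶠ α : Peak.ELod, ((l.1 α).map (q α)).prod)) = ⊤ ∧
      -- (ii) the polynomial basis over the rationals
      Peak.IsPolynomialBasis ℚ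
        (fun p : Peak.ELod × {n : ℕ+ // Odd (n : ℕ)} =>
          ((1 : ℚ) ⊗ₜ[ℤ] q p.1 p.2.1 : ℚ ⊗[ℤ] Peak.PQSym)) ∧
      -- it contains the symmetric functions `q_n`, `n` odd, a polynomial basis of `Γ_ℚ`
      (∀ n : ℕ+, (q Peak.oneComp n : Peak.Amb) = Peak.qSym n) ∧
      Peak.IsPolynomialBasis ℚ
        (fun n : {n : ℕ+ // Odd (n : ℕ)} =>
          ((1 : ℚ) ⊗ₜ[ℤ] (⟨Peak.qSym n.1, Peak.qSym_mem n.1⟩ : Peak.Gam) :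
            ℚ ⊗[ℤ] Peak.Gam)) := by
  refine ⟨Peak.genQ, fun α n => (Peak.lambdaOp_monomialPeak n α.1).symm, Peak.adjoin_genQ,
    Peak.ker_aeval_genQ, ?_, ?_, Peak.isPolynomialBasis_genQ,
    fun n => Peak.coe_genQ_oneComp n, Peak.isPolynomialBasis_qSym⟩
  · simp only [Peak.StrictFamily.finprod_genQ]
    exact Peak.linearIndependent_squarefree_genQ.comp _ Peak.StrictFamily.toFinset_injective
  · simp only [Peak.StrictFamily.finprod_genQ]
    rw [← Peak.span_squarefree_genQ]
    exact congrArg _ (Peak.StrictFamily.toFinset_surjective.range_comp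
      fun S : Finset (Peak.ELod × ℕ+) => ∏ p ∈ S, Peak.genQ p.1 p.2)
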